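/- Let $d\ge 1$, $\beta>0$, $T>0$. Let $\mathcal P$ be the set of probability densities on $\mathbb R^d$ with finite second moment, and let $\mathcal D\subset\mathcal P$ be the set of $\rho=e^{-V_0}\in\mathcal P$ with $V_0\in C^2$, $D^2V_0$ bounded and $\lim_{|x|\to\infty}\nabla V_0(x)\cdot\frac{x}{|x|}=\infty$. Let $p_0^*\in\mathcal D$, and let $h\in C^2(\mathbb R^d)\cap L^2(\mathbb R^d;p_0^*)$ have bounded Hessian $D^2h$ and $\liminf_{|x|\to\infty}\nabla h(x)\cdot\frac{x}{|x|}>-\infty$. For $\rho\in\mathcal P$ and a vector field $u$ write $\hat h=\int h\rho\,dx$ and $$\mathsf L(\rho,u)=\frac12\int\Big|\frac1\rho\nabla\cdot(\rho u)\Big|^2\rho\,dx+\frac{\beta^2}{2}\int|h-\hat h|^2\rho\,dx\in[0,\infty],\qquad \mathsf H(\rho,\mathsf q,u)=\mathsf L(\rho,u)-\int \mathsf q\,\nabla\cdot(\rho u)\,dx ,$$ where $\frac1\rho\nabla\cdot(\rho u)=g$ is meant weakly ($\int\phi\, g\rho\,dx=-\int\nabla\phi\cdot u\,\rho\,dx$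 for all $\phi\in C^1_c(\mathbb R^d)$), and $\mathsf L=\mathsf H=\infty$ if no such $g$ exists. For $t\in[0,T]$ and $\rho\in\mathcal D$ consider all pairs $(\rho_s,u_s)_{s\in[t,T]}$, jointly measurable in $(s,x)$, with $\rho_s\in\mathcal P$, $\rho_t=\rho$, $\int_t^T\!\int|u_s|^2\rho_s\,dx\,ds<\infty$, that solve $\partial_s\rho_s+\nabla\cdot(\rho_su_s)=0$ weakly. Let $$V(\rho,t)=\inf_{(\rho_s,u_s)}\Big[\int_t^T\mathsf L(\rho_s,u_s)\,ds+\beta\int h\rho_T\,dx\Big]$$ be the value function; for $t=0$, $\rho=p_0^*$ the bracket is the cost $J(u)$. The derivative $\frac{\partial F}{\partial\rho}(\rho)\in L^2(\mathbb R^d;\rho)$ of a functional $F$ on $\mathcal D$ is a function $\Theta$ (determined up to an additive constant) such that $\frac{d}{ds}F(\rho_s)|_{s=0}=-\int\Theta\,\nabla\cdot(\rho u_0)\,dx$ for every path $\rho_s\in\mathcal D$, $|s|<\varepsilon$, with $\rho_0=\rho$ and $\partial_s\rho_s=-\nabla\cdot(\rho_su_s)$ weakly, where the $u_s$ are continuous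 vector fields supported in a common compact set and $\frac1\rho\nabla\cdot(\rho u_0)\in L^2(\mathbb R^d;\rho)$. Then: 1. $V$ solves the dynamic programming equation, for all $\rho\in\mathcal D$: both derivatives below exist and $$\frac{\partial V}{\partial t}(\rho,t)+\inf_{u\in L^2(\mathbb R^d;\rho)}\mathsf H\Big(\rho,\frac{\partial V}{\partial\rho}(\rho,t),u\Big)=0,\quad t\in[0,T),\qquad V(\rho,T)=\beta\int h\rho\,dx .$$ 2. $V(\rho,t)=\beta\int h(x)\rho(x)\,dx$ for all $\rho\in\mathcal D$, $t\in[0,T]$. This functional solves the dynamic programming equation, with $\frac{\partial V}{\partial\rho}(\rho,t)=\beta h$. 3. For $\rho\in\mathcal D$, $t\in[0,T)$, the infimum in the dynamic programming equation is attained, and $u\in L^2(\mathbb R^d;\rho)$ attains it if and only if $$\frac1\rho\nabla\cdot(\rho u)=\beta(h-\hat h)\qquad(\ast)$$ weakly on $\mathbb R^d$. For $\rho\in\mathcal D$, $t\in[0,T]$, the control problem on $[t,T]$ started at $\rho$ has an optimal pair, and an admissible pair $(\rho_s,u_s)$ is optimal if and only if, for almost every $s\in[t,T]$, $(\ast)$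 holds with $(\rho,u)=(\rho_s,u_s)$. In particular this holds for the problem of minimizing $J$, whose minimum is $\beta\int h\,p_0^*\,dx$. -/

import Mathlib

open MeasureTheory Set Filter Topology
open scoped ENNReal

namespace MeanFieldControl

/-- The Euclidean space of dimension `d`. -/
abbrev E (d : ℕ) : Type := EuclideanSpace ℝ (Fin d)

variable {d : ℕ}

/-- The class of probability densities with finite second moment. -/
structure IsDensity (ρ : E d → ℝ) : Prop where
  measurable : Measurable ρ
  nonneg : ∀ x, 0 ≤ ρ x
  integrable : Integrable ρ
  integral_eq_one : ∫ x, ρ x = 1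
  second_moment : Integrable (fun x => ‖x‖ ^ 2 * ρ x)

/-- The measure `ρ(x) dx`. -/
noncomputable def law (ρ : E d → ℝ) : Measure (E d) :=
  volume.withDensity (fun x => ENNReal.ofReal (ρ x))

/-- The mean `∫ h ρ dx`, written with a hat over `h` in the text. -/
noncomputable def mean (ρ h : E d → ℝ) : ℝ := ∫ x, h x ∂(law ρ)

/-- Assumption (A1): a density of the form `exp (-V₀)` with `V₀` of class `C²`, bounded Hessian,
and `∇V₀(x) · x / |x| → ∞` as `|x| → ∞`. -/
structure AssumptionA1 (ρ : E d → ℝ) : Prop where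
  density : IsDensity ρ
  exp_form : ∃ V₀ : E d → ℝ, ContDiff ℝ 2 V₀ ∧ (∀ x, ρ x = Real.exp (-V₀ x)) ∧
    (∃ C : ℝ, ∀ x, ‖iteratedFDeriv ℝ 2 V₀ x‖ ≤ C) ∧
    Tendsto (fun x => fderiv ℝ V₀ x x / ‖x‖) (cocompact (E d)) atTop

/-- Assumption (A2): `h` is `C²`, in `L²(p₀)`, with bounded Hessian, and the lower limit of
`∇h(x) · x / |x|` as `|x| → ∞` is larger than `-∞`. -/
structure AssumptionA2 (p₀ h : E d → ℝ) : Prop where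
  contDiff : ContDiff ℝ 2 h
  memLp : MemLp h 2 (law p₀)
  hessian_bounded : ∃ C : ℝ, ∀ x, ‖iteratedFDeriv ℝ 2 h x‖ ≤ C
  liminf_radial : ∃ c : ℝ, ∀ᶠ x in cocompact (E d), c ≤ fderiv ℝ h x x / ‖x‖

/-- Continuously differentiable, compactly supported test functions. -/
def IsTest (φ : E d → ℝ) : Prop := ContDiff ℝ 1 φ ∧ HasCompactSupport φ

/-- `g = (1/ρ) ∇·(ρ u)` in the weak sense: `∇·(ρ u) = ρ g` as distributions.
Such a `g` is unique up to equality almost everywhere for `ρ(x) dx`. -/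
def HasWeightedDiv (ρ : E d → ℝ) (u : E d → E d) (g : E d → ℝ) : Prop :=
  LocallyIntegrable u (law ρ) ∧ LocallyIntegrable g (law ρ) ∧
    ∀ φ : E d → ℝ, IsTest φ →
      ∫ x, φ x * g x ∂(law ρ) = -∫ x, fderiv ℝ φ x (u x) ∂(law ρ)

open Classical in
/-- The function `(1/ρ) ∇·(ρ u)`; the value `0` is a dummy when it does not exist. -/
noncomputable def weightedDiv (ρ : E d → ℝ) (u : E d → E d) : E d → ℝ :=
  if hg : ∃ g, HasWeightedDiv ρ u g then hg.choose else 0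

open Classical in
/-- The Lagrangian
`L(ρ,u) = ½ ∫ |(1/ρ) ∇·(ρ u)|² ρ dx + (β²/2) ∫ |h - ĥ|² ρ dx`, with values in `[0,∞]`;
the first term is `∞` when `ρ u` has no weak divergence of the form `ρ g`. -/
noncomputable def lagrangian (β : ℝ) (h ρ : E d → ℝ) (u : E d → E d) : ℝ≥0∞ :=
  (if ∃ g, HasWeightedDiv ρ u g then
    ENNReal.ofReal (1 / 2) * ∫⁻ x, ‖weightedDiv ρ u x‖ₑ ^ 2 ∂(law ρ) else ⊤)
  + ENNReal.ofReal (β ^ 2 / 2) * ∫⁻ x, ‖h x - mean ρ h‖ₑ ^ 2 ∂(law ρ)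

/-- The Hamiltonian `H(ρ,q,u) = L(ρ,u) - ∫ q ∇·(ρ u) dx`; it is `∞` whenever `L(ρ,u)` is. -/
noncomputable def hamiltonian (β : ℝ) (h ρ q : E d → ℝ) (u : E d → E d) : EReal :=
  (lagrangian β h ρ u : EReal) - ((∫ x, q x * weightedDiv ρ u x ∂(law ρ) : ℝ) : EReal)

/-- The infimum of the Hamiltonian over the controls `u ∈ L²(ρ)`. -/
noncomputable def minHamiltonian (β : ℝ) (h ρ q : E d → ℝ) : EReal :=
  ⨅ (u : E d → E d) (_ : MemLp u 2 (law ρ)), hamiltonian β h ρ q u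

/-- `(ρ,u)` is an admissible pair (trajectory of densities, control) on `[t,T]` started at `ρ₀`:
`u` has finite energy and `∂ρ/∂s + ∇·(ρ u) = 0` holds weakly, with `ρ_t = ρ₀`. -/
structure IsAdmissible (t T : ℝ) (ρ₀ : E d → ℝ) (ρ : ℝ → E d → ℝ) (u : ℝ → E d → E d) : Prop where
  measurable_density : Measurable (Function.uncurry ρ)
  measurable_control : Measurable (Function.uncurry u)
  density : ∀ s ∈ Icc t T, IsDensity (ρ s)
  initial : ρ t = ρ₀
  energy : ∫⁻ s in Icc t T, ∫⁻ x, ‖u s x‖ₑ ^ 2 ∂(law (ρ s)) < ⊤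
  continuity : ∀ φ : E d → ℝ, IsTest φ → ∀ s ∈ Icc t T,
    (∫ x, φ x ∂(law (ρ s))) - ∫ x, φ x ∂(law (ρ t))
      = ∫ r in t..s, ∫ x, fderiv ℝ φ x (u r x) ∂(law (ρ r))

/-- The cost on `[t,T]`: `∫_t^T L(ρ_s,u_s) ds + β ∫ h ρ_T dx`. For `t = 0` this is `J`. -/
noncomputable def cost (β : ℝ) (h : E d → ℝ) (t T : ℝ) (ρ : ℝ → E d → ℝ) (u : ℝ → E d → E d) :
    EReal :=
  ((∫⁻ s in Icc t T, lagrangian β h (ρ s) (u s) : ℝ≥0∞) : EReal)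
    + ((β * ∫ x, h x ∂(law (ρ T)) : ℝ) : EReal)

/-- The value function: the infimum of the cost on `[t,T]` over the admissible pairs
started at `ρ₀` at time `t`. -/
noncomputable def valueFunction (β : ℝ) (h : E d → ℝ) (T : ℝ) (ρ₀ : E d → ℝ) (t : ℝ) : EReal :=
  ⨅ (ρ : ℝ → E d → ℝ) (u : ℝ → E d → E d) (_ : IsAdmissible t T ρ₀ ρ u), cost β h t T ρ u

/-- `(ρ,u)` is an optimal pair for the control problem on `[t,T]` started at `ρ₀`. -/
def IsOptimal (β : ℝ) (h : E d → ℝ) (t T : ℝ) (ρ₀ : E d → ℝ)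
    (ρ : ℝ → E d → ℝ) (u : ℝ → E d → E d) : Prop :=
  IsAdmissible t T ρ₀ ρ u ∧
    ∀ (ρ' : ℝ → E d → ℝ) (u' : ℝ → E d → E d), IsAdmissible t T ρ₀ ρ' u' →
      cost β h t T ρ u ≤ cost β h t T ρ' u'

/-- The control law `(1/ρ) ∇·(ρ u) = β (h - ĥ)`, as a partial differential equation for `u`. -/
def SolvesControlPDE (β : ℝ) (h ρ : E d → ℝ) (u : E d → E d) : Prop :=
  HasWeightedDiv ρ u (fun x => β * (h x - mean ρ h))

/-- A variation of `ρ`: a path `ρ_s`, `|s| < ε`, of densities satisfying (A1) with `ρ_0 = ρ`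
and `∂ρ_s/∂s = -∇·(ρ_s u_s)`, for continuous vector fields `u_s` supported in a common
compact set. -/
structure IsVariation (ρ : E d → ℝ) (ε : ℝ) (path : ℝ → E d → ℝ) (u : ℝ → E d → E d) : Prop where
  pos : 0 < ε
  density : ∀ s ∈ Ioo (-ε) ε, AssumptionA1 (path s)
  initial : path 0 = ρ
  continuous : ∀ s ∈ Ioo (-ε) ε, Continuous (u s)
  support : ∃ K : Set (E d), IsCompact K ∧ ∀ s ∈ Ioo (-ε) ε, ∀ x ∉ K, u s x = 0
  continuity : ∀ φ : E d → ℝ, IsTest φ → ∀ s ∈ Ioo (-ε) ε,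
    HasDerivAt (fun r => ∫ x, φ x ∂(law (path r))) (∫ x, fderiv ℝ φ x (u s x) ∂(law (path s))) s

/-- `Θ ∈ L²(ρ)` is the (Gâteaux) derivative at `ρ` of the functional `F` of densities:
`d/ds F(ρ_s) = -∫ Θ ∇·(ρ u) dx` at `s = 0` along every variation `ρ_s` of `ρ` with initial
velocity field `u`. It is determined up to an additive constant. -/
def HasGateauxDeriv (F : (E d → ℝ) → ℝ) (ρ Θ : E d → ℝ) : Prop :=
  MemLp Θ 2 (law ρ) ∧
    ∀ (ε : ℝ) (path : ℝ → E d → ℝ) (u : ℝ → E d → E d) (g : E d → ℝ),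
      IsVariation ρ ε path u → HasWeightedDiv ρ (u 0) g → MemLp g 2 (law ρ) →
        HasDerivAt (fun s => F (path s)) (-∫ x, Θ x * g x ∂(law ρ)) 0

/-- `W` solves the dynamic programming equation
`∂W/∂t (ρ,t) + inf_{u ∈ L²} H(ρ, ∂W/∂ρ (ρ,t), u) = 0` for `t ∈ [0,T)`,
`W(ρ,T) = β ∫ h ρ dx`, at every density `ρ` satisfying (A1). Both derivatives exist, and the
equation holds for every representative `Θ` of `∂W/∂ρ`. -/
def SolvesDP (β : ℝ) (h : E d → ℝ) (T : ℝ) (W : (E d → ℝ) → ℝ → ℝ) : Prop :=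
  (∀ ρ : E d → ℝ, AssumptionA1 ρ → ∀ t ∈ Ico 0 T,
    (∃ Θ : E d → ℝ, HasGateauxDeriv (fun ρ' => W ρ' t) ρ Θ) ∧
    ∃ a : ℝ, HasDerivWithinAt (fun s => W ρ s) a (Icc 0 T) t ∧
      ∀ Θ : E d → ℝ, HasGateauxDeriv (fun ρ' => W ρ' t) ρ Θ →
        (a : EReal) + minHamiltonian β h ρ Θ = 0) ∧
  ∀ ρ : E d → ℝ, AssumptionA1 ρ → W ρ T = β * ∫ x, h x ∂(law ρ)

end MeanFieldControl

namespace MeanFieldControl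

variable {d : ℕ}

/-! ### The measure with density `ρ` -/

/-! The theorem rests on completing a square. Write g for the weighted divergence of u and w = β(h -
ĥ). Integration by parts gives ∫ g (h - ĥ) ρ = -∫ ∇h·u ρ, hence L(ρ,u) = -β ∫ ∇h·u ρ + ½ ∫ (g - w)²
ρ (`lagrangian_eq_square`). The continuity equation tested against h turns the time integral of the
first term into β ∫ h ρ_t - β ∫ h ρ_T, so the terminal cost cancels. Formally, the cost is β ∫ h ρ_t
plus half the space-time integral of (g - w)². This yields the lower bound, and equality exactly
when g = w for almost every time.

Several points need work. Since h grows quadratically, it is approximated by cutoffs whose gradients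
stay of linear growth, and `exists_moment_bound` bounds the second moments along any finite-energy
pair. Measurability of g in time is bypassed: `le_lagrangian` replaces the square by a square tested
against one function, and a countable C¹-dense family of test functions recovers the control law at
almost every time. Conversely, a pair that satisfies the control law must be shown to have finite
cost, that is, h must stay in L²(ρ_s). The law reads ∂ρ = -β(h - ĥ)ρ, so with h bounded below
linearly the density grows at most by a factor exponential in |x| (`lintegral_le_exp`), which the
exponential moments of the initial density absorb.

The lower bound is attained by the Gibbs path ρ_s ∝ ρ₀ exp(-β(s-t)h), which solves ∂ρ = -β(h - ĥ)ρ.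
A velocity of finite energy with divergence w exists by Riesz representation as soon as a Poincaré
inequality holds uniformly in s (`exists_control`). Working over space-time at once makes the
velocity jointly measurable. The Poincaré inequality follows from a Lyapunov argument: the bounded
field x/√(1+|x|²) controls the far region because the potential grows superlinearly in the radial
direction, and the flat inequality on a ball controls the rest (`weighted_poincare`).

The value function is thus the linear functional β ∫ h ρ. Its time derivative vanishes. Its
derivative in ρ is βh, uniquely up to a constant because the paths of `exists_isVariation` test
against all derivatives of smooth functions. With such a derivative the Hamiltonian is exactly ½ ∫
(g - w)² ρ, so its infimum is 0 and the minimizers solve the control law. -/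

theorem integral_law {ρ : E d → ℝ} (hm : Measurable ρ) (h0 : ∀ x, 0 ≤ ρ x) (f : E d → ℝ) :
    ∫ x, f x ∂(law ρ) = ∫ x, ρ x * f x := by
  rw [law, integral_withDensity_eq_integral_toReal_smul (by fun_prop) (by simp)]
  simp [ENNReal.toReal_ofReal, h0]

theorem integrable_law_iff {ρ : E d → ℝ} (hm : Measurable ρ) (h0 : ∀ x, 0 ≤ ρ x) {f : E d → ℝ} :
    Integrable f (law ρ) ↔ Integrable (fun x => ρ x * f x) := by
  rw [law, integrable_withDensity_iff_integrable_smul' (by fun_prop) (by simp)]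
  simp [ENNReal.toReal_ofReal, h0]

theorem IsDensity.isProbabilityMeasure {ρ : E d → ℝ} (hρ : IsDensity ρ) :
    IsProbabilityMeasure (law ρ) := by
  constructor
  rw [law, withDensity_apply _ MeasurableSet.univ, Measure.restrict_univ,
    ← ofReal_integral_eq_lintegral_ofReal hρ.integrable (ae_of_all _ hρ.nonneg),
    hρ.integral_eq_one, ENNReal.ofReal_one]

theorem IsDensity.integrable_sq {ρ : E d → ℝ} (hρ : IsDensity ρ) :
    Integrable (fun x => (1 + ‖x‖) ^ 2) (law ρ) := by
  have := hρ.isProbabilityMeasure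
  have h1 : Integrable (fun x : E d => 2 + 2 * ‖x‖ ^ 2) (law ρ) := by
    refine (integrable_const _).add (Integrable.const_mul ?_ 2)
    rw [integrable_law_iff hρ.measurable hρ.nonneg]
    simpa [mul_comm] using hρ.second_moment
  refine h1.mono' (by fun_prop) (ae_of_all _ fun x => ?_)
  rw [Real.norm_of_nonneg (by positivity)]
  nlinarith [sq_nonneg (1 - ‖x‖)]

/-! ### Growth of functions with bounded Hessian -/

/-- A `C¹` function with at most quadratic growth and gradient of at most linear growth. -/
structure QuadGrowth (C : ℝ) (f : E d → ℝ) : Prop where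
  contDiff : ContDiff ℝ 1 f
  bound : ∀ x, |f x| ≤ C * (1 + ‖x‖) ^ 2
  bound_fderiv : ∀ x, ‖fderiv ℝ f x‖ ≤ C * (1 + ‖x‖)

theorem QuadGrowth.nonneg {C : ℝ} {f : E d → ℝ} (h : QuadGrowth C f) : 0 ≤ C := by
  have := (norm_nonneg _).trans (h.bound_fderiv 0)
  simpa using this

theorem QuadGrowth.const (c : ℝ) : QuadGrowth |c| (fun _ : E d => c) where
  contDiff := contDiff_const
  bound x := by
    have : 1 ≤ (1 + ‖x‖) ^ 2 := by nlinarith [norm_nonneg x]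
    nlinarith [abs_nonneg c]
  bound_fderiv x := by
    rw [fderiv_const_apply, norm_zero]
    positivity

theorem norm_sub_le_of_fderiv_le {F : Type*} [NormedAddCommGroup F] [NormedSpace ℝ F]
    {f : E d → F} (hf : Differentiable ℝ f) {R C : ℝ}
    (hC : ∀ x, ‖x‖ ≤ R → ‖fderiv ℝ f x‖ ≤ C) {x : E d} (hx : ‖x‖ ≤ R) :
    ‖f x - f 0‖ ≤ C * ‖x‖ := by
  have hR : 0 ≤ R := (norm_nonneg x).trans hx
  have := (convex_closedBall (0 : E d) R).norm_image_sub_le_of_norm_fderiv_le (f := f) (𝕜 := ℝ)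
    (C := C) (x := 0) (y := x) (fun y _ => hf y)
    (fun y hy => hC y (by simpa using hy)) (by simpa using hR) (by simpa using hx)
  simpa using this

/-- The mean value inequality is applied twice from the origin, first to the gradient and then to
the function. This is the only way in which the bounded Hessian of h is used. -/
theorem exists_quadGrowth {f : E d → ℝ} (hf : ContDiff ℝ 2 f)
    (hC : ∃ C : ℝ, ∀ x, ‖iteratedFDeriv ℝ 2 f x‖ ≤ C) : ∃ C, QuadGrowth C f := by
  obtain ⟨C, hC⟩ := hC
  have hC0 : 0 ≤ C := (norm_nonneg _).trans (hC 0)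
  have h1 : ∀ x, ‖fderiv ℝ (fderiv ℝ f) x‖ ≤ C := by
    intro x
    have := hC x
    rwa [← norm_iteratedFDeriv_fderiv, ← norm_iteratedFDeriv_fderiv,
      norm_iteratedFDeriv_zero] at this
  have hd' : Differentiable ℝ (fderiv ℝ f) :=
    (hf.fderiv_right (m := 1) (by norm_num)).differentiable (by norm_num)
  have h2 : ∀ x, ‖fderiv ℝ f x‖ ≤ (C + ‖fderiv ℝ f 0‖) * (1 + ‖x‖) := by
    intro x
    have h3 := norm_sub_le_of_fderiv_le hd' (R := ‖x‖) (C := C) (fun y _ => h1 y) le_rfl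
    have h4 : ‖fderiv ℝ f x‖ ≤ ‖fderiv ℝ f 0‖ + ‖fderiv ℝ f x - fderiv ℝ f 0‖ := by
      simpa using norm_add_le (fderiv ℝ f 0) (fderiv ℝ f x - fderiv ℝ f 0)
    nlinarith [norm_nonneg x, norm_nonneg (fderiv ℝ f 0)]
  have hB : 0 ≤ C + ‖fderiv ℝ f 0‖ := by positivity
  refine ⟨C + ‖fderiv ℝ f 0‖ + |f 0|, hf.of_le (by norm_num), fun x => ?_, fun x => ?_⟩
  · have h3 := norm_sub_le_of_fderiv_le (hf.differentiable (by norm_num)) (R := ‖x‖)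
      (C := (C + ‖fderiv ℝ f 0‖) * (1 + ‖x‖)) (fun y hy => (h2 y).trans (by gcongr)) le_rfl
    have h4 : |f x| ≤ |f 0| + ‖f x - f 0‖ := by
      simpa using abs_add_le (f 0) (f x - f 0)
    have h5 : 1 ≤ (1 + ‖x‖) ^ 2 := by nlinarith [norm_nonneg x]
    have h6 : (1 + ‖x‖) * ‖x‖ ≤ (1 + ‖x‖) ^ 2 := by nlinarith [norm_nonneg x]
    nlinarith [abs_nonneg (f 0)]
  · nlinarith [h2 x, abs_nonneg (f 0), norm_nonneg x]

/-- A lower bound for the radial derivative at infinity integrates to a linear lower bound. -/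
theorem exists_linear_lower_bound {f : E d → ℝ} (hf : ContDiff ℝ 1 f) {A : ℝ}
    (hA : ∀ᶠ x in cocompact (E d), A ≤ fderiv ℝ f x x / ‖x‖) :
    ∃ C, 0 ≤ C ∧ ∀ x, A * ‖x‖ - C ≤ f x := by
  obtain ⟨R, hR1, hR⟩ : ∃ R : ℝ, 1 ≤ R ∧ ∀ x : E d, R ≤ ‖x‖ → A ≤ fderiv ℝ f x x / ‖x‖ := by
    rw [← Metric.cobounded_eq_cocompact, ← comap_norm_atTop, eventually_comap,
      eventually_atTop] at hA
    obtain ⟨R, hR⟩ := hA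
    exact ⟨max R 1, le_max_right _ _, fun x hx => hR _ ((le_max_left _ _).trans hx) x rfl⟩
  have hcont : Continuous fun x => |f x - A * ‖x‖| := by
    have := hf.continuous
    fun_prop
  obtain ⟨C, hC⟩ := (isCompact_closedBall (0 : E d) R).bddAbove_image hcont.continuousOn
  have hC' : ∀ x : E d, ‖x‖ ≤ R → |f x - A * ‖x‖| ≤ C := fun x hx =>
    hC ⟨x, by simpa using hx, rfl⟩
  refine ⟨C, (abs_nonneg _).trans (hC' 0 (by simp; linarith)), fun x => ?_⟩
  rcases le_or_gt ‖x‖ R with hx | hx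
  · have := neg_le_of_abs_le (hC' x hx); linarith
  have hx0 : 0 < ‖x‖ := by linarith
  set e : E d := ‖x‖⁻¹ • x with he
  have hen : ‖e‖ = 1 := by rw [he, norm_smul, norm_inv, norm_norm, inv_mul_cancel₀ hx0.ne']
  -- Along the ray through x this function is nondecreasing beyond R, so its value at ‖x‖ is at
  -- least its value at R, which is at least -C by compactness of the ball.
  let g : ℝ → ℝ := fun τ => f (τ • e) - A * τ
  have hder : ∀ τ, HasDerivAt g (fderiv ℝ f (τ • e) e - A) τ := by
    intro τ
    have h1 : HasDerivAt (fun τ : ℝ => τ • e) e τ := by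
      simpa using (hasDerivAt_id τ).smul_const e
    have h2 := ((hf.differentiable (by norm_num)) (τ • e)).hasFDerivAt.comp_hasDerivAt τ h1
    have h3 : HasDerivAt g (fderiv ℝ f (τ • e) e - A * 1) τ :=
      h2.sub ((hasDerivAt_id τ).const_mul A)
    rwa [mul_one] at h3
  have hmono : MonotoneOn g (Icc R ‖x‖) := by
    refine monotoneOn_of_deriv_nonneg (convex_Icc _ _)
      (fun τ _ => (hder τ).continuousAt.continuousWithinAt)
      (fun τ _ => (hder τ).differentiableAt.differentiableWithinAt) fun τ hτ => ?_
    rw [interior_Icc] at hτ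
    rw [(hder τ).deriv]
    have hτ0 : 0 < τ := by linarith [hτ.1]
    have hn : ‖τ • e‖ = τ := by rw [norm_smul, hen, mul_one, Real.norm_of_nonneg hτ0.le]
    have := hR (τ • e) (by rw [hn]; exact hτ.1.le)
    rw [hn, map_smul, smul_eq_mul, mul_div_cancel_left₀ _ hτ0.ne'] at this
    linarith
  have h1 := hmono ⟨le_rfl, hx.le⟩ ⟨hx.le, le_rfl⟩ hx.le
  have h2 : ‖x‖ • e = x := by rw [he, smul_smul, mul_inv_cancel₀ hx0.ne', one_smul]
  have hRn : ‖R • e‖ = R := by rw [norm_smul, hen, mul_one, Real.norm_of_nonneg (by linarith)]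
  have h3 := neg_le_of_abs_le (hC' (R • e) hRn.le)
  simp only [g, h2] at h1
  rw [hRn] at h3
  linarith

/-! ### Cutoff functions -/

/-- A smooth function equal to `1` on the unit ball, supported in the ball of radius `2`. -/
noncomputable def unitBump (d : ℕ) : ContDiffBump (0 : E d) := ⟨1, 2, by norm_num, by norm_num⟩

/-- Smooth cutoff functions, equal to `1` on the ball of radius `n + 1`. -/
noncomputable def cutoff (n : ℕ) (x : E d) : ℝ := unitBump d (((n : ℝ) + 1)⁻¹ • x)

theorem cutoff_contDiff (n : ℕ) {m : ℕ∞} : ContDiff ℝ m (cutoff (d := d) n) :=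
  (unitBump d).contDiff.comp (contDiff_const_smul _)

theorem cutoff_nonneg (n : ℕ) (x : E d) : 0 ≤ cutoff n x := (unitBump d).nonneg

theorem cutoff_le_one (n : ℕ) (x : E d) : cutoff n x ≤ 1 := (unitBump d).le_one

theorem norm_scale (n : ℕ) (x : E d) : ‖((n : ℝ) + 1)⁻¹ • x‖ = ‖x‖ / (n + 1) := by
  rw [norm_smul, norm_inv, Real.norm_of_nonneg (by positivity), inv_mul_eq_div]

theorem cutoff_eq_one {n : ℕ} {x : E d} (hx : ‖x‖ ≤ n + 1) : cutoff n x = 1 := by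
  refine (unitBump d).one_of_mem_closedBall ?_
  rw [mem_closedBall_zero_iff, norm_scale]
  exact (div_le_one (by positivity)).2 hx

theorem cutoff_eq_zero {n : ℕ} {x : E d} (hx : 2 * (n + 1 : ℝ) ≤ ‖x‖) : cutoff n x = 0 := by
  refine (unitBump d).zero_of_le_dist ?_
  rw [dist_zero_right, norm_scale, le_div_iff₀ (by positivity)]
  exact hx

theorem cutoff_hasCompactSupport (n : ℕ) : HasCompactSupport (cutoff (d := d) n) := by
  refine HasCompactSupport.intro (isCompact_closedBall 0 (2 * (n + 1 : ℝ))) fun x hx => ?_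
  refine cutoff_eq_zero ?_
  simp only [mem_closedBall_zero_iff, not_le] at hx
  exact hx.le

/-- Equality holds near x, not only at x, so that derivatives of products with the cutoff agree as
well. -/
theorem eventually_cutoff_eq_one (x : E d) : ∀ᶠ n in atTop, ∀ᶠ y in 𝓝 x, cutoff n y = 1 := by
  obtain ⟨N, hN⟩ := exists_nat_gt ‖x‖
  filter_upwards [eventually_ge_atTop N] with n hn
  have : ∀ᶠ y in 𝓝 x, ‖y‖ < (n : ℝ) :=
    (continuous_norm.tendsto x).eventually (gt_mem_nhds (hN.trans_le (by exact_mod_cast hn)))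
  filter_upwards [this] with y hy
  exact cutoff_eq_one (by linarith)

/-- The gradient is of order 1/(n+1) and vanishes beyond radius 2(n+1), where 1 + ‖x‖ is of order
n+1. This scale invariance keeps truncations of functions of quadratic growth under control. -/
theorem exists_fderiv_cutoff_le (d : ℕ) :
    ∃ C, 0 ≤ C ∧ ∀ n (x : E d), ‖fderiv ℝ (cutoff n) x‖ * (1 + ‖x‖) ≤ C := by
  obtain ⟨C, hC⟩ : ∃ C, ∀ x, ‖fderiv ℝ (unitBump d) x‖ ≤ C := by
    have h1 : Continuous (fderiv ℝ (unitBump d)) :=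
      ((unitBump d).contDiff (n := 1)).continuous_fderiv (by norm_num)
    exact h1.bounded_above_of_compact_support ((unitBump d).hasCompactSupport.fderiv ℝ)
  have hC0 : 0 ≤ C := (norm_nonneg _).trans (hC 0)
  refine ⟨3 * C, by positivity, fun n x => ?_⟩
  have hn : (0 : ℝ) < n + 1 := by positivity
  have h1 : fderiv ℝ (cutoff n) x
      = (fderiv ℝ (unitBump d) (((n : ℝ) + 1)⁻¹ • x)).comp
        (((n : ℝ) + 1)⁻¹ • ContinuousLinearMap.id ℝ (E d)) := by
    have h2 : HasFDerivAt (fun x : E d => ((n : ℝ) + 1)⁻¹ • x)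
        (((n : ℝ) + 1)⁻¹ • ContinuousLinearMap.id ℝ (E d)) x :=
      (hasFDerivAt_id x).fun_const_smul _
    have h3 : DifferentiableAt ℝ (unitBump d) (((n : ℝ) + 1)⁻¹ • x) :=
      ((unitBump d).contDiff (n := 1)).differentiable (by norm_num) _
    exact (h3.hasFDerivAt.comp x h2).fderiv
  rcases le_or_gt ‖x‖ (2 * (n + 1)) with hx | hx
  · have h2 : ‖fderiv ℝ (cutoff n) x‖ ≤ C * (n + 1 : ℝ)⁻¹ := by
      rw [h1]
      refine (ContinuousLinearMap.opNorm_comp_le _ _).trans ?_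
      have h4 : ‖((n : ℝ) + 1)⁻¹ • ContinuousLinearMap.id ℝ (E d)‖ ≤ (n + 1 : ℝ)⁻¹ := by
        rw [norm_smul, norm_inv, Real.norm_of_nonneg hn.le]
        exact mul_le_of_le_one_right (by positivity) ContinuousLinearMap.norm_id_le
      have := hC (((n : ℝ) + 1)⁻¹ • x)
      gcongr
    calc ‖fderiv ℝ (cutoff n) x‖ * (1 + ‖x‖) ≤ (C * (n + 1 : ℝ)⁻¹) * (3 * (n + 1)) := by
          gcongr
          have : (0 : ℝ) ≤ n := by positivity
          linarith
      _ = 3 * C := by field_simp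
  · have : cutoff n =ᶠ[𝓝 x] fun _ => (0 : ℝ) := by
      have : ∀ᶠ y in 𝓝 x, 2 * ((n : ℝ) + 1) < ‖y‖ :=
        (continuous_norm.tendsto x).eventually (lt_mem_nhds hx)
      filter_upwards [this] with y hy
      exact cutoff_eq_zero hy.le
    rw [this.fderiv_eq, fderiv_const_apply, norm_zero, zero_mul]
    positivity

theorem isTest_cutoff_mul (n : ℕ) {f : E d → ℝ} (hf : ContDiff ℝ 1 f) :
    IsTest (fun x => cutoff n x * f x) :=
  ⟨(cutoff_contDiff n (m := 1)).mul hf, (cutoff_hasCompactSupport n).mul_right⟩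

theorem eventually_fderiv_cutoff_mul (f : E d → ℝ) (x : E d) :
    ∀ᶠ n in atTop, fderiv ℝ (fun y => cutoff n y * f y) x = fderiv ℝ f x := by
  filter_upwards [eventually_cutoff_eq_one x] with n hn
  refine EventuallyEq.fderiv_eq ?_
  filter_upwards [hn] with y hy
  rw [hy, one_mul]

theorem eventually_cutoff_mul (f : E d → ℝ) (x : E d) :
    ∀ᶠ n in atTop, cutoff n x * f x = f x := by
  filter_upwards [eventually_cutoff_eq_one x] with n hn
  rw [hn.self_of_nhds, one_mul]

theorem abs_cutoff_mul_le (n : ℕ) (f : E d → ℝ) (x : E d) : |cutoff n x * f x| ≤ |f x| := by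
  rw [abs_mul, abs_of_nonneg (cutoff_nonneg n x)]
  exact mul_le_of_le_one_left (abs_nonneg _) (cutoff_le_one n x)

/-- In the product rule the dangerous term pairs a quadratic factor with the gradient of the cutoff,
which gains back one power of 1 + ‖x‖. The bound is uniform in n and serves as the dominating
function. -/
theorem QuadGrowth.exists_fderiv_cutoff_mul_le {C : ℝ} {f : E d → ℝ} (hf : QuadGrowth C f) :
    ∃ C', 0 ≤ C' ∧ ∀ n x, ‖fderiv ℝ (fun y => cutoff n y * f y) x‖ ≤ C' * (1 + ‖x‖) := by
  obtain ⟨D, hD0, hD⟩ := exists_fderiv_cutoff_le d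
  have hC := hf.nonneg
  refine ⟨C + C * D, by positivity, fun n x => ?_⟩
  have h1 : fderiv ℝ (fun y => cutoff n y * f y) x
      = cutoff n x • fderiv ℝ f x + f x • fderiv ℝ (cutoff n) x :=
    fderiv_fun_mul ((cutoff_contDiff n (m := 1)).differentiable (by norm_num) x)
      (hf.contDiff.differentiable (by norm_num) x)
  rw [h1]
  refine (norm_add_le _ _).trans ?_
  rw [norm_smul, norm_smul, Real.norm_of_nonneg (cutoff_nonneg n x), Real.norm_eq_abs]
  have h2 : cutoff n x * ‖fderiv ℝ f x‖ ≤ C * (1 + ‖x‖) :=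
    (mul_le_of_le_one_left (norm_nonneg _) (cutoff_le_one n x)).trans (hf.bound_fderiv x)
  have h3 : |f x| * ‖fderiv ℝ (cutoff n) x‖ ≤ C * D * (1 + ‖x‖) := by
    calc |f x| * ‖fderiv ℝ (cutoff n) x‖ ≤ (C * (1 + ‖x‖) ^ 2) * ‖fderiv ℝ (cutoff n) x‖ := by
          gcongr; exact hf.bound x
      _ = C * (1 + ‖x‖) * (‖fderiv ℝ (cutoff n) x‖ * (1 + ‖x‖)) := by ring
      _ ≤ C * (1 + ‖x‖) * D := by gcongr; exact hD n x
      _ = _ := by ring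
  linarith

/-! ### Exponential moments under (A1) -/

/-- The term of order d+1 in the series of exp(1 + ‖x‖) gives decay faster than (1 + ‖x‖)^(-d). -/
theorem integrable_exp_neg_norm (d : ℕ) : Integrable (fun x : E d => Real.exp (-‖x‖)) := by
  have h1 := integrable_one_add_norm (E := E d) (μ := volume) (r := ((d + 1 : ℕ) : ℝ)) (by simp)
  refine (h1.const_mul (Real.exp 1 * (d + 1).factorial)).mono' (by fun_prop)
    (ae_of_all _ fun x => ?_)
  have hx : 0 < 1 + ‖x‖ := by positivity
  rw [Real.norm_of_nonneg (Real.exp_nonneg _), Real.rpow_neg hx.le, Real.rpow_natCast]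
  have h2 := Real.pow_div_factorial_le_exp (x := 1 + ‖x‖) hx.le (d + 1)
  have hf : (0 : ℝ) < (d + 1).factorial := by positivity
  rw [Real.exp_neg, ← div_eq_mul_inv, inv_le_comm₀ (Real.exp_pos _) (by positivity), inv_div,
    div_le_iff₀ (by positivity)]
  rw [div_le_iff₀ hf, Real.exp_add] at h2
  linarith

theorem AssumptionA1.exists_potential {ρ : E d → ℝ} (hρ : AssumptionA1 ρ) :
    ∃ V : E d → ℝ, ContDiff ℝ 2 V ∧ (∀ x, ρ x = Real.exp (-V x)) ∧ (∃ C, QuadGrowth C V) ∧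
      Tendsto (fun x => fderiv ℝ V x x / ‖x‖) (cocompact (E d)) atTop ∧
      ∀ A : ℝ, ∃ C, 0 ≤ C ∧ ∀ x, A * ‖x‖ - C ≤ V x := by
  obtain ⟨V, h1, h2, h3, h4⟩ := hρ.exp_form
  exact ⟨V, h1, h2, exists_quadGrowth h1 h3, h4, fun A =>
    exists_linear_lower_bound (h1.of_le (by norm_num)) (h4.eventually_ge_atTop A)⟩

/-- The potential outgrows every linear function; a slope of A + 1 leaves a factor exp(-‖x‖) to
integrate. -/
theorem AssumptionA1.integrable_exp_volume {ρ : E d → ℝ} (hρ : AssumptionA1 ρ) (A : ℝ) :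
    Integrable (fun x => ρ x * Real.exp (A * ‖x‖)) := by
  obtain ⟨V, -, h2, -, -, h5⟩ := hρ.exists_potential
  obtain ⟨C, -, hC⟩ := h5 (A + 1)
  have hm := hρ.density.measurable
  refine ((integrable_exp_neg_norm d).const_mul (Real.exp C)).mono' (by fun_prop)
    (ae_of_all _ fun x => ?_)
  rw [Real.norm_of_nonneg (mul_nonneg (hρ.density.nonneg x) (Real.exp_nonneg _)), h2,
    ← Real.exp_add, ← Real.exp_add]
  exact Real.exp_le_exp.2 (by linarith [hC x])

theorem AssumptionA1.integrable_exp {ρ : E d → ℝ} (hρ : AssumptionA1 ρ) (A : ℝ) :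
    Integrable (fun x => Real.exp (A * ‖x‖)) (law ρ) :=
  (integrable_law_iff hρ.density.measurable hρ.density.nonneg).2 (hρ.integrable_exp_volume A)

theorem one_add_norm_pow_le (n : ℕ) (x : E d) :
    (1 + ‖x‖) ^ n ≤ Real.exp (n * ‖x‖) := by
  rw [Real.exp_nat_mul]
  gcongr
  linarith [Real.add_one_le_exp ‖x‖]

theorem AssumptionA1.integrable_of_pow {ρ : E d → ℝ} (hρ : AssumptionA1 ρ) {f : E d → ℝ} {C : ℝ}
    (hf : AEStronglyMeasurable f (law ρ)) (n : ℕ) (hC : ∀ x, |f x| ≤ C * (1 + ‖x‖) ^ n) :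
    Integrable f (law ρ) := by
  have hC0 : 0 ≤ C := by
    have := (abs_nonneg _).trans (hC 0)
    simpa using this
  refine ((hρ.integrable_exp n).const_mul C).mono' hf (ae_of_all _ fun x => ?_)
  exact (hC x).trans (mul_le_mul_of_nonneg_left (one_add_norm_pow_le n x) hC0)

theorem AssumptionA1.memLp_two {ρ : E d → ℝ} (hρ : AssumptionA1 ρ) {f : E d → ℝ} {C : ℝ}
    (hf : QuadGrowth C f) : MemLp f 2 (law ρ) := by
  rw [memLp_two_iff_integrable_sq hf.contDiff.continuous.aestronglyMeasurable]
  refine hρ.integrable_of_pow (C := C ^ 2) (hf.contDiff.continuous.pow 2).aestronglyMeasurable 4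
    fun x => ?_
  rw [abs_pow]
  calc |f x| ^ 2 ≤ (C * (1 + ‖x‖) ^ 2) ^ 2 := by gcongr; exact hf.bound x
    _ = _ := by ring

section

/-! ### Test functions -/

theorem IsTest.continuous {φ : E d → ℝ} (hφ : IsTest φ) : Continuous φ := hφ.1.continuous

theorem IsTest.continuous_fderiv {φ : E d → ℝ} (hφ : IsTest φ) : Continuous (fderiv ℝ φ) :=
  hφ.1.continuous_fderiv (by norm_num)

theorem IsTest.exists_bound {φ : E d → ℝ} (hφ : IsTest φ) :
    ∃ B, 0 < B ∧ ∀ x, |φ x| ≤ B ∧ ‖fderiv ℝ φ x‖ ≤ B := by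
  obtain ⟨B, hB⟩ := hφ.continuous.bounded_above_of_compact_support hφ.2
  obtain ⟨B', hB'⟩ := hφ.continuous_fderiv.bounded_above_of_compact_support (hφ.2.fderiv ℝ)
  exact ⟨max (max B B') 1, by positivity, fun x =>
    ⟨(hB x).trans (by simp), (hB' x).trans (by simp)⟩⟩

theorem IsTest.quadGrowth {φ : E d → ℝ} (hφ : IsTest φ) : ∃ C, QuadGrowth C φ := by
  obtain ⟨B, hB, h⟩ := hφ.exists_bound
  refine ⟨B, hφ.1, fun x => (h x).1.trans ?_, fun x => (h x).2.trans ?_⟩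
  · exact le_mul_of_one_le_right hB.le (one_le_pow₀ (by linarith [norm_nonneg x]))
  · exact le_mul_of_one_le_right hB.le (by linarith [norm_nonneg x])

theorem IsTest.of_contDiff {φ : E d → ℝ} (hφ : ContDiff ℝ ((⊤ : ℕ∞) : WithTop ℕ∞) φ)
    (hc : HasCompactSupport φ) : IsTest φ :=
  ⟨hφ.of_le (by exact_mod_cast le_top), hc⟩

theorem IsTest.add {φ ψ : E d → ℝ} (hφ : IsTest φ) (hψ : IsTest ψ) :
    IsTest (fun x => φ x + ψ x) := ⟨hφ.1.add hψ.1, hφ.2.add hψ.2⟩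

theorem IsTest.const_mul {φ : E d → ℝ} (c : ℝ) (hφ : IsTest φ) :
    IsTest (fun x => c * φ x) := ⟨contDiff_const.mul hφ.1, hφ.2.mul_left⟩

theorem IsTest.integrable_mul {φ : E d → ℝ} (hφ : IsTest φ) {μ : Measure (E d)} {g : E d → ℝ}
    (hg : LocallyIntegrable g μ) : Integrable (fun x => φ x * g x) μ :=
  hg.integrable_smul_left_of_hasCompactSupport hφ.continuous hφ.2

theorem aestronglyMeasurable_apply {Ω : Type*} [MeasurableSpace Ω] {μ : Measure Ω}
    {A : Ω → (E d →L[ℝ] ℝ)} {U : Ω → E d} (hA : AEStronglyMeasurable A μ)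
    (hU : AEStronglyMeasurable U μ) : AEStronglyMeasurable (fun ω => A ω (U ω)) μ :=
  isBoundedBilinearMap_apply.continuous.comp_aestronglyMeasurable (hA.prodMk hU)

theorem aestronglyMeasurable_fderiv_apply {Ω : Type*} [MeasurableSpace Ω] {μ : Measure Ω}
    {X U : Ω → E d} (hX : AEStronglyMeasurable X μ) (hU : AEStronglyMeasurable U μ) {f : E d → ℝ}
    (hf : ContDiff ℝ 1 f) : AEStronglyMeasurable (fun ω => fderiv ℝ f (X ω) (U ω)) μ :=
  aestronglyMeasurable_apply
    ((hf.continuous_fderiv (by norm_num)).comp_aestronglyMeasurable hX) hU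

theorem IsTest.integrable_fderiv {φ : E d → ℝ} (hφ : IsTest φ) {μ : Measure (E d)}
    {u : E d → E d} (hu : LocallyIntegrable u μ) :
    Integrable (fun x => fderiv ℝ φ x (u x)) μ := by
  obtain ⟨B, hB, h⟩ := hφ.exists_bound
  have h1 : IntegrableOn u (tsupport (fderiv ℝ φ)) μ :=
    hu.integrableOn_isCompact (hφ.2.fderiv ℝ)
  have h2 : IntegrableOn (fun x => fderiv ℝ φ x (u x)) (tsupport (fderiv ℝ φ)) μ := by
    refine (h1.norm.const_mul B).mono' (aestronglyMeasurable_fderiv_apply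
      aestronglyMeasurable_id h1.aestronglyMeasurable hφ.1) (ae_of_all _ fun x => ?_)
    exact ((fderiv ℝ φ x).le_opNorm _).trans
      (mul_le_mul_of_nonneg_right (h x).2 (norm_nonneg _))
  rw [integrableOn_iff_integrable_of_support_subset] at h2
  · exact h2
  · intro x hx
    refine subset_tsupport _ fun h0 => hx ?_
    simp [h0]

theorem QuadGrowth.integrable_fderiv {Ω : Type*} [MeasurableSpace Ω] {μ : Measure Ω}
    {X U : Ω → E d} (hX : AEStronglyMeasurable X μ) (hU : AEStronglyMeasurable U μ)
    (hi : Integrable (fun ω => (1 + ‖X ω‖) * ‖U ω‖) μ) {C : ℝ} {f : E d → ℝ}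
    (hf : QuadGrowth C f) : Integrable (fun ω => fderiv ℝ f (X ω) (U ω)) μ := by
  refine (hi.const_mul C).mono' (aestronglyMeasurable_fderiv_apply hX hU hf.contDiff)
    (ae_of_all _ fun ω => ?_)
  calc ‖fderiv ℝ f (X ω) (U ω)‖ ≤ ‖fderiv ℝ f (X ω)‖ * ‖U ω‖ := (fderiv ℝ f _).le_opNorm _
    _ ≤ C * (1 + ‖X ω‖) * ‖U ω‖ := by gcongr; exact hf.bound_fderiv _
    _ = _ := by ring

/-- Position and velocity are maps on an abstract space, so that the same limit serves a single law
(position `id`) and the space-time measure (position `Prod.snd`). -/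
theorem QuadGrowth.tendsto_integral_fderiv {Ω : Type*} [MeasurableSpace Ω] {μ : Measure Ω}
    {X U : Ω → E d} (hX : AEStronglyMeasurable X μ) (hU : AEStronglyMeasurable U μ)
    (hi : Integrable (fun ω => (1 + ‖X ω‖) * ‖U ω‖) μ) {C : ℝ} {f : E d → ℝ}
    (hf : QuadGrowth C f) :
    Tendsto (fun n => ∫ ω, fderiv ℝ (fun y => cutoff n y * f y) (X ω) (U ω) ∂μ) atTop
      (𝓝 (∫ ω, fderiv ℝ f (X ω) (U ω) ∂μ)) := by
  obtain ⟨C', hC0, hC'⟩ := hf.exists_fderiv_cutoff_mul_le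
  refine tendsto_integral_of_dominated_convergence (fun ω => C' * ((1 + ‖X ω‖) * ‖U ω‖))
    (fun n => aestronglyMeasurable_fderiv_apply hX hU (isTest_cutoff_mul n hf.contDiff).1)
    (hi.const_mul C') (fun n => ae_of_all _ fun ω => ?_) (ae_of_all _ fun ω => ?_)
  · calc _ ≤ ‖fderiv ℝ (fun y => cutoff n y * f y) (X ω)‖ * ‖U ω‖ :=
          (fderiv ℝ _ _).le_opNorm _
      _ ≤ C' * (1 + ‖X ω‖) * ‖U ω‖ := by gcongr; exact hC' _ _
      _ = _ := by ring
  · refine tendsto_const_nhds.congr' ?_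
    filter_upwards [eventually_fderiv_cutoff_mul f (X ω)] with n hn
    rw [hn]

theorem tendsto_integral_cutoff_mul {μ : Measure (E d)} {f g : E d → ℝ}
    (hi : Integrable (fun x => f x * g x) μ) :
    Tendsto (fun n => ∫ x, cutoff n x * f x * g x ∂μ) atTop (𝓝 (∫ x, f x * g x ∂μ)) := by
  refine tendsto_integral_of_dominated_convergence (fun x => |f x * g x|)
    (fun n => ?_) hi.abs (fun n => ae_of_all _ fun x => ?_) (ae_of_all _ fun x => ?_)
  · simp_rw [mul_assoc]
    exact (cutoff_contDiff n (m := 0)).continuous.aestronglyMeasurable.mul hi.aestronglyMeasurable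
  · rw [mul_assoc]
    exact abs_cutoff_mul_le n (fun x => f x * g x) x
  · refine tendsto_const_nhds.congr' ?_
    filter_upwards [eventually_cutoff_mul f x] with n hn
    rw [hn]

/-! ### The weak weighted divergence -/

theorem ae_eq_of_forall_isTest {μ : Measure (E d)} {g g' : E d → ℝ} (hg : LocallyIntegrable g μ)
    (hg' : LocallyIntegrable g' μ)
    (h : ∀ φ : E d → ℝ, IsTest φ → ∫ x, φ x * g x ∂μ = ∫ x, φ x * g' x ∂μ) : g =ᵐ[μ] g' := by
  have h1 := ae_eq_zero_of_integral_contDiff_smul_eq_zero (hg.sub hg') fun φ hφ hc => ?_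
  · filter_upwards [h1] with x hx
    exact sub_eq_zero.1 hx
  have ht := IsTest.of_contDiff hφ hc
  simp only [Pi.sub_apply, smul_eq_mul, mul_sub]
  rw [integral_sub (ht.integrable_mul hg) (ht.integrable_mul hg'), h φ ht, sub_self]

theorem HasWeightedDiv.ae_eq {ρ : E d → ℝ} {u : E d → E d} {g g' : E d → ℝ}
    (hg : HasWeightedDiv ρ u g) (hg' : HasWeightedDiv ρ u g') : g =ᵐ[law ρ] g' :=
  ae_eq_of_forall_isTest hg.2.1 hg'.2.1 fun φ hφ => (hg.2.2 φ hφ).trans (hg'.2.2 φ hφ).symm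

theorem HasWeightedDiv.congr {ρ : E d → ℝ} {u : E d → E d} {g g' : E d → ℝ}
    (hg : HasWeightedDiv ρ u g) (h : g =ᵐ[law ρ] g') : HasWeightedDiv ρ u g' := by
  refine ⟨hg.1, fun x => (hg.2.1 x).congr h, fun φ hφ => ?_⟩
  rw [← hg.2.2 φ hφ]
  refine integral_congr_ae ?_
  filter_upwards [h] with x hx
  rw [hx]

theorem weightedDiv_spec {ρ : E d → ℝ} {u : E d → E d} (h : ∃ g, HasWeightedDiv ρ u g) :
    HasWeightedDiv ρ u (weightedDiv ρ u) := by
  rw [weightedDiv, dif_pos h]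
  exact h.choose_spec

/-- Truncations of f are test functions with gradients of uniformly linear growth, so dominated
convergence extends the weak divergence identity to f. -/
theorem HasWeightedDiv.integral_eq {ρ : E d → ℝ} {u : E d → E d} {g : E d → ℝ}
    (hg : HasWeightedDiv ρ u g) (hu : Integrable (fun x => (1 + ‖x‖) * ‖u x‖) (law ρ))
    {C : ℝ} {f : E d → ℝ} (hf : QuadGrowth C f) (hfg : Integrable (fun x => f x * g x) (law ρ)) :
    ∫ x, f x * g x ∂(law ρ) = -∫ x, fderiv ℝ f x (u x) ∂(law ρ) := by
  have h1 := tendsto_integral_cutoff_mul hfg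
  have h2 := (hf.tendsto_integral_fderiv (X := id) (U := u) aestronglyMeasurable_id
    hg.1.aestronglyMeasurable hu).neg
  refine tendsto_nhds_unique h1 (h2.congr fun n => ?_)
  exact (hg.2.2 _ (isTest_cutoff_mul n hf.contDiff)).symm

/-! ### The Lagrangian -/

theorem lintegral_enorm_sq_eq {Ω : Type*} [MeasurableSpace Ω] {μ : Measure Ω} {f : Ω → ℝ}
    (hf : MemLp f 2 μ) : ∫⁻ x, ‖f x‖ₑ ^ 2 ∂μ = ENNReal.ofReal (∫ x, f x ^ 2 ∂μ) := by
  rw [ofReal_integral_eq_lintegral_ofReal hf.integrable_sq (ae_of_all _ fun x => sq_nonneg _)]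
  refine lintegral_congr fun x => ?_
  rw [← sq_abs, ENNReal.ofReal_pow (abs_nonneg _), Real.enorm_eq_ofReal_abs]

theorem memLp_two_of_lintegral_lt_top {Ω F : Type*} [MeasurableSpace Ω] [NormedAddCommGroup F]
    {μ : Measure Ω} {f : Ω → F}
    (hf : AEStronglyMeasurable f μ) (h : ∫⁻ x, ‖f x‖ₑ ^ 2 ∂μ < ⊤) : MemLp f 2 μ := by
  refine ⟨hf, ?_⟩
  rw [eLpNorm_lt_top_iff_lintegral_rpow_enorm_lt_top (by norm_num) (by norm_num)]
  simpa using h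

variable {β : ℝ} {h ρ g : E d → ℝ} {u : E d → E d}

/-- The weak divergence is unique almost everywhere, so the representative picked by `weightedDiv`
can be exchanged for any other. -/
theorem lagrangian_eq (hg : HasWeightedDiv ρ u g) (hg2 : MemLp g 2 (law ρ))
    (hw : MemLp (fun x => h x - mean ρ h) 2 (law ρ)) :
    lagrangian β h ρ u = ENNReal.ofReal (1 / 2 * ∫ x, g x ^ 2 ∂(law ρ)
      + β ^ 2 / 2 * ∫ x, (h x - mean ρ h) ^ 2 ∂(law ρ)) := by
  have hex : ∃ g, HasWeightedDiv ρ u g := ⟨g, hg⟩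
  have hae := (weightedDiv_spec hex).ae_eq hg
  rw [lagrangian, if_pos hex, lintegral_enorm_sq_eq hw,
    lintegral_congr_ae (g := fun x => ‖g x‖ₑ ^ 2) (by filter_upwards [hae] with x hx; rw [hx]),
    lintegral_enorm_sq_eq hg2, ← ENNReal.ofReal_mul (by norm_num),
    ← ENNReal.ofReal_mul (by positivity), ← ENNReal.ofReal_add]
  · exact mul_nonneg (by norm_num) (integral_nonneg fun _ => sq_nonneg _)
  · exact mul_nonneg (by positivity) (integral_nonneg fun _ => sq_nonneg _)

/-- Each summand must be finite. Positivity of β is what makes the second one control the variance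
of h. -/
theorem exists_of_lagrangian_ne_top (hβ : 0 < β) (hh : Measurable h)
    (hL : lagrangian β h ρ u ≠ ⊤) :
    HasWeightedDiv ρ u (weightedDiv ρ u) ∧ MemLp (weightedDiv ρ u) 2 (law ρ) ∧
      MemLp (fun x => h x - mean ρ h) 2 (law ρ) := by
  have hex : ∃ g, HasWeightedDiv ρ u g := by
    by_contra hn
    rw [lagrangian, if_neg hn, top_add] at hL
    exact hL rfl
  have hg := weightedDiv_spec hex
  rw [lagrangian, if_pos hex, ne_eq, ENNReal.add_eq_top, not_or] at hL
  refine ⟨hg, memLp_two_of_lintegral_lt_top hg.2.1.aestronglyMeasurable ?_,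
    memLp_two_of_lintegral_lt_top (by fun_prop) ?_⟩
  · refine lt_top_iff_ne_top.2 fun hn => hL.1 ?_
    rw [hn, ENNReal.mul_top]
    simp
  · refine lt_top_iff_ne_top.2 fun hn => hL.2 ?_
    rw [hn, ENNReal.mul_top]
    rw [ne_eq, ENNReal.ofReal_eq_zero, not_le]
    positivity

/-- Integration by parts of the centred function `h` against the weighted divergence. -/
theorem HasWeightedDiv.integral_centred [IsProbabilityMeasure (law ρ)] (hg : HasWeightedDiv ρ u g)
    (hu : Integrable (fun x => (1 + ‖x‖) * ‖u x‖) (law ρ)) {C : ℝ} (hh : QuadGrowth C h)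
    (hg2 : MemLp g 2 (law ρ)) (hw : MemLp (fun x => h x - mean ρ h) 2 (law ρ)) :
    ∫ x, g x * (h x - mean ρ h) ∂(law ρ) = -∫ x, fderiv ℝ h x (u x) ∂(law ρ) := by
  -- Testing against the constant 1 shows that g has mean zero, so centring h does not change the
  -- pairing.
  have h0 : ∫ x, g x ∂(law ρ) = 0 := by
    have := hg.integral_eq hu (QuadGrowth.const (d := d) 1)
      (by simpa using hg2.integrable (by norm_num))
    simpa using this
  have hgi := hg2.integrable (μ := law ρ) (by norm_num)
  have h1 : MemLp h 2 (law ρ) := by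
    have := hw.add (memLp_const (μ := law ρ) (p := 2) (mean ρ h))
    convert this using 1
    ext x; simp
  have h2 := hg.integral_eq hu hh (h1.integrable_mul hg2)
  have h3 : ∀ x, g x * (h x - mean ρ h) = h x * g x - mean ρ h * g x := fun x => by ring
  have h4 : Integrable (fun x => h x * g x) (law ρ) := h1.integrable_mul hg2
  simp_rw [h3]
  rw [integral_sub h4 (hgi.const_mul _), integral_const_mul, h0, h2]
  simp

theorem integral_sq_sub {Ω : Type*} [MeasurableSpace Ω] {μ : Measure Ω} {f g : Ω → ℝ}
    (hf : MemLp f 2 μ) (hg : MemLp g 2 μ) (c : ℝ) :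
    ∫ x, (f x - c * g x) ^ 2 ∂μ
      = ∫ x, f x ^ 2 ∂μ - 2 * c * ∫ x, f x * g x ∂μ + c ^ 2 * ∫ x, g x ^ 2 ∂μ := by
  have h3 : ∀ x, (f x - c * g x) ^ 2 = f x ^ 2 - 2 * c * (f x * g x) + c ^ 2 * g x ^ 2 :=
    fun x => by ring
  simp_rw [h3]
  rw [integral_add, integral_sub, integral_const_mul, integral_const_mul]
  · exact hf.integrable_sq
  · exact (hf.integrable_mul hg).const_mul _
  · exact hf.integrable_sq.sub ((hf.integrable_mul hg).const_mul _)
  · exact hg.integrable_sq.const_mul _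

/-- Completing the square in the Lagrangian. -/
theorem lagrangian_eq_square [IsProbabilityMeasure (law ρ)] (hg : HasWeightedDiv ρ u g)
    (hu : Integrable (fun x => (1 + ‖x‖) * ‖u x‖) (law ρ)) {C : ℝ} (hh : QuadGrowth C h)
    (hg2 : MemLp g 2 (law ρ)) (hw : MemLp (fun x => h x - mean ρ h) 2 (law ρ)) :
    lagrangian β h ρ u = ENNReal.ofReal (-β * ∫ x, fderiv ℝ h x (u x) ∂(law ρ)
      + 1 / 2 * ∫ x, (g x - β * (h x - mean ρ h)) ^ 2 ∂(law ρ)) := by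
  rw [lagrangian_eq hg hg2 hw, integral_sq_sub hg2 hw,
    hg.integral_centred hu hh hg2 hw]
  congr 1
  ring

theorem sq_integral_le {Ω : Type*} [MeasurableSpace Ω] {μ : Measure Ω} [IsProbabilityMeasure μ]
    {f : Ω → ℝ} (hf : MemLp f 2 μ) : (∫ x, f x ∂μ) ^ 2 ≤ ∫ x, f x ^ 2 ∂μ := by
  have h1 := integral_sq_sub hf (memLp_const (μ := μ) (p := 2) (1 : ℝ)) (∫ x, f x ∂μ)
  have h2 : 0 ≤ ∫ x, (f x - (∫ x, f x ∂μ) * 1) ^ 2 ∂μ := integral_nonneg fun _ => sq_nonneg _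
  rw [h1] at h2
  simp at h2
  nlinarith

/-- A lower bound for the Lagrangian that detects, against one test function, whether the control
law holds. -/
theorem le_lagrangian [IsProbabilityMeasure (law ρ)] (hβ : 0 < β)
    (hu : Integrable (fun x => (1 + ‖x‖) * ‖u x‖) (law ρ)) {C : ℝ} (hh : QuadGrowth C h)
    {φ : E d → ℝ} (hφ : IsTest φ) {B : ℝ} (hB : ∀ x, |φ x| ≤ B) {c : ℝ} (hc : 0 ≤ c)
    (hcB : c * B ^ 2 ≤ 1 / 2) :
    ENNReal.ofReal (-β * (∫ x, fderiv ℝ h x (u x) ∂(law ρ))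
      + c * (∫ x, φ x * (β * (h x - mean ρ h)) ∂(law ρ)
        + ∫ x, fderiv ℝ φ x (u x) ∂(law ρ)) ^ 2) ≤ lagrangian β h ρ u := by
  by_cases hL : lagrangian β h ρ u = ⊤
  · rw [hL]; exact le_top
  obtain ⟨hg, hg2, hw⟩ := exists_of_lagrangian_ne_top hβ hh.contDiff.continuous.measurable hL
  rw [lagrangian_eq_square hg hu hh hg2 hw]
  refine ENNReal.ofReal_le_ofReal (add_le_add_right ?_ _)
  set g := weightedDiv ρ u
  have hv : MemLp (fun x => g x - β * (h x - mean ρ h)) 2 (law ρ) := hg2.sub (hw.const_mul β)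
  -- The bracket is minus the integral of φ against the residual, so its square is at most B² times
  -- the squared residual, and c B² ≤ 1/2 keeps it below the square in the Lagrangian. The resulting
  -- bound no longer mentions g, so it can be integrated in time without measurability of g.
  have h1 : ∫ x, φ x * (β * (h x - mean ρ h)) ∂(law ρ) + ∫ x, fderiv ℝ φ x (u x) ∂(law ρ)
      = -∫ x, φ x * (g x - β * (h x - mean ρ h)) ∂(law ρ) := by
    simp_rw [mul_sub (φ _) (g _)]
    rw [integral_sub (hφ.integrable_mul hg.2.1)
      (hφ.integrable_mul ((hw.const_mul β).locallyIntegrable (by norm_num))), hg.2.2 φ hφ]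
    ring
  have h2 : MemLp (fun x => φ x * (g x - β * (h x - mean ρ h))) 2 (law ρ) :=
    hv.of_le_mul (c := B) (hφ.continuous.aestronglyMeasurable.mul hv.aestronglyMeasurable)
      (ae_of_all _ fun x => by
        rw [norm_mul]
        exact mul_le_mul_of_nonneg_right (hB x) (norm_nonneg _))
  have h3 := sq_integral_le h2
  have h4 : ∫ x, (φ x * (g x - β * (h x - mean ρ h))) ^ 2 ∂(law ρ)
      ≤ B ^ 2 * ∫ x, (g x - β * (h x - mean ρ h)) ^ 2 ∂(law ρ) := by
    rw [← integral_const_mul]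
    refine integral_mono h2.integrable_sq (hv.integrable_sq.const_mul _) fun x => ?_
    simp only [mul_pow]
    refine mul_le_mul_of_nonneg_right ?_ (sq_nonneg _)
    rw [← sq_abs]
    exact pow_le_pow_left₀ (abs_nonneg _) (hB x) 2
  have h5 : 0 ≤ ∫ x, (g x - β * (h x - mean ρ h)) ^ 2 ∂(law ρ) :=
    integral_nonneg fun _ => sq_nonneg _
  rw [h1, neg_sq]
  calc _ ≤ c * (B ^ 2 * ∫ x, (g x - β * (h x - mean ρ h)) ^ 2 ∂(law ρ)) :=
        mul_le_mul_of_nonneg_left (h3.trans h4) hc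
    _ = (c * B ^ 2) * ∫ x, (g x - β * (h x - mean ρ h)) ^ 2 ∂(law ρ) := by ring
    _ ≤ _ := mul_le_mul_of_nonneg_right hcB h5

/-! ### A countable family of test functions -/

/-- A test function is encoded as the continuous map x ↦ (φ x, φ' x). The space of such maps is
separable and metrizable for the compact-open topology, so each of its subsets has a countable dense
subset. Sorting by support in balls of integer radius keeps the approximants supported where the
limit is. -/
theorem exists_countable_isTest (d : ℕ) : ∃ D : ℕ → E d → ℝ, (∀ n, IsTest (D n)) ∧
    ∀ φ : E d → ℝ, IsTest φ → ∃ K : Set (E d), IsCompact K ∧ ∀ ε : ℝ, 0 < ε → ∃ n, ∀ x,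
      (x ∉ K → φ x = 0 ∧ fderiv ℝ φ x = 0 ∧ D n x = 0 ∧ fderiv ℝ (D n) x = 0) ∧
      (|φ x - D n x| ≤ ε ∧ ‖fderiv ℝ φ x - fderiv ℝ (D n) x‖ ≤ ε) := by
  classical
  let S (R : ℕ) : Set C(E d, ℝ × (E d →L[ℝ] ℝ)) := {F | ∃ φ : E d → ℝ, IsTest φ ∧
    tsupport φ ⊆ Metric.closedBall 0 R ∧ ∀ x, F x = (φ x, fderiv ℝ φ x)}
  have hS : ∀ R, ∃ c ⊆ S R, c.Countable ∧ S R ⊆ closure c := fun R =>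
    (TopologicalSpace.IsSeparable.of_separableSpace (S R)).exists_countable_dense_subset
  choose c hcS hcc hcd using hS
  -- The zero function makes the countable family nonempty, as its enumeration requires.
  have hz : (0 : C(E d, ℝ × (E d →L[ℝ] ℝ))) ∈ S 0 := by
    refine ⟨fun _ => 0, ⟨contDiff_const, HasCompactSupport.zero⟩, ?_, fun x => ?_⟩
    · simp [tsupport]
    · simp only [ContinuousMap.zero_apply, fderiv_const_apply]
      rfl
  have hU : (⋃ R, c R).Countable := countable_iUnion hcc
  have hne : (⋃ R, c R).Nonempty := by
    obtain ⟨F, hF⟩ := closure_nonempty_iff.1 ⟨_, hcd 0 hz⟩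
    exact ⟨F, mem_iUnion.2 ⟨0, hF⟩⟩
  obtain ⟨e, he⟩ := hU.exists_eq_range hne
  have hex : ∀ n, ∃ φ : E d → ℝ, IsTest φ ∧ ∀ x, e n x = (φ x, fderiv ℝ φ x) := by
    intro n
    have : e n ∈ ⋃ R, c R := he ▸ mem_range_self n
    obtain ⟨R, hR⟩ := mem_iUnion.1 this
    obtain ⟨φ, h1, -, h2⟩ := hcS R hR
    exact ⟨φ, h1, h2⟩
  choose D hD1 hD2 using hex
  refine ⟨D, hD1, fun φ hφ => ?_⟩
  obtain ⟨R, hR⟩ : ∃ R : ℕ, tsupport φ ⊆ Metric.closedBall 0 R := by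
    obtain ⟨r, hr⟩ := hφ.2.isBounded.subset_closedBall 0
    obtain ⟨R, hR⟩ := exists_nat_ge r
    exact ⟨R, hr.trans (Metric.closedBall_subset_closedBall hR)⟩
  set K : Set (E d) := Metric.closedBall 0 R with hK
  have hout : ∀ ψ : E d → ℝ, tsupport ψ ⊆ K → ∀ x ∉ K, ψ x = 0 ∧ fderiv ℝ ψ x = 0 := by
    intro ψ hψ x hx
    refine ⟨image_eq_zero_of_notMem_tsupport fun h => hx (hψ h), ?_⟩
    exact image_eq_zero_of_notMem_tsupport fun h => hx (hψ (tsupport_fderiv_subset ℝ h))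
  refine ⟨K, isCompact_closedBall _ _, fun ε hε => ?_⟩
  let F : C(E d, ℝ × (E d →L[ℝ] ℝ)) :=
    ⟨fun x => (φ x, fderiv ℝ φ x), hφ.continuous.prodMk hφ.continuous_fderiv⟩
  have hF : F ∈ closure (c R) := hcd R ⟨φ, hφ, hR, fun _ => rfl⟩
  have hnear : ∀ᶠ G in 𝓝 F, ∀ x ∈ K, dist (F x) (G x) < ε :=
    (ContinuousMap.tendsto_iff_forall_isCompact_tendstoUniformlyOn.1 tendsto_id K
      (isCompact_closedBall _ _) _ (Metric.dist_mem_uniformity hε))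
  obtain ⟨G, hG1, hG2⟩ := (mem_closure_iff_frequently.1 hF).and_eventually hnear |>.exists
  obtain ⟨n, rfl⟩ : G ∈ range e := he ▸ mem_iUnion.2 ⟨R, hG1⟩
  obtain ⟨ψ, hψ1, hψ2, hψ3⟩ := hcS R hG1
  have hψD : D n = ψ := by
    ext x
    have := (hD2 n x).symm.trans (hψ3 x)
    exact (Prod.ext_iff.1 this).1
  refine ⟨n, fun x => ⟨fun hx => ?_, ?_⟩⟩
  · have h1 := hout φ hR x hx
    have h2 := hout ψ hψ2 x hx
    rw [hψD]
    exact ⟨h1.1, h1.2, h2.1, h2.2⟩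
  · by_cases hx : x ∈ K
    · have h1 := (hG2 x hx).le
      rw [hD2 n x, Prod.dist_eq, max_le_iff] at h1
      simpa [F, Real.dist_eq, dist_eq_norm] using h1
    · have h1 := hout φ hR x hx
      have h2 := hout ψ hψ2 x hx
      rw [hψD, h1.1, h1.2, h2.1, h2.2]
      simpa using hε.le

/-- A countable family of test functions that is dense in `C¹`, uniformly on compact sets. -/
noncomputable def denseTest (d : ℕ) : ℕ → E d → ℝ := (exists_countable_isTest d).choose

theorem isTest_denseTest (n : ℕ) : IsTest (denseTest d n) :=
  (exists_countable_isTest d).choose_spec.1 n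

/-- An identity known for almost every time, one test function at a time, has an exceptional set
that depends on the function. A countable family gives a common one, and this lemma returns to all
test functions: the error is at most ε times the mass of w and u on a compact set. -/
theorem forall_isTest_of_denseTest {μ : Measure (E d)} {w : E d → ℝ} {u : E d → E d}
    (hw : LocallyIntegrable w μ) (hu : LocallyIntegrable u μ)
    (h : ∀ n, ∫ x, denseTest d n x * w x ∂μ = -∫ x, fderiv ℝ (denseTest d n) x (u x) ∂μ)
    {φ : E d → ℝ} (hφ : IsTest φ) :
    ∫ x, φ x * w x ∂μ = -∫ x, fderiv ℝ φ x (u x) ∂μ := by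
  obtain ⟨K, hK, hKε⟩ := (exists_countable_isTest d).choose_spec.2 φ hφ
  have hwK := (hw.integrableOn_isCompact hK).norm
  have huK := (hu.integrableOn_isCompact hK).norm
  have key : ∀ ε : ℝ, 0 < ε → |∫ x, φ x * w x ∂μ + ∫ x, fderiv ℝ φ x (u x) ∂μ|
      ≤ 0 + ε * (∫ x in K, ‖w x‖ ∂μ + ∫ x in K, ‖u x‖ ∂μ) := by
    intro ε hε
    obtain ⟨n, hn⟩ := hKε ε hε
    change ∀ x, (x ∉ K → φ x = 0 ∧ fderiv ℝ φ x = 0 ∧ denseTest d n x = 0 ∧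
      fderiv ℝ (denseTest d n) x = 0) ∧ (|φ x - denseTest d n x| ≤ ε ∧
      ‖fderiv ℝ φ x - fderiv ℝ (denseTest d n) x‖ ≤ ε) at hn
    have ht := isTest_denseTest (d := d) n
    have e1 : ∫ x, φ x * w x ∂μ + ∫ x, fderiv ℝ φ x (u x) ∂μ
        = ∫ x, (φ x - denseTest d n x) * w x ∂μ
          + ∫ x, (fderiv ℝ φ x - fderiv ℝ (denseTest d n) x) (u x) ∂μ := by
      simp_rw [sub_mul, _root_.sub_apply]
      rw [integral_sub (hφ.integrable_mul hw) (ht.integrable_mul hw),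
        integral_sub (hφ.integrable_fderiv hu) (ht.integrable_fderiv hu), h n]
      ring
    have e2 : |∫ x, (φ x - denseTest d n x) * w x ∂μ| ≤ ε * ∫ x in K, ‖w x‖ ∂μ := by
      rw [← Real.norm_eq_abs, ← integral_const_mul,
        ← setIntegral_eq_integral_of_forall_compl_eq_zero (s := K)]
      · refine norm_integral_le_of_norm_le (hwK.const_mul ε) (ae_of_all _ fun x => ?_)
        rw [norm_mul]
        exact mul_le_mul_of_nonneg_right (hn x).2.1 (norm_nonneg _)
      · intro x hx
        obtain ⟨a, -, b, -⟩ := (hn x).1 hx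
        rw [a, b, sub_zero, zero_mul]
    have e3 : |∫ x, (fderiv ℝ φ x - fderiv ℝ (denseTest d n) x) (u x) ∂μ|
        ≤ ε * ∫ x in K, ‖u x‖ ∂μ := by
      rw [← Real.norm_eq_abs, ← integral_const_mul,
        ← setIntegral_eq_integral_of_forall_compl_eq_zero (s := K)]
      · refine norm_integral_le_of_norm_le (huK.const_mul ε) (ae_of_all _ fun x => ?_)
        exact (ContinuousLinearMap.le_opNorm _ _).trans
          (mul_le_mul_of_nonneg_right (hn x).2.2 (norm_nonneg _))
      · intro x hx
        obtain ⟨-, a, -, b⟩ := (hn x).1 hx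
        rw [a, b, sub_zero, _root_.zero_apply]
    rw [e1]
    exact (abs_add_le _ _).trans (by linarith)
  have h0 : |∫ x, φ x * w x ∂μ + ∫ x, fderiv ℝ φ x (u x) ∂μ| ≤ 0 := by
    have hc : Tendsto (fun ε : ℝ => 0 + ε * (∫ x in K, ‖w x‖ ∂μ + ∫ x in K, ‖u x‖ ∂μ))
        (𝓝[>] 0) (𝓝 0) := by
      have : Continuous fun ε : ℝ =>
          0 + ε * (∫ x in K, ‖w x‖ ∂μ + ∫ x in K, ‖u x‖ ∂μ) := by fun_prop
      have := (this.tendsto 0).mono_left (nhdsWithin_le_nhds (s := Ioi 0))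
      simpa using this
    exact ge_of_tendsto hc (eventually_nhdsWithin_of_forall key)
  have := abs_nonpos_iff.1 h0
  linarith

end

section

/-! ### The space-time measure of a path of densities -/

/-- The laws of a jointly measurable family of densities, as a kernel. -/
noncomputable def lawKernel {S : Type*} [MeasurableSpace S] (ρ : S → E d → ℝ) :
    ProbabilityTheory.Kernel S (E d) :=
  (ProbabilityTheory.Kernel.const S volume).withDensity fun s x => ENNReal.ofReal (ρ s x)

instance {S : Type*} [MeasurableSpace S] (ρ : S → E d → ℝ) :
    ProbabilityTheory.IsSFiniteKernel (lawKernel ρ) :=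
  inferInstanceAs (ProbabilityTheory.IsSFiniteKernel
    ((ProbabilityTheory.Kernel.const S volume).withDensity
      fun s x => ((ρ s x).toNNReal : ℝ≥0∞)))

theorem lawKernel_apply {S : Type*} [MeasurableSpace S] {ρ : S → E d → ℝ}
    (hm : Measurable (Function.uncurry ρ)) (s : S) : lawKernel ρ s = law (ρ s) := by
  rw [lawKernel, ProbabilityTheory.Kernel.withDensity_apply]
  · rfl
  · exact ENNReal.measurable_ofReal.comp hm

/-- The measure `ρ_s(x) dx ds` on `[t,T] × E d`. -/
noncomputable def spaceTime (t T : ℝ) (ρ : ℝ → E d → ℝ) : Measure (ℝ × E d) :=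
  (volume.restrict (Icc t T)).compProd (lawKernel ρ)

variable {t T : ℝ} {ρ₀ : E d → ℝ} {ρ : ℝ → E d → ℝ} {u : ℝ → E d → E d}

theorem lintegral_spaceTime (hm : Measurable (Function.uncurry ρ)) {f : ℝ × E d → ℝ≥0∞}
    (hf : Measurable f) :
    ∫⁻ z, f z ∂(spaceTime t T ρ) = ∫⁻ s in Icc t T, ∫⁻ x, f (s, x) ∂(law (ρ s)) := by
  simp_rw [spaceTime, Measure.lintegral_compProd hf, lawKernel_apply hm]

theorem integral_spaceTime (hm : Measurable (Function.uncurry ρ)) {f : ℝ × E d → ℝ}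
    (hf : Integrable f (spaceTime t T ρ)) :
    ∫ z, f z ∂(spaceTime t T ρ) = ∫ s in Icc t T, ∫ x, f (s, x) ∂(law (ρ s)) := by
  have := Measure.integral_compProd hf
  simp_rw [lawKernel_apply hm] at this
  exact this

theorem integrable_spaceTime (hm : Measurable (Function.uncurry ρ)) {f : ℝ × E d → ℝ}
    (hf : Integrable f (spaceTime t T ρ)) :
    (∀ᵐ s ∂(volume.restrict (Icc t T)), Integrable (fun x => f (s, x)) (law (ρ s))) ∧
    Integrable (fun s => ∫ x, f (s, x) ∂(law (ρ s))) (volume.restrict (Icc t T)) := by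
  have h1 := ((Measure.integrable_compProd_iff hf.aestronglyMeasurable).1 hf).1
  have h2 : Integrable (fun s => ∫ x, f (s, x) ∂(lawKernel ρ s)) (volume.restrict (Icc t T)) :=
    Integrable.integral_compProd
      (κ := ProbabilityTheory.Kernel.const Unit (volume.restrict (Icc t T)))
      (η := ProbabilityTheory.Kernel.prodMkLeft Unit (lawKernel ρ)) (a := ()) hf
  simp_rw [lawKernel_apply hm] at h1 h2
  exact ⟨h1, h2⟩

theorem stronglyMeasurable_integral_law (hm : Measurable (Function.uncurry ρ)) {f : E d → ℝ}
    (hf : Measurable f) : StronglyMeasurable fun s => ∫ x, f x ∂(law (ρ s)) := by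
  have := StronglyMeasurable.integral_kernel (κ := lawKernel ρ) hf.stronglyMeasurable
  simpa only [lawKernel_apply hm] using this

theorem integrable_spaceTime_of_bound (hm : Measurable (Function.uncurry ρ)) {f : ℝ × E d → ℝ}
    (hf : Measurable f) (h0 : ∀ z, 0 ≤ f z) {M : ℝ}
    (hi : ∀ s ∈ Icc t T, Integrable (fun x => f (s, x)) (law (ρ s)))
    (hM : ∀ s ∈ Icc t T, ∫ x, f (s, x) ∂(law (ρ s)) ≤ M) : Integrable f (spaceTime t T ρ) := by
  refine ⟨hf.aestronglyMeasurable, ?_⟩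
  rw [hasFiniteIntegral_iff_ofReal (ae_of_all _ h0), lintegral_spaceTime hm (by fun_prop)]
  have : ∀ᵐ s ∂(volume.restrict (Icc t T)),
      ∫⁻ x, ENNReal.ofReal (f (s, x)) ∂(law (ρ s)) ≤ ENNReal.ofReal M := by
    filter_upwards [ae_restrict_mem measurableSet_Icc] with s hs
    rw [← ofReal_integral_eq_lintegral_ofReal (hi s hs) (ae_of_all _ fun x => h0 _)]
    exact ENNReal.ofReal_le_ofReal (hM s hs)
  refine (lintegral_mono_ae this).trans_lt ?_
  rw [lintegral_const]
  exact ENNReal.mul_lt_top ENNReal.ofReal_lt_top (by simp)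

/-! ### Bounds along an admissible pair -/

/-- The cutoff is squared so that the gradient of q is bounded by a multiple of √q. Young's
inequality then splits the derivative into a small multiple of q and an energy term, with K
independent of n. -/
theorem exists_truncated_moment (d : ℕ) : ∃ K : ℝ, 0 ≤ K ∧ ∀ n : ℕ,
    ∃ q : E d → ℝ, IsTest q ∧ (∀ x, q x = cutoff n x * (cutoff n x * (1 + ‖x‖ ^ 2))) ∧
      ∀ x v, ∀ ε : ℝ, 0 < ε → |fderiv ℝ q x v| ≤ ε * q x + K / ε * ‖v‖ ^ 2 := by
  obtain ⟨D, hD0, hD⟩ := exists_fderiv_cutoff_le d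
  refine ⟨2 * (D + 1) ^ 2, by positivity, fun n => ?_⟩
  have hsq : ContDiff ℝ 1 fun x : E d => 1 + ‖x‖ ^ 2 := contDiff_const.add (contDiff_norm_sq ℝ)
  refine ⟨fun x => cutoff n x * (cutoff n x * (1 + ‖x‖ ^ 2)),
    isTest_cutoff_mul n ((cutoff_contDiff n (m := 1)).mul hsq), fun x => rfl,
    fun x v ε hε => ?_⟩
  have h1 : HasFDerivAt (cutoff n) (fderiv ℝ (cutoff n) x) x :=
    ((cutoff_contDiff n (m := 1)).differentiable (by norm_num) x).hasFDerivAt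
  have h2 : HasFDerivAt (fun x : E d => 1 + ‖x‖ ^ 2) (2 • innerSL ℝ x) x :=
    (hasStrictFDerivAt_norm_sq x).hasFDerivAt.const_add 1
  have h3 := (h1.fun_mul (h1.fun_mul h2)).fderiv
  rw [h3]
  simp only [add_apply, smul_apply, innerSL_apply_apply, smul_eq_mul, nsmul_eq_mul, Nat.cast_ofNat]
  set χ := cutoff n x
  have hχ0 : 0 ≤ χ := cutoff_nonneg n x
  have hχ1 : χ ≤ 1 := cutoff_le_one n x
  set δ := fderiv ℝ (cutoff n) x v
  have hδ : |δ| * (1 + ‖x‖) ≤ D * ‖v‖ := by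
    have h4 := (fderiv ℝ (cutoff n) x).le_opNorm v
    rw [Real.norm_eq_abs] at h4
    calc |δ| * (1 + ‖x‖) ≤ ‖fderiv ℝ (cutoff n) x‖ * ‖v‖ * (1 + ‖x‖) := by gcongr
      _ = ‖fderiv ℝ (cutoff n) x‖ * (1 + ‖x‖) * ‖v‖ := by ring
      _ ≤ D * ‖v‖ := by gcongr; exact hD n x
  have hin : |inner ℝ x v| ≤ ‖x‖ * ‖v‖ := abs_real_inner_le_norm x v
  have e1 : χ * (χ * (2 * inner ℝ x v) + (1 + ‖x‖ ^ 2) * δ) + χ * (1 + ‖x‖ ^ 2) * δ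
      = 2 * χ * (χ * inner ℝ x v + (1 + ‖x‖ ^ 2) * δ) := by ring
  have hx := norm_nonneg x
  have e2 : |χ * inner ℝ x v + (1 + ‖x‖ ^ 2) * δ| ≤ (D + 1) * ‖v‖ * (1 + ‖x‖) := by
    refine (abs_add_le _ _).trans ?_
    rw [abs_mul, abs_mul, abs_of_nonneg hχ0, abs_of_nonneg (by positivity : 0 ≤ 1 + ‖x‖ ^ 2)]
    have a1 : χ * |inner ℝ x v| ≤ ‖v‖ * (1 + ‖x‖) := by
      calc χ * |inner ℝ x v| ≤ 1 * (‖x‖ * ‖v‖) := by gcongr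
        _ ≤ _ := by nlinarith [norm_nonneg v]
    have a2 : (1 + ‖x‖ ^ 2) * |δ| ≤ D * ‖v‖ * (1 + ‖x‖) := by
      calc (1 + ‖x‖ ^ 2) * |δ| ≤ (1 + ‖x‖) ^ 2 * |δ| := by gcongr; nlinarith
        _ = |δ| * (1 + ‖x‖) * (1 + ‖x‖) := by ring
        _ ≤ D * ‖v‖ * (1 + ‖x‖) := by gcongr
    linarith
  have e3 : (χ * (1 + ‖x‖)) ^ 2 ≤ 2 * (χ * (χ * (1 + ‖x‖ ^ 2))) := by
    have : (1 + ‖x‖) ^ 2 ≤ 2 * (1 + ‖x‖ ^ 2) := by nlinarith [sq_nonneg (1 - ‖x‖)]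
    calc (χ * (1 + ‖x‖)) ^ 2 = χ ^ 2 * (1 + ‖x‖) ^ 2 := by ring
      _ ≤ χ ^ 2 * (2 * (1 + ‖x‖ ^ 2)) := by gcongr
      _ = _ := by ring
  rw [e1, abs_mul, abs_of_nonneg (by positivity : 0 ≤ 2 * χ)]
  have e4 : 2 * χ * ((D + 1) * ‖v‖ * (1 + ‖x‖))
      ≤ ε / 2 * (χ * (1 + ‖x‖)) ^ 2 + 2 * (D + 1) ^ 2 / ε * ‖v‖ ^ 2 := by
    have : 0 ≤ (ε / 2) * (χ * (1 + ‖x‖) - 2 * (D + 1) / ε * ‖v‖) ^ 2 := by positivity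
    have h5 : (ε / 2) * (χ * (1 + ‖x‖) - 2 * (D + 1) / ε * ‖v‖) ^ 2
      = ε / 2 * (χ * (1 + ‖x‖)) ^ 2 + 2 * (D + 1) ^ 2 / ε * ‖v‖ ^ 2
        - 2 * χ * ((D + 1) * ‖v‖ * (1 + ‖x‖)) := by
      field_simp
      ring
    linarith
  calc _ ≤ 2 * χ * ((D + 1) * ‖v‖ * (1 + ‖x‖)) := by gcongr
    _ ≤ _ := e4
    _ ≤ _ := by nlinarith

namespace IsAdmissible

theorem memLp_control (ha : IsAdmissible t T ρ₀ ρ u) :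
    MemLp (Function.uncurry u) 2 (spaceTime t T ρ) := by
  refine memLp_two_of_lintegral_lt_top ha.measurable_control.aestronglyMeasurable ?_
  have := ha.measurable_control
  rw [lintegral_spaceTime ha.measurable_density (by fun_prop)]
  exact ha.energy

theorem integrable_energy (ha : IsAdmissible t T ρ₀ ρ u) :
    (∀ᵐ s ∂(volume.restrict (Icc t T)), Integrable (fun x => ‖u s x‖ ^ 2) (law (ρ s))) ∧
    Integrable (fun s => ∫ x, ‖u s x‖ ^ 2 ∂(law (ρ s))) (volume.restrict (Icc t T)) := by
  have h1 : Integrable (fun z => ‖Function.uncurry u z‖ ^ 2) (spaceTime t T ρ) :=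
    ha.memLp_control.integrable_norm_pow (p := 2) (by norm_num)
  have h2 := integrable_spaceTime ha.measurable_density h1
  exact h2

/-- A bound for a test moment whose derivative along the flow it controls itself. -/
theorem test_moment_le (ha : IsAdmissible t T ρ₀ ρ u) (htT : t ≤ T) {q : E d → ℝ} (hq : IsTest q)
    {K : ℝ} (hqd : ∀ x v, |fderiv ℝ q x v|
      ≤ 1 / (2 * (T - t + 1)) * q x + K / (1 / (2 * (T - t + 1))) * ‖v‖ ^ 2)
    (hq0 : ∀ x, 0 ≤ q x) (hK : 0 ≤ K) {s : ℝ} (hs : s ∈ Icc t T) :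
    ∫ x, q x ∂(law (ρ s)) ≤ 2 * (∫ x, q x ∂(law (ρ t)) + K / (1 / (2 * (T - t + 1)))
      * ∫ r in Icc t T, ∫ x, ‖u r x‖ ^ 2 ∂(law (ρ r))) := by
  obtain ⟨hae, hint⟩ := ha.integrable_energy
  generalize he : (fun s => ∫ x, ‖u s x‖ ^ 2 ∂(law (ρ s))) = e at hint
  have he' : ∀ r, ∫ x, ‖u r x‖ ^ 2 ∂(law (ρ r)) = e r := fun r => by rw [← he]
  have he0 : ∀ s, 0 ≤ e s := fun s => by
    rw [← he']; exact integral_nonneg fun _ => by positivity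
  have htmem : t ∈ Icc t T := ⟨le_rfl, htT⟩
  have hTt : 0 < T - t + 1 := by linarith
  -- Over [t,T] this ε makes the contribution of q at most half its supremum, which is then absorbed
  -- into the left side. The `+ 1` covers the case t = T.
  obtain ⟨ε, hε⟩ : ∃ ε : ℝ, ε = 1 / (2 * (T - t + 1)) := ⟨_, rfl⟩
  have hε0 : 0 < ε := by rw [hε]; positivity
  rw [← hε] at hqd ⊢
  obtain ⟨B, hB0, hB⟩ := hq.exists_bound
  have hqi : ∀ s ∈ Icc t T, Integrable q (law (ρ s)) := fun s hs => by
    have := (ha.density s hs).isProbabilityMeasure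
    exact (integrable_const B).mono' hq.continuous.aestronglyMeasurable
      (ae_of_all _ fun x => (hB x).1)
  obtain ⟨m, hm⟩ : ∃ m : ℝ → ℝ, ∀ s, ∫ x, q x ∂(law (ρ s)) = m s := ⟨_, fun _ => rfl⟩
  simp only [hm]
  have hmB : ∀ s ∈ Icc t T, m s ≤ B := fun s hs => by
    have := (ha.density s hs).isProbabilityMeasure
    have h1 := integral_mono (hqi s hs) (integrable_const B) fun x => (le_abs_self _).trans (hB x).1
    rw [← hm]
    simpa using h1
  -- The absorption is legitimate only because the supremum is finite, which holds since q is
  -- bounded.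
  have hbdd : BddAbove (m '' Icc t T) := ⟨B, by rintro _ ⟨s, hs, rfl⟩; exact hmB s hs⟩
  obtain ⟨Sup, hSup⟩ : ∃ S, sSup (m '' Icc t T) = S := ⟨_, rfl⟩
  have hmS : ∀ s ∈ Icc t T, m s ≤ Sup := fun s hs => hSup ▸ le_csSup hbdd ⟨s, hs, rfl⟩
  have hS0 : 0 ≤ Sup := le_trans (by rw [← hm]; exact integral_nonneg hq0) (hmS t htmem)
  have hgi : IntegrableOn (fun r => ε * Sup + K / ε * e r) (Icc t T) :=
    (integrable_const _).add (hint.const_mul _)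
  have h4 : ∫ r in Icc t T, (ε * Sup + K / ε * e r)
      ≤ Sup / 2 + K / ε * ∫ r in Icc t T, e r := by
    rw [integral_add (integrable_const _) (hint.const_mul _), integral_const_mul (K / ε)]
    simp only [integral_const, smul_eq_mul, measureReal_restrict_apply_univ,
      Real.volume_real_Icc_of_le htT]
    refine add_le_add ?_ le_rfl
    rw [hε]
    have : (T - t) * (1 / (2 * (T - t + 1)) * Sup)
        = ((T - t) / (T - t + 1)) * (Sup / 2) := by
      field_simp
    rw [this]
    exact mul_le_of_le_one_left (by positivity) ((div_le_one hTt).2 (by linarith))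
  have hstep : ∀ s ∈ Icc t T, m s ≤ m t + (Sup / 2 + K / ε * ∫ r in Icc t T, e r) := by
    intro s hs
    have h1 := ha.continuity q hq s hs
    have hsub : Ioc t s ⊆ Icc t T := fun r hr => ⟨hr.1.le, hr.2.trans hs.2⟩
    have hae' : ∀ᵐ r ∂(volume.restrict (Ioc t s)),
        ‖∫ x, fderiv ℝ q x (u r x) ∂(law (ρ r))‖ ≤ ε * Sup + K / ε * e r := by
      filter_upwards [ae_restrict_of_ae_restrict_of_subset hsub hae,
        ae_restrict_mem measurableSet_Ioc] with r hr hrm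
      have hr' := hsub hrm
      have h2 : ‖∫ x, fderiv ℝ q x (u r x) ∂(law (ρ r))‖
          ≤ ∫ x, (ε * q x + K / ε * ‖u r x‖ ^ 2) ∂(law (ρ r)) :=
        norm_integral_le_of_norm_le (((hqi r hr').const_mul _).add (hr.const_mul _))
          (ae_of_all _ fun x => hqd x _)
      rw [integral_add ((hqi r hr').const_mul _) (hr.const_mul _), integral_const_mul,
        integral_const_mul, he', hm] at h2
      have h3 := mul_le_mul_of_nonneg_left (hmS r hr') hε0.le
      linarith
    have h3 : ‖∫ r in t..s, ∫ x, fderiv ℝ q x (u r x) ∂(law (ρ r))‖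
        ≤ ∫ r in Icc t T, (ε * Sup + K / ε * e r) := by
      rw [intervalIntegral.integral_of_le hs.1]
      refine (norm_integral_le_of_norm_le (hgi.mono_set hsub) hae').trans ?_
      refine setIntegral_mono_set hgi (ae_of_all _ fun r => ?_) hsub.eventuallyLE
      have := he0 r
      simp only [Pi.zero_apply]
      positivity
    rw [← h1, hm, hm] at h3
    have h5 := (le_abs_self _).trans (h3.trans h4)
    linarith
  have hSle : Sup ≤ m t + (Sup / 2 + K / ε * ∫ r in Icc t T, e r) := by
    rw [← hSup]
    refine csSup_le ⟨_, ⟨t, htmem, rfl⟩⟩ ?_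
    rintro _ ⟨s, hs, rfl⟩
    rw [hSup]
    exact hstep s hs
  have := hmS s hs
  linarith

/-- The second moments are bounded along an admissible pair. -/
theorem exists_moment_bound (ha : IsAdmissible t T ρ₀ ρ u) (htT : t ≤ T) :
    ∃ M, 0 ≤ M ∧ ∀ s ∈ Icc t T, ∫ x, (1 + ‖x‖) ^ 2 ∂(law (ρ s)) ≤ M := by
  obtain ⟨K, hK0, hK⟩ := exists_truncated_moment d
  have htmem : t ∈ Icc t T := ⟨le_rfl, htT⟩
  have hle2 : ∀ x : E d, 1 + ‖x‖ ^ 2 ≤ (1 + ‖x‖) ^ 2 := fun x => by nlinarith [norm_nonneg x]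
  have hfi : ∀ s ∈ Icc t T, Integrable (fun x => 1 + ‖x‖ ^ 2) (law (ρ s)) := fun s hs => by
    refine (ha.density s hs).integrable_sq.mono' (by fun_prop) (ae_of_all _ fun x => ?_)
    rw [Real.norm_of_nonneg (by positivity)]
    exact hle2 x
  have hTt : 0 < T - t + 1 := by linarith
  have hcut : ∀ (n : ℕ) (x : E d),
      |cutoff n x * (cutoff n x * (1 + ‖x‖ ^ 2))| ≤ 1 + ‖x‖ ^ 2 := fun n x => by
    refine (abs_cutoff_mul_le n (fun x => cutoff n x * (1 + ‖x‖ ^ 2)) x).trans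
      ((abs_cutoff_mul_le n (fun x => (1 + ‖x‖ ^ 2)) x).trans ?_)
    rw [abs_of_nonneg (by positivity)]
  have hcm : ∀ n : ℕ, Continuous fun x : E d => cutoff n x * (cutoff n x * (1 + ‖x‖ ^ 2)) :=
    fun n => by
      have := (cutoff_contDiff (d := d) n (m := 0)).continuous
      fun_prop
  -- Neither K nor the untruncated initial moment depends on n, so the bound survives the removal of
  -- the cutoff.
  obtain ⟨M1, hM1⟩ : ∃ M1 : ℝ, ∀ n : ℕ, ∀ s ∈ Icc t T,
      ∫ x, cutoff n x * (cutoff n x * (1 + ‖x‖ ^ 2)) ∂(law (ρ s)) ≤ M1 := by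
    refine ⟨2 * (∫ x, (1 + ‖x‖ ^ 2) ∂(law (ρ t)) + K / (1 / (2 * (T - t + 1)))
      * ∫ r in Icc t T, ∫ x, ‖u r x‖ ^ 2 ∂(law (ρ r))), fun n s hs => ?_⟩
    obtain ⟨q, hq, hqe, hqd⟩ := hK n
    have hq0 : ∀ x, 0 ≤ q x := fun x => by
      rw [hqe]; have := cutoff_nonneg n x; positivity
    have h1 := ha.test_moment_le htT hq (fun x v => hqd x v _ (by positivity)) hq0 hK0 hs
    simp_rw [hqe] at h1
    have h2 : ∫ x, cutoff n x * (cutoff n x * (1 + ‖x‖ ^ 2)) ∂(law (ρ t))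
        ≤ ∫ x, (1 + ‖x‖ ^ 2) ∂(law (ρ t)) :=
      integral_mono ((hfi t htmem).mono' (hcm n).aestronglyMeasurable (ae_of_all _ (hcut n)))
        (hfi t htmem) fun x => (le_abs_self _).trans (hcut n x)
    linarith
  have h3 : ∀ s ∈ Icc t T, ∫ x, (1 + ‖x‖) ^ 2 ∂(law (ρ s)) ≤ 2 * M1 := by
    intro s hs
    have hlim : ∫ x, (1 + ‖x‖ ^ 2) ∂(law (ρ s)) ≤ M1 := by
      refine le_of_tendsto' (tendsto_integral_of_dominated_convergence (fun x => 1 + ‖x‖ ^ 2)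
        (fun n => (hcm n).aestronglyMeasurable) (hfi s hs) (fun n => ae_of_all _ (hcut n))
        (ae_of_all _ fun x => ?_)) fun n => hM1 n s hs
      refine tendsto_const_nhds.congr' ?_
      filter_upwards [eventually_cutoff_eq_one x] with n hn
      rw [hn.self_of_nhds, one_mul, one_mul]
    have h2 : ∫ x, (1 + ‖x‖) ^ 2 ∂(law (ρ s)) ≤ ∫ x, 2 * (1 + ‖x‖ ^ 2) ∂(law (ρ s)) := by
      refine integral_mono (ha.density s hs).integrable_sq ((hfi s hs).const_mul 2) fun x => ?_
      nlinarith [sq_nonneg (1 - ‖x‖)]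
    rw [integral_const_mul] at h2
    linarith
  exact ⟨2 * M1, le_trans (integral_nonneg fun x => by positivity) (h3 t htmem), h3⟩

/-- Young's inequality between the second moments, bounded in time, and the energy. This is the
integrability that allows testing against functions of quadratic growth. -/
theorem integrable_norm_mul (ha : IsAdmissible t T ρ₀ ρ u) (htT : t ≤ T) :
    Integrable (fun z : ℝ × E d => (1 + ‖z.2‖) * ‖Function.uncurry u z‖) (spaceTime t T ρ) := by
  obtain ⟨M, -, hM⟩ := ha.exists_moment_bound htT
  have h1 : Integrable (fun z : ℝ × E d => (1 + ‖z.2‖) ^ 2) (spaceTime t T ρ) :=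
    integrable_spaceTime_of_bound ha.measurable_density (by fun_prop) (fun z => by positivity)
      (fun s hs => (ha.density s hs).integrable_sq) hM
  have h2 := ha.memLp_control.integrable_norm_pow (p := 2) (by norm_num)
  have := ha.measurable_control
  refine (h1.add h2).mono' (by fun_prop) (ae_of_all _ fun z => ?_)
  rw [Real.norm_of_nonneg (by positivity)]
  simp only [Pi.add_apply]
  nlinarith [sq_nonneg (1 + ‖z.2‖ - ‖Function.uncurry u z‖), norm_nonneg z.2,
    norm_nonneg (Function.uncurry u z)]

theorem ae_integrable_norm_mul (ha : IsAdmissible t T ρ₀ ρ u) (htT : t ≤ T) :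
    ∀ᵐ s ∂(volume.restrict (Icc t T)),
      Integrable (fun x => (1 + ‖x‖) * ‖u s x‖) (law (ρ s)) :=
  (integrable_spaceTime ha.measurable_density (ha.integrable_norm_mul htT)).1

theorem measurable_slice (ha : IsAdmissible t T ρ₀ ρ u) (s : ℝ) : Measurable (u s) :=
  ha.measurable_control.comp measurable_prodMk_left

theorem ae_locallyIntegrable (ha : IsAdmissible t T ρ₀ ρ u) (htT : t ≤ T) :
    ∀ᵐ s ∂(volume.restrict (Icc t T)), LocallyIntegrable (u s) (law (ρ s)) := by
  filter_upwards [ha.ae_integrable_norm_mul htT] with s hs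
  refine Integrable.locallyIntegrable ?_
  refine hs.mono' (ha.measurable_slice s).aestronglyMeasurable (ae_of_all _ fun x => ?_)
  exact le_mul_of_one_le_left (norm_nonneg _) (by linarith [norm_nonneg x])

theorem integrable_fderiv (ha : IsAdmissible t T ρ₀ ρ u) (htT : t ≤ T) {C : ℝ} {f : E d → ℝ}
    (hf : QuadGrowth C f) :
    Integrable (fun z : ℝ × E d => fderiv ℝ f z.2 (Function.uncurry u z)) (spaceTime t T ρ) :=
  hf.integrable_fderiv measurable_snd.aestronglyMeasurable
    ha.measurable_control.aestronglyMeasurable (ha.integrable_norm_mul htT)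

theorem integrable_integral_fderiv (ha : IsAdmissible t T ρ₀ ρ u) (htT : t ≤ T) {C : ℝ}
    {f : E d → ℝ} (hf : QuadGrowth C f) :
    Integrable (fun s => ∫ x, fderiv ℝ f x (u s x) ∂(law (ρ s))) (volume.restrict (Icc t T)) :=
  (integrable_spaceTime ha.measurable_density (ha.integrable_fderiv htT hf)).2

theorem integrable_of_quadGrowth {ρ : E d → ℝ} (hρ : IsDensity ρ) {C : ℝ} {f : E d → ℝ}
    (hf : QuadGrowth C f) : Integrable f (law ρ) :=
  (hρ.integrable_sq.const_mul C).mono' hf.contDiff.continuous.aestronglyMeasurable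
    (ae_of_all _ hf.bound)

/-- The continuity equation tested against functions of quadratic growth. -/
theorem integral_sub_eq (ha : IsAdmissible t T ρ₀ ρ u) (htT : t ≤ T) {C : ℝ} {f : E d → ℝ}
    (hf : QuadGrowth C f) :
    ∫ x, f x ∂(law (ρ T)) - ∫ x, f x ∂(law (ρ t))
      = ∫ s in Icc t T, ∫ x, fderiv ℝ f x (u s x) ∂(law (ρ s)) := by
  have key : ∀ n : ℕ, ∫ x, cutoff n x * f x ∂(law (ρ T)) - ∫ x, cutoff n x * f x ∂(law (ρ t))
      = ∫ z, fderiv ℝ (fun y => cutoff n y * f y) z.2 (Function.uncurry u z)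
        ∂(spaceTime t T ρ) := by
    intro n
    have hφ := isTest_cutoff_mul n hf.contDiff
    obtain ⟨C', hC'⟩ := hφ.quadGrowth
    rw [ha.continuity _ hφ T ⟨htT, le_rfl⟩, intervalIntegral.integral_of_le htT,
      ← integral_Icc_eq_integral_Ioc,
      integral_spaceTime ha.measurable_density (ha.integrable_fderiv htT hC')]
    rfl
  have hlim : ∀ s ∈ Icc t T, Tendsto (fun n => ∫ x, cutoff n x * f x ∂(law (ρ s))) atTop
      (𝓝 (∫ x, f x ∂(law (ρ s)))) := fun s hs => by
    have := tendsto_integral_cutoff_mul (μ := law (ρ s)) (f := f) (g := fun _ => 1)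
      (by simpa using integrable_of_quadGrowth (ha.density s hs) hf)
    simpa using this
  have hr := hf.tendsto_integral_fderiv (μ := spaceTime t T ρ) (X := Prod.snd)
    (U := Function.uncurry u) measurable_snd.aestronglyMeasurable
    ha.measurable_control.aestronglyMeasurable (ha.integrable_norm_mul htT)
  have hl := (hlim T ⟨htT, le_rfl⟩).sub (hlim t ⟨le_rfl, htT⟩)
  rw [tendsto_nhds_unique (hl.congr key) hr,
    integral_spaceTime ha.measurable_density (ha.integrable_fderiv htT hf)]
  rfl

end IsAdmissible

end

/-! ### The lower bound for the cost and the case of equality. -/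

section

theorem ereal_coe_le_add_iff (X : ℝ≥0∞) (y z : ℝ) :
    (z : EReal) ≤ (X : EReal) + (y : EReal) ↔ ENNReal.ofReal (z - y) ≤ X := by
  induction X using ENNReal.recTopCoe with
  | top => simp
  | coe X =>
    have h1 : ((X : ℝ≥0∞) : EReal) = ((X : ℝ) : EReal) := rfl
    rw [h1, ← EReal.coe_add, EReal.coe_le_coe_iff, ← ENNReal.ofReal_coe_nnreal,
      ENNReal.ofReal_le_ofReal_iff X.coe_nonneg, sub_le_iff_le_add]

/-- The sign of z - y is recorded separately because `ENNReal.ofReal` forgets it, and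
`ae_eq_zero_of_lintegral_le` needs it. -/
theorem le_ofReal_of_ereal_add_le {X : ℝ≥0∞} {y z : ℝ}
    (h : (X : EReal) + (y : EReal) ≤ (z : EReal)) : 0 ≤ z - y ∧ X ≤ ENNReal.ofReal (z - y) := by
  induction X using ENNReal.recTopCoe with
  | top => simp at h
  | coe X =>
    have h1 : ((X : ℝ≥0∞) : EReal) = ((X : ℝ) : EReal) := rfl
    rw [h1, ← EReal.coe_add, EReal.coe_le_coe_iff] at h
    rw [← ENNReal.ofReal_coe_nnreal]
    have hX : (0 : ℝ) ≤ X := X.2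
    refine ⟨by linarith, ?_⟩
    exact ENNReal.ofReal_le_ofReal (by linarith)

theorem ofReal_integral_le_lintegral {Ω : Type*} [MeasurableSpace Ω] {ν : Measure Ω} {a : Ω → ℝ}
    (ha : Integrable a ν) : ENNReal.ofReal (∫ s, a s ∂ν) ≤ ∫⁻ s, ENNReal.ofReal (a s) ∂ν := by
  have h1 : ∫ s, a s ∂ν ≤ ∫ s, max (a s) 0 ∂ν :=
    integral_mono ha ha.pos_part fun s => le_max_left _ _
  have h2 := ofReal_integral_eq_lintegral_ofReal ha.pos_part (ae_of_all _ fun s => le_max_right _ _)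
  refine (ENNReal.ofReal_le_ofReal h1).trans (h2.le.trans (lintegral_mono fun s => ?_))
  simp [ENNReal.ofReal_max]

/-- Equality in a lower bound of a lower integral forces the nonnegative excess to vanish. -/
theorem ae_eq_zero_of_lintegral_le {Ω : Type*} [MeasurableSpace Ω] {ν : Measure Ω} {a b : Ω → ℝ}
    (ha : Integrable a ν) (hb : AEStronglyMeasurable b ν) (hb0 : ∀ s, 0 ≤ b s)
    (h0 : 0 ≤ ∫ s, a s ∂ν)
    (h : ∫⁻ s, ENNReal.ofReal (a s + b s) ∂ν ≤ ENNReal.ofReal (∫ s, a s ∂ν)) :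
    ∀ᵐ s ∂ν, b s = 0 := by
  -- `ENNReal.ofReal` truncates at 0 and b is not known to be integrable, so the argument runs on
  -- the positive part of a + b. It dominates a pointwise while its integral is at most that of a,
  -- so the two agree almost everywhere.
  have hF : AEStronglyMeasurable (fun s => max (a s + b s) 0) ν :=
    (ha.aestronglyMeasurable.add hb).sup aestronglyMeasurable_const
  have hof : ∀ s, ENNReal.ofReal (max (a s + b s) 0) = ENNReal.ofReal (a s + b s) := fun s => by
    simp [ENNReal.ofReal_max]
  have hFi : Integrable (fun s => max (a s + b s) 0) ν := by
    refine ⟨hF, ?_⟩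
    rw [hasFiniteIntegral_iff_ofReal (f := fun s => max (a s + b s) 0)
      (ae_of_all _ fun s => le_max_right _ _)]
    simp_rw [hof]
    exact h.trans_lt ENNReal.ofReal_lt_top
  have h1 : ∫ s, max (a s + b s) 0 ∂ν ≤ ∫ s, a s ∂ν := by
    have h2 := ofReal_integral_eq_lintegral_ofReal hFi (ae_of_all _ fun s => le_max_right _ _)
    simp_rw [hof] at h2
    rw [← h2] at h
    exact (ENNReal.ofReal_le_ofReal_iff h0).1 h
  have hge : ∀ s, a s + b s ≤ max (a s + b s) 0 := fun s => le_max_left _ _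
  have hnn : 0 ≤ fun s => max (a s + b s) 0 - a s := fun s => by
    have := hge s; have := hb0 s
    simp only [Pi.zero_apply]; linarith
  have h3 : ∫ s, (max (a s + b s) 0 - a s) ∂ν = 0 := by
    refine le_antisymm ?_ (integral_nonneg hnn)
    rw [integral_sub hFi ha]
    linarith
  have h4 := (integral_eq_zero_iff_of_nonneg hnn (hFi.sub ha)).1 h3
  filter_upwards [h4] with s hs
  have := hge s; have := hb0 s
  simp only [Pi.zero_apply] at hs
  linarith

variable {β t T C : ℝ} {h ρ₀ : E d → ℝ} {ρ : ℝ → E d → ℝ} {u : ℝ → E d → E d}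

namespace IsAdmissible

/-- The pointwise bound is integrated by monotonicity of the lower integral alone; the Lagrangian
need not be measurable in time. -/
theorem lintegral_le_lagrangian (ha : IsAdmissible t T ρ₀ ρ u) (htT : t ≤ T) (hβ : 0 < β)
    (hh : QuadGrowth C h) {φ : E d → ℝ} (hφ : IsTest φ) {B : ℝ} (hB : ∀ x, |φ x| ≤ B) {c : ℝ}
    (hc : 0 ≤ c) (hcB : c * B ^ 2 ≤ 1 / 2) :
    ∫⁻ s in Icc t T, ENNReal.ofReal (-β * (∫ x, fderiv ℝ h x (u s x) ∂(law (ρ s)))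
      + c * (∫ x, φ x * (β * (h x - mean (ρ s) h)) ∂(law (ρ s))
        + ∫ x, fderiv ℝ φ x (u s x) ∂(law (ρ s))) ^ 2)
      ≤ ∫⁻ s in Icc t T, lagrangian β h (ρ s) (u s) := by
  refine lintegral_mono_ae ?_
  filter_upwards [ha.ae_integrable_norm_mul htT, ae_restrict_mem measurableSet_Icc] with s hs hsm
  have := (ha.density s hsm).isProbabilityMeasure
  exact le_lagrangian hβ hs hh hφ hB hc hcB

/-- The cost of an admissible pair is at least `β ∫ h ρ₀ dx`. -/
theorem le_cost (ha : IsAdmissible t T ρ₀ ρ u) (htT : t ≤ T) (hβ : 0 < β)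
    (hh : QuadGrowth C h) :
    ((β * ∫ x, h x ∂(law ρ₀) : ℝ) : EReal) ≤ cost β h t T ρ u := by
  rw [cost, ereal_coe_le_add_iff, ← ha.initial]
  have h1 := ha.integral_sub_eq htT hh
  -- With φ = 0 and c = 0 the tested square disappears and only the transport term remains.
  have h2 := ha.lintegral_le_lagrangian htT hβ hh (φ := fun _ => 0)
    ⟨contDiff_const, HasCompactSupport.zero⟩ (B := 0) (by simp) le_rfl (by norm_num)
  simp only [zero_mul, add_zero] at h2
  refine le_trans ?_ ((ofReal_integral_le_lintegral
    ((ha.integrable_integral_fderiv htT hh).const_mul (-β))).trans h2)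
  rw [integral_const_mul, ← h1]
  exact ENNReal.ofReal_le_ofReal (by linarith)

/-- Expanding the centred product leaves integrals of the fixed functions φh, φ and h against the
laws, each measurable in time by the kernel structure. -/
theorem aestronglyMeasurable_residual (ha : IsAdmissible t T ρ₀ ρ u) (htT : t ≤ T)
    (hh : QuadGrowth C h) {φ : E d → ℝ} (hφ : IsTest φ) :
    AEStronglyMeasurable (fun s => ∫ x, φ x * (β * (h x - mean (ρ s) h)) ∂(law (ρ s))
        + ∫ x, fderiv ℝ φ x (u s x) ∂(law (ρ s))) (volume.restrict (Icc t T)) := by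
  obtain ⟨C', hC'⟩ := hφ.quadGrowth
  refine AEStronglyMeasurable.add ?_ (ha.integrable_integral_fderiv htT hC').aestronglyMeasurable
  have hhm := hh.contDiff.continuous.measurable
  have hφm := hφ.continuous.measurable
  have m1 := stronglyMeasurable_integral_law ha.measurable_density (hφm.mul hhm)
  have m2 := stronglyMeasurable_integral_law ha.measurable_density hφm
  have m3 := stronglyMeasurable_integral_law ha.measurable_density hhm
  refine (((m1.sub (m3.mul m2)).const_mul β).aestronglyMeasurable).congr ?_
  filter_upwards [ae_restrict_mem measurableSet_Icc] with s hs
  have hint := integrable_of_quadGrowth (ha.density s hs) hh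
  have i1 := hφ.integrable_mul hint.locallyIntegrable
  have i2 := integrable_of_quadGrowth (ha.density s hs) hC'
  have e : ∀ x, φ x * (β * (h x - mean (ρ s) h))
      = β * (φ x * h x - mean (ρ s) h * φ x) := fun x => by ring
  simp_rw [e]
  rw [integral_const_mul, integral_sub i1 (i2.const_mul _), integral_const_mul]
  rfl

/-- A pair whose cost does not exceed `β ∫ h ρ₀ dx` satisfies the control law. -/
theorem solvesControlPDE_of_cost_le (ha : IsAdmissible t T ρ₀ ρ u) (htT : t ≤ T) (hβ : 0 < β)
    (hh : QuadGrowth C h)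
    (hcost : cost β h t T ρ u ≤ ((β * ∫ x, h x ∂(law ρ₀) : ℝ) : EReal)) :
    ∀ᵐ s ∂(volume.restrict (Icc t T)), SolvesControlPDE β h (ρ s) (u s) := by
  obtain ⟨h0, hL⟩ := le_ofReal_of_ereal_add_le hcost
  have h1 := ha.integral_sub_eq htT hh
  have hai := (ha.integrable_integral_fderiv htT hh).const_mul (-β)
  have hval : β * ∫ x, h x ∂(law ρ₀) - β * ∫ x, h x ∂(law (ρ T))
      = ∫ s in Icc t T, -β * (∫ x, fderiv ℝ h x (u s x) ∂(law (ρ s))) := by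
    rw [integral_const_mul, ← h1, ← ha.initial]
    ring
  rw [hval] at hL h0
  have key : ∀ n, ∀ᵐ s ∂(volume.restrict (Icc t T)),
      ∫ x, denseTest d n x * (β * (h x - mean (ρ s) h)) ∂(law (ρ s))
        + ∫ x, fderiv ℝ (denseTest d n) x (u s x) ∂(law (ρ s)) = 0 := by
    intro n
    have hφ := isTest_denseTest (d := d) n
    obtain ⟨B, hB0, hB⟩ := hφ.exists_bound
    -- This is the largest weight allowed by c B² ≤ 1/2; being positive, it forces the tested
    -- residual itself to vanish.
    have hc : 0 < 1 / (2 * B ^ 2) := by positivity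
    have h2 := ha.lintegral_le_lagrangian htT hβ hh hφ (fun x => (hB x).1) hc.le
      (by field_simp; norm_num)
    have h3 := ae_eq_zero_of_lintegral_le hai
      (((ha.aestronglyMeasurable_residual (β := β) htT hh hφ).pow 2).const_mul (1 / (2 * B ^ 2)))
      (fun s => mul_nonneg hc.le (sq_nonneg _)) h0 (h2.trans hL)
    filter_upwards [h3] with s hs
    rcases mul_eq_zero.1 hs with h4 | h4
    · exact absurd h4 hc.ne'
    · exact pow_eq_zero_iff (two_ne_zero) |>.1 h4
  filter_upwards [ae_all_iff.2 key, ha.ae_locallyIntegrable htT,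
    ae_restrict_mem measurableSet_Icc] with s hs hul hsm
  have := (ha.density s hsm).isProbabilityMeasure
  have hw : LocallyIntegrable (fun x => β * (h x - mean (ρ s) h)) (law (ρ s)) :=
    (((integrable_of_quadGrowth (ha.density s hsm) hh).sub
      (integrable_const _)).const_mul β).locallyIntegrable
  exact ⟨hul, hw, fun φ hφ => forall_isTest_of_denseTest hw hul
    (fun n => eq_neg_of_add_eq_zero_left (hs n)) hφ⟩

end IsAdmissible

/-! ### Exponential moments of solutions of the control law -/

/-- The function exp(-K(s-t)) (m(t) + K ∫ m) is nonincreasing, since the integral inequality gives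
its derivative a sign. -/
theorem gronwall_integral {m : ℝ → ℝ} (hm : StronglyMeasurable m) (hc : ContinuousOn m (Icc t T))
    {K : ℝ} (hK : 0 ≤ K) (hle : ∀ s ∈ Icc t T, m s ≤ m t + K * ∫ r in t..s, m r)
    {s : ℝ} (hs : s ∈ Icc t T) : m s ≤ Real.exp (K * (s - t)) * m t := by
  have htT : t ≤ T := hs.1.trans hs.2
  have hint : ∀ s ∈ Icc t T, IntervalIntegrable m volume t s := fun s hs =>
    (hc.mono (by rw [uIcc_of_le hs.1]; exact Icc_subset_Icc_right hs.2)).intervalIntegrable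
  let y : ℝ → ℝ := fun s => Real.exp (-(K * (s - t))) * (m t + K * ∫ r in t..s, m r)
  have hder : ∀ s ∈ Ioo t T, HasDerivAt y
      (Real.exp (-(K * (s - t))) * (-K) * (m t + K * ∫ r in t..s, m r)
        + Real.exp (-(K * (s - t))) * (K * m s)) s := by
    intro s hs
    have hd1 := intervalIntegral.integral_hasDerivAt_right (hint s ⟨hs.1.le, hs.2.le⟩)
      hm.stronglyMeasurableAtFilter (hc.continuousAt (Icc_mem_nhds hs.1 hs.2))
    have hd2 : HasDerivAt (fun s => -(K * (s - t))) (-K) s := by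
      have := (((hasDerivAt_id s).sub_const t).const_mul K).neg
      rw [mul_one] at this
      exact this
    exact hd2.exp.mul ((hd1.const_mul K).const_add (m t))
  have hcont : ContinuousOn y (Icc t T) := by
    have hp : ContinuousOn (fun s => ∫ r in t..s, m r) (Icc t T) := by
      have := intervalIntegral.continuousOn_primitive_interval (f := m) (μ := volume)
        (a := t) (b := T) (by rw [uIcc_of_le htT]; exact hc.integrableOn_Icc)
      rwa [uIcc_of_le htT] at this
    have he : Continuous fun s : ℝ => Real.exp (-(K * (s - t))) := by fun_prop
    exact he.continuousOn.mul (continuousOn_const.add (continuousOn_const.mul hp))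
  have hanti : AntitoneOn y (Icc t T) := by
    refine antitoneOn_of_deriv_nonpos (convex_Icc _ _) hcont (fun s hs => ?_) fun s hs => ?_
    · rw [interior_Icc] at hs
      exact (hder s hs).differentiableAt.differentiableWithinAt
    · rw [interior_Icc] at hs
      rw [(hder s hs).deriv]
      have h1 := hle s ⟨hs.1.le, hs.2.le⟩
      have h2 := mul_nonneg (mul_nonneg hK (Real.exp_nonneg (-(K * (s - t))))) (sub_nonneg.2 h1)
      linarith
  have h1 := hanti ⟨le_rfl, htT⟩ hs hs.1
  have h2 : y t = m t := by simp [y]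
  rw [h2] at h1
  have h3 : m t + K * ∫ r in t..s, m r = Real.exp (K * (s - t)) * y s := by
    simp only [y]
    rw [← mul_assoc, ← Real.exp_add, add_neg_cancel, Real.exp_zero, one_mul]
  have h4 := hle s hs
  rw [h3] at h4
  exact h4.trans (mul_le_mul_of_nonneg_left h1 (Real.exp_nonneg _))

/-- For a compact set, a smooth function equal to 1 on it and supported in a slightly larger open
set transfers the bound, and outer regularity shrinks the open set. Inner regularity then passes to
measurable sets. -/
theorem measure_le_of_forall_isTest {μ ν : Measure (E d)} [IsFiniteMeasure μ] [IsFiniteMeasure ν]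
    {U : Set (E d)} (hU : IsOpen U) {c : ℝ} (hc : 0 ≤ c)
    (h : ∀ φ : E d → ℝ, IsTest φ → (∀ x, 0 ≤ φ x) → tsupport φ ⊆ U →
      ∫ x, φ x ∂μ ≤ c * ∫ x, φ x ∂ν) {A : Set (E d)} (hA : MeasurableSet A) (hAU : A ⊆ U) :
    μ A ≤ ENNReal.ofReal c * ν A := by
  have hK : ∀ K : Set (E d), IsCompact K → K ⊆ U → μ K ≤ ENNReal.ofReal c * ν K := by
    intro K hK hKU
    have hopen : ∀ W : Set (E d), IsOpen W → K ⊆ W → μ K ≤ ENNReal.ofReal c * ν W := by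
      intro W hW hKW
      obtain ⟨L, hL, hKL, hLW⟩ := exists_compact_between hK (hW.inter hU) (subset_inter hKW hKU)
      obtain ⟨f, hf, hf01, hfs, hf1⟩ := exists_contMDiff_support_eq_eq_one_iff
        (modelWithCornersSelf ℝ (E d)) (n := (⊤ : ℕ∞)) (isOpen_interior (s := L)) hK.isClosed hKL
      have hts : tsupport f ⊆ L := by
        rw [tsupport, hfs]
        exact closure_minimal interior_subset hL.isClosed
      have hfc : HasCompactSupport f := hL.of_isClosed_subset (isClosed_tsupport f) hts
      have hft : IsTest f := IsTest.of_contDiff hf.contDiff hfc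
      have hf0 : ∀ x, 0 ≤ f x := fun x => (hf01 ⟨x, rfl⟩).1
      have hfle : ∀ x, f x ≤ 1 := fun x => (hf01 ⟨x, rfl⟩).2
      have h1 := h f hft hf0 (hts.trans (hLW.trans inter_subset_right))
      have hfi : ∀ (μ : Measure (E d)) [IsFiniteMeasure μ], Integrable f μ := fun μ _ =>
        (integrable_const (1 : ℝ)).mono' hft.continuous.aestronglyMeasurable
          (ae_of_all _ fun x => by rw [Real.norm_of_nonneg (hf0 x)]; exact hfle x)
      have h2 : μ K ≤ ENNReal.ofReal (∫ x, f x ∂μ) := by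
        rw [ofReal_integral_eq_lintegral_ofReal (hfi μ) (ae_of_all _ hf0),
          ← lintegral_indicator_one hK.measurableSet]
        refine lintegral_mono fun x => ?_
        by_cases hx : x ∈ K
        · simp [hx, (hf1 x).1 hx]
        · simp [hx]
      have h3 : ENNReal.ofReal (∫ x, f x ∂ν) ≤ ν W := by
        rw [ofReal_integral_eq_lintegral_ofReal (hfi ν) (ae_of_all _ hf0),
          ← lintegral_indicator_one hW.measurableSet]
        refine lintegral_mono fun x => ?_
        by_cases hx : x ∈ W
        · simp only [hx, indicator_of_mem, Pi.one_apply]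
          exact ENNReal.ofReal_le_one.2 (hfle x)
        · have : f x = 0 := image_eq_zero_of_notMem_tsupport fun hxt => hx (hLW (hts hxt)).1
          simp [this]
      calc μ K ≤ ENNReal.ofReal (∫ x, f x ∂μ) := h2
        _ ≤ ENNReal.ofReal (c * ∫ x, f x ∂ν) := ENNReal.ofReal_le_ofReal h1
        _ = ENNReal.ofReal c * ENNReal.ofReal (∫ x, f x ∂ν) := ENNReal.ofReal_mul hc
        _ ≤ _ := by gcongr
    refine ENNReal.le_of_forall_pos_le_add fun ε hε _ => ?_
    -- Dividing by c + 1 rather than c also covers c = 0.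
    have hδ : 0 < (ε : ℝ) / (c + 1) := by positivity
    obtain ⟨W, hKW, hW, hνW⟩ := K.exists_isOpen_le_add ν
      (ε := ENNReal.ofReal (ε / (c + 1))) (by simpa using hδ)
    calc μ K ≤ ENNReal.ofReal c * ν W := hopen W hW hKW
      _ ≤ ENNReal.ofReal c * (ν K + ENNReal.ofReal (ε / (c + 1))) := by gcongr
      _ = ENNReal.ofReal c * ν K + ENNReal.ofReal (c * (ε / (c + 1))) := by
        rw [mul_add, ENNReal.ofReal_mul hc]
      _ ≤ ENNReal.ofReal c * ν K + ε := by
        refine add_le_add le_rfl ?_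
        rw [← ENNReal.ofReal_coe_nnreal]
        refine ENNReal.ofReal_le_ofReal ?_
        rw [mul_div_assoc', div_le_iff₀ (by positivity)]
        nlinarith [ε.2]
  rw [hA.measure_eq_iSup_isCompact]
  exact iSup₂_le fun K hKA => iSup_le fun hKc =>
    (hK K hKc (hKA.trans hAU)).trans (by gcongr)

end

section

variable {d : ℕ} {β t T C : ℝ} {h ρ₀ : E d → ℝ} {ρ : ℝ → E d → ℝ} {u : ℝ → E d → E d}

namespace IsAdmissible

theorem exists_mean_bound (ha : IsAdmissible t T ρ₀ ρ u) (htT : t ≤ T) (hh : QuadGrowth C h) :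
    ∃ H, 0 ≤ H ∧ ∀ s ∈ Icc t T, |mean (ρ s) h| ≤ H := by
  obtain ⟨M, hM0, hM⟩ := ha.exists_moment_bound htT
  have hC := hh.nonneg
  refine ⟨C * M, by positivity, fun s hs => ?_⟩
  have h1 : ‖mean (ρ s) h‖ ≤ ∫ x, C * (1 + ‖x‖) ^ 2 ∂(law (ρ s)) :=
    norm_integral_le_of_norm_le ((ha.density s hs).integrable_sq.const_mul C) (ae_of_all _ hh.bound)
  rw [integral_const_mul] at h1
  exact h1.trans (mul_le_mul_of_nonneg_left (hM s hs) hC)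

/-- Along the control law, the mass in a ball grows at most exponentially. -/
theorem test_moment_le_exp (ha : IsAdmissible t T ρ₀ ρ u) (htT : t ≤ T) (hβ : 0 < β)
    (hpde : ∀ᵐ s ∂(volume.restrict (Icc t T)), SolvesControlPDE β h (ρ s) (u s))
    {a : ℝ} (ha0 : 0 ≤ a) (hlow : ∀ x, -(a * (1 + ‖x‖)) ≤ h x) {H : ℝ} (hH0 : 0 ≤ H)
    (hH : ∀ s ∈ Icc t T, |mean (ρ s) h| ≤ H) {φ : E d → ℝ} (hφ : IsTest φ) (hφ0 : ∀ x, 0 ≤ φ x)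
    {R : ℝ} (hR0 : 0 ≤ R) (hR : ∀ x, φ x ≠ 0 → ‖x‖ ≤ R) {s : ℝ} (hs : s ∈ Icc t T) :
    ∫ x, φ x ∂(law (ρ s))
      ≤ Real.exp (β * (a * (1 + R) + H) * (s - t)) * ∫ x, φ x ∂(law (ρ t)) := by
  obtain ⟨Cφ, hCφ⟩ := hφ.quadGrowth
  set K := β * (a * (1 + R) + H) with hK
  have hK0 : 0 ≤ K := by positivity
  set m : ℝ → ℝ := fun s => ∫ x, φ x ∂(law (ρ s)) with hmdef
  set F : ℝ → ℝ := fun s => ∫ x, fderiv ℝ φ x (u s x) ∂(law (ρ s)) with hF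
  have hFi : IntegrableOn F (Icc t T) := ha.integrable_integral_fderiv htT hCφ
  have hm : StronglyMeasurable m :=
    stronglyMeasurable_integral_law ha.measurable_density hφ.continuous.measurable
  have hms : ∀ s ∈ Icc t T, m s = m t + ∫ r in t..s, F r := fun s hs => by
    have := ha.continuity φ hφ s hs
    simp only [hmdef, hF]
    linarith
  have hmc : ContinuousOn m (Icc t T) := by
    have h1 := intervalIntegral.continuousOn_primitive_interval (f := F) (μ := volume)
      (a := t) (b := T) (by rwa [uIcc_of_le htT])
    rw [uIcc_of_le htT] at h1
    exact (continuousOn_const.add h1).congr hms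
  -- The control law turns the derivative of m into β ∫ φ (ĥ - h) ρ. On the support of φ the lower
  -- bound for h gives ĥ - h ≤ H + a(1+R), which is the rate K/β.
  have hFm : ∀ᵐ r ∂(volume.restrict (Icc t T)), F r ≤ K * m r := by
    filter_upwards [hpde, ae_restrict_mem measurableSet_Icc] with r hr hrm
    have h1 := hr.2.2 φ hφ
    have h2 : F r = ∫ x, φ x * (β * (mean (ρ r) h - h x)) ∂(law (ρ r)) := by
      have e : ∀ x, φ x * (β * (mean (ρ r) h - h x)) = -(φ x * (β * (h x - mean (ρ r) h))) :=
        fun x => by ring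
      simp_rw [e]
      rw [integral_neg, h1, neg_neg]
    have hi : Integrable (fun x => φ x * (β * (mean (ρ r) h - h x))) (law (ρ r)) := by
      have := (hφ.integrable_mul hr.2.1).neg
      refine this.congr (ae_of_all _ fun x => ?_)
      simp only [Pi.neg_apply]
      ring
    rw [h2, hmdef, ← integral_const_mul]
    refine integral_mono hi ((integrable_of_quadGrowth (ha.density r hrm) hCφ).const_mul K)
      fun x => ?_
    by_cases hx : φ x = 0
    · simp [hx]
    have hxR := hR x hx
    have hmr := (le_abs_self _).trans (hH r hrm)
    have hl := hlow x
    have h3 : β * (mean (ρ r) h - h x) ≤ K := by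
      rw [hK]
      refine mul_le_mul_of_nonneg_left ?_ hβ.le
      have : a * (1 + ‖x‖) ≤ a * (1 + R) := by gcongr
      linarith
    have := mul_le_mul_of_nonneg_left h3 (hφ0 x)
    simp only
    linarith
  refine gronwall_integral hm hmc hK0 (fun s hs => ?_) hs
  rw [hms s hs, intervalIntegral.integral_of_le hs.1, intervalIntegral.integral_of_le hs.1,
    ← integral_const_mul]
  refine add_le_add le_rfl ?_
  have hsub : Ioc t s ⊆ Icc t T := fun r hr => ⟨hr.1.le, hr.2.trans hs.2⟩
  exact integral_mono_ae (hFi.mono_set hsub)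
    ((hmc.integrableOn_Icc.mono_set hsub).const_mul K)
    (ae_restrict_of_ae_restrict_of_subset hsub hFm)

/-- The growth rate in a ball is linear in its radius. Cutting space into the shells where ⌊‖x‖⌋ =
n, each inside the ball of radius n+1, turns it into a pointwise factor; 2 + ‖x‖ pays for the
rounding. -/
theorem lintegral_le_exp (ha : IsAdmissible t T ρ₀ ρ u) (htT : t ≤ T) (hβ : 0 < β)
    (hpde : ∀ᵐ s ∂(volume.restrict (Icc t T)), SolvesControlPDE β h (ρ s) (u s))
    {a : ℝ} (ha0 : 0 ≤ a) (hlow : ∀ x, -(a * (1 + ‖x‖)) ≤ h x) {H : ℝ} (hH0 : 0 ≤ H)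
    (hH : ∀ s ∈ Icc t T, |mean (ρ s) h| ≤ H) {s : ℝ} (hs : s ∈ Icc t T)
    (f : E d → ℝ≥0∞) (hf : Measurable f) :
    ∫⁻ x, f x ∂(law (ρ s)) ≤ ∫⁻ x, ENNReal.ofReal
      (Real.exp (β * (a * (2 + ‖x‖) + H) * (s - t))) * f x ∂(law (ρ t)) := by
  have := (ha.density s hs).isProbabilityMeasure
  have := (ha.density t ⟨le_rfl, htT⟩).isProbabilityMeasure
  have hst : 0 ≤ s - t := sub_nonneg.2 hs.1
  let A : ℕ → Set (E d) := fun n => {x | ⌊‖x‖⌋₊ = n}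
  have hA : ∀ n, MeasurableSet (A n) := fun n =>
    (Nat.measurable_floor.comp measurable_norm) (measurableSet_singleton n)
  have hAu : (⋃ n, A n) = univ := eq_univ_of_forall fun x => mem_iUnion.2 ⟨_, rfl⟩
  have hAd : Pairwise (Function.onFun Disjoint A) := fun m n hmn => by
    refine disjoint_left.2 fun x hx hx' => hmn ?_
    exact hx.symm.trans hx'
  have hsplit : ∀ (μ : Measure (E d)) (f : E d → ℝ≥0∞), ∫⁻ x, f x ∂μ = ∑' n, ∫⁻ x in A n, f x ∂μ :=
    fun μ f => by rw [← lintegral_iUnion hA hAd, hAu, Measure.restrict_univ]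
  rw [hsplit (law (ρ s)), hsplit (law (ρ t))]
  refine ENNReal.tsum_le_tsum fun n => ?_
  set c := Real.exp (β * (a * (1 + ((n : ℝ) + 1)) + H) * (s - t)) with hc
  have hmeas : (law (ρ s)).restrict (A n) ≤ ENNReal.ofReal c • (law (ρ t)).restrict (A n) := by
    refine Measure.le_iff.2 fun B hB => ?_
    rw [Measure.smul_apply, Measure.restrict_apply hB, Measure.restrict_apply hB, smul_eq_mul]
    refine measure_le_of_forall_isTest (U := Metric.ball 0 ((n : ℝ) + 1)) Metric.isOpen_ball
      (Real.exp_nonneg _) (fun φ hφ hφ0 hφU => ?_) (hB.inter (hA n)) fun x hx => ?_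
    · refine ha.test_moment_le_exp htT hβ hpde ha0 hlow hH0 hH hφ hφ0 (by positivity)
        (fun x hx => ?_) hs
      have := hφU (subset_tsupport φ hx)
      rw [mem_ball_zero_iff] at this
      exact this.le
    · rw [mem_ball_zero_iff]
      have h1 : ⌊‖x‖⌋₊ = n := hx.2
      rw [← h1]
      exact Nat.lt_floor_add_one _
  refine (lintegral_mono' hmeas le_rfl).trans ?_
  rw [lintegral_smul_measure, smul_eq_mul, ← lintegral_const_mul _ hf]
  refine setLIntegral_mono' (hA n) fun x hx => ?_
  gcongr
  have h1 : ⌊‖x‖⌋₊ = n := hx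
  have h2 : (n : ℝ) ≤ ‖x‖ := by rw [← h1]; exact Nat.floor_le (norm_nonneg x)
  rw [hc, show 2 + ‖x‖ = 1 + (‖x‖ + 1) by ring]
  gcongr

/-- Along the control law started under (A1), `h` stays square integrable. -/
theorem memLp_of_solvesControlPDE (hρ₀ : AssumptionA1 ρ₀) (ha : IsAdmissible t T ρ₀ ρ u)
    (htT : t ≤ T) (hβ : 0 < β) (hh : QuadGrowth C h)
    (hpde : ∀ᵐ s ∂(volume.restrict (Icc t T)), SolvesControlPDE β h (ρ s) (u s))
    {a : ℝ} (ha0 : 0 ≤ a) (hlow : ∀ x, -(a * (1 + ‖x‖)) ≤ h x) {s : ℝ} (hs : s ∈ Icc t T) :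
    MemLp h 2 (law (ρ s)) := by
  obtain ⟨H, hH0, hH⟩ := ha.exists_mean_bound htT hh
  have hhm := hh.contDiff.continuous.measurable
  refine memLp_two_of_lintegral_lt_top hhm.aestronglyMeasurable ?_
  refine (ha.lintegral_le_exp htT hβ hpde ha0 hlow hH0 hH hs _ (by fun_prop)).trans_lt ?_
  set k := β * (s - t)
  -- Both the growth factor and h² are dominated by exponentials of multiples of ‖x‖, and the
  -- initial density has exponential moments of every order. The 4 comes from bounding (1 + ‖x‖)⁴.
  have hint : Integrable (fun x => C ^ 2 * Real.exp (k * (2 * a + H)) *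
      Real.exp ((k * a + (4 : ℕ)) * ‖x‖)) (law (ρ t)) := by
    rw [ha.initial]
    exact (hρ₀.integrable_exp _).const_mul _
  have hlt := hint.lintegral_lt_top
  refine lt_of_le_of_lt (lintegral_mono fun x => ?_) hlt
  have h1 : ‖h x‖ₑ ^ 2 = ENNReal.ofReal (h x ^ 2) := by
    rw [← sq_abs, ENNReal.ofReal_pow (abs_nonneg _), Real.enorm_eq_ofReal_abs]
  rw [h1, ← ENNReal.ofReal_mul (Real.exp_nonneg _)]
  refine ENNReal.ofReal_le_ofReal ?_
  have h2 : h x ^ 2 ≤ C ^ 2 * Real.exp ((4 : ℕ) * ‖x‖) := by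
    have h3 : h x ^ 2 ≤ (C * (1 + ‖x‖) ^ 2) ^ 2 := by
      rw [← sq_abs]
      gcongr
      exact hh.bound x
    refine h3.trans ?_
    rw [mul_pow, ← pow_mul]
    exact mul_le_mul_of_nonneg_left (one_add_norm_pow_le 4 x) (sq_nonneg C)
  calc _ ≤ Real.exp (β * (a * (2 + ‖x‖) + H) * (s - t)) * (C ^ 2 * Real.exp ((4 : ℕ) * ‖x‖)) := by
        gcongr
    _ = C ^ 2 * (Real.exp (β * (a * (2 + ‖x‖) + H) * (s - t)) * Real.exp ((4 : ℕ) * ‖x‖)) := by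
        ring
    _ = C ^ 2 * (Real.exp (k * (2 * a + H)) * Real.exp ((k * a + (4 : ℕ)) * ‖x‖)) := by
        rw [← Real.exp_add, ← Real.exp_add]
        congr 2
        simp only [k]
        ring
    _ = _ := by ring

/-- The control law implies that the cost is the lower bound `β ∫ h ρ₀ dx`. -/
theorem cost_eq_of_solvesControlPDE (hρ₀ : AssumptionA1 ρ₀) (ha : IsAdmissible t T ρ₀ ρ u)
    (htT : t ≤ T) (hβ : 0 < β) (hh : QuadGrowth C h)
    (hpde : ∀ᵐ s ∂(volume.restrict (Icc t T)), SolvesControlPDE β h (ρ s) (u s))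
    {a : ℝ} (ha0 : 0 ≤ a) (hlow : ∀ x, -(a * (1 + ‖x‖)) ≤ h x) :
    cost β h t T ρ u = ((β * ∫ x, h x ∂(law ρ₀) : ℝ) : EReal) := by
  -- Under the control law the residual vanishes and the transport term equals β² times the variance
  -- of h. Its nonnegativity lets the lower integral be computed as a Bochner integral.
  have key : ∀ᵐ s ∂(volume.restrict (Icc t T)),
      0 ≤ -β * (∫ x, fderiv ℝ h x (u s x) ∂(law (ρ s))) ∧ lagrangian β h (ρ s) (u s)
        = ENNReal.ofReal (-β * (∫ x, fderiv ℝ h x (u s x) ∂(law (ρ s)))) := by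
    filter_upwards [hpde, ha.ae_integrable_norm_mul htT, ae_restrict_mem measurableSet_Icc]
      with s hs hu hsm
    have := (ha.density s hsm).isProbabilityMeasure
    have hw : MemLp (fun x => h x - mean (ρ s) h) 2 (law (ρ s)) :=
      (ha.memLp_of_solvesControlPDE hρ₀ htT hβ hh hpde ha0 hlow hsm).sub (memLp_const _)
    have hg2 : MemLp (fun x => β * (h x - mean (ρ s) h)) 2 (law (ρ s)) := hw.const_mul β
    have h1 := lagrangian_eq_square (β := β) hs hu hh hg2 hw
    have h2 := HasWeightedDiv.integral_centred hs hu hh hg2 hw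
    refine ⟨?_, by simpa using h1⟩
    rw [neg_mul, ← mul_neg, ← h2]
    refine mul_nonneg hβ.le (integral_nonneg fun x => ?_)
    have : β * (h x - mean (ρ s) h) * (h x - mean (ρ s) h)
      = β * (h x - mean (ρ s) h) ^ 2 := by ring
    simp only [Pi.zero_apply]
    rw [this]
    positivity
  have hai := (ha.integrable_integral_fderiv htT hh).const_mul (-β)
  have h1 : ∫⁻ s in Icc t T, lagrangian β h (ρ s) (u s) = ENNReal.ofReal
      (∫ s in Icc t T, -β * (∫ x, fderiv ℝ h x (u s x) ∂(law (ρ s)))) := by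
    rw [ofReal_integral_eq_lintegral_ofReal hai (key.mono fun s hs => hs.1)]
    exact lintegral_congr_ae (key.mono fun s hs => hs.2)
  have h0 : 0 ≤ ∫ s in Icc t T, -β * (∫ x, fderiv ℝ h x (u s x) ∂(law (ρ s))) :=
    integral_nonneg_of_ae (key.mono fun s hs => hs.1)
  rw [cost, h1, EReal.coe_ennreal_ofReal, max_eq_left h0, ← EReal.coe_add, integral_const_mul,
    ← ha.integral_sub_eq htT hh, ha.initial]
  congr 1
  ring

end IsAdmissible

end

/-! ### The Poincaré inequality on a ball -/

theorem lintegral_comp_affine {a : E d} {θ : ℝ} (hθ : 1 / 2 ≤ θ) {G : E d → ℝ≥0∞}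
    (hG : Measurable G) : ∫⁻ y, G (a + θ • y) ≤ 2 ^ d * ∫⁻ y, G y := by
  have hθ0 : 0 < θ := by linarith
  have h1 : ∫⁻ y, G (a + θ • y) = ∫⁻ z, G (a + z) ∂(Measure.map (fun y => θ • y) volume) := by
    rw [lintegral_map (by fun_prop) (by fun_prop)]
  rw [h1, Measure.map_addHaar_smul _ hθ0.ne', lintegral_smul_measure,
    lintegral_add_left_eq_self, smul_eq_mul]
  gcongr
  rw [finrank_euclideanSpace, Fintype.card_fin, abs_inv, abs_of_pos (by positivity)]
  have : (θ ^ d)⁻¹ ≤ 2 ^ d := by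
    rw [← inv_pow]
    gcongr
    rw [inv_le_comm₀ hθ0 (by norm_num)]
    linarith
  calc ENNReal.ofReal (θ ^ d)⁻¹ ≤ ENNReal.ofReal (2 ^ d) := ENNReal.ofReal_le_ofReal this
    _ = 2 ^ d := by rw [ENNReal.ofReal_pow (by norm_num)]; simp

/-- By convexity y ↦ (1-θ)z + θy maps B into itself, and its inverse Jacobian θ^(-d) is at most 2^d
once θ ≥ 1/2. -/
theorem lintegral_segment_le {B : Set (E d)} (hB : Convex ℝ B) (hBm : MeasurableSet B)
    {F : E d → ℝ≥0∞} (hF : Measurable F) {z : E d} (hz : z ∈ B) {θ : ℝ} (hθ : 1 / 2 ≤ θ)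
    (hθ1 : θ ≤ 1) :
    ∫⁻ y in B, F ((1 - θ) • z + θ • y) ≤ 2 ^ d * ∫⁻ y in B, F y := by
  rw [← lintegral_indicator hBm, ← lintegral_indicator hBm]
  refine le_trans (lintegral_mono fun y => ?_)
    (lintegral_comp_affine (a := (1 - θ) • z) hθ (hF.indicator hBm))
  by_cases hy : y ∈ B
  · have : (1 - θ) • z + θ • y ∈ B := hB hz hy (by linarith) (by linarith) (by ring)
    simp [hy, this]
  · simp [hy]

/-- One of θ and 1 - θ is at least 1/2; the change of variables is made in the endpoint that carries
this weight, which avoids any singularity in θ. -/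
theorem lintegral_lintegral_segment_le {B : Set (E d)} (hB : Convex ℝ B) (hBm : MeasurableSet B)
    {F : E d → ℝ≥0∞} (hF : Measurable F) {θ : ℝ} (hθ0 : 0 ≤ θ) (hθ1 : θ ≤ 1) :
    ∫⁻ y in B, ∫⁻ z in B, F ((1 - θ) • z + θ • y) ≤ 2 ^ d * (∫⁻ y in B, F y) * volume B := by
  rcases le_total (1 / 2) θ with h | h
  · rw [lintegral_lintegral_swap (by fun_prop)]
    refine (setLIntegral_mono' hBm fun z hz =>
      lintegral_segment_le hB hBm hF hz h hθ1).trans ?_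
    rw [setLIntegral_const]
  · refine (setLIntegral_mono' hBm fun y hy => ?_).trans (setLIntegral_const _ _).le
    have := lintegral_segment_le hB hBm hF hy (θ := 1 - θ) (by linarith) (by linarith)
    simp only [sub_sub_cancel] at this
    simp_rw [add_comm (_ • _) (θ • y)]
    exact this

/-- The fundamental theorem of calculus along the segment, followed by Jensen's inequality on the
unit interval. -/
theorem sq_sub_le_lintegral_segment {φ : E d → ℝ} (hφ : ContDiff ℝ 1 φ) {y z : E d} {D : ℝ}
    (hD : ‖y - z‖ ≤ D) :
    ENNReal.ofReal ((φ y - φ z) ^ 2) ≤ ENNReal.ofReal (D ^ 2) *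
      ∫⁻ θ in Ioc (0 : ℝ) 1, ENNReal.ofReal (‖fderiv ℝ φ ((1 - θ) • z + θ • y)‖ ^ 2) := by
  have hD0 : 0 ≤ D := (norm_nonneg _).trans hD
  have hpath : Continuous fun θ : ℝ => (1 - θ) • z + θ • y := by fun_prop
  have hφ' := hφ.continuous_fderiv (by norm_num)
  have hcont : Continuous fun θ : ℝ => fderiv ℝ φ ((1 - θ) • z + θ • y) (y - z) :=
    (hφ'.comp hpath).clm_apply continuous_const
  have hftc : ∫ θ in (0 : ℝ)..1, fderiv ℝ φ ((1 - θ) • z + θ • y) (y - z) = φ y - φ z := by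
    have hder : ∀ θ ∈ uIcc (0 : ℝ) 1, HasDerivAt (fun θ : ℝ => φ ((1 - θ) • z + θ • y))
        (fderiv ℝ φ ((1 - θ) • z + θ • y) (y - z)) θ := by
      intro θ _
      have h1 : HasDerivAt (fun θ : ℝ => (1 - θ) • z + θ • y) (y - z) θ := by
        have h2 : HasDerivAt (fun θ : ℝ => z + θ • (y - z)) ((1 : ℝ) • (y - z)) θ :=
          ((hasDerivAt_id θ).smul_const (y - z)).const_add z
        rw [one_smul] at h2
        refine h2.congr_of_eventuallyEq (Eventually.of_forall fun θ => ?_)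
        simp only [sub_smul, smul_sub, one_smul]
        abel
      exact ((hφ.differentiable (by norm_num)) _).hasFDerivAt.comp_hasDerivAt θ h1
    rw [intervalIntegral.integral_eq_sub_of_hasDerivAt hder (hcont.intervalIntegrable _ _)]
    simp
  rw [intervalIntegral.integral_of_le (by norm_num)] at hftc
  have hprob : IsProbabilityMeasure (volume.restrict (Ioc (0 : ℝ) 1)) := ⟨by simp⟩
  have hLp : MemLp (fun θ : ℝ => fderiv ℝ φ ((1 - θ) • z + θ • y) (y - z)) 2
      (volume.restrict (Ioc (0 : ℝ) 1)) := by
    rw [memLp_two_iff_integrable_sq hcont.aestronglyMeasurable]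
    exact ((hcont.pow 2).integrableOn_Icc (a := 0) (b := 1)).mono_set Ioc_subset_Icc_self
  have h1 := sq_integral_le hLp
  rw [hftc] at h1
  have hn : Continuous fun θ : ℝ => ‖fderiv ℝ φ ((1 - θ) • z + θ • y)‖ ^ 2 :=
    (hφ'.comp hpath).norm.pow 2
  have hni : IntegrableOn (fun θ : ℝ => ‖fderiv ℝ φ ((1 - θ) • z + θ • y)‖ ^ 2) (Ioc 0 1) :=
    (hn.integrableOn_Icc (a := 0) (b := 1)).mono_set Ioc_subset_Icc_self
  have h2 : ∫ θ in Ioc (0 : ℝ) 1, (fderiv ℝ φ ((1 - θ) • z + θ • y) (y - z)) ^ 2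
      ≤ D ^ 2 * ∫ θ in Ioc (0 : ℝ) 1, ‖fderiv ℝ φ ((1 - θ) • z + θ • y)‖ ^ 2 := by
    rw [← integral_const_mul]
    refine integral_mono hLp.integrable_sq (hni.const_mul _) fun θ => ?_
    have h3 := (fderiv ℝ φ ((1 - θ) • z + θ • y)).le_opNorm (y - z)
    rw [Real.norm_eq_abs] at h3
    simp only
    rw [← sq_abs, ← mul_pow, mul_comm D]
    gcongr
    exact h3.trans (by gcongr)
  calc ENNReal.ofReal ((φ y - φ z) ^ 2)
      ≤ ENNReal.ofReal (D ^ 2 * ∫ θ in Ioc (0 : ℝ) 1, ‖fderiv ℝ φ ((1 - θ) • z + θ • y)‖ ^ 2) :=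
        ENNReal.ofReal_le_ofReal (h1.trans h2)
    _ = _ := by
        rw [ENNReal.ofReal_mul (by positivity), ofReal_integral_eq_lintegral_ofReal hni
          (ae_of_all _ fun θ => by positivity)]

/-- The Poincaré inequality on a ball. -/
theorem poincare_ball {R : ℝ} (hR : 0 < R) {φ : E d → ℝ} (hφ : ContDiff ℝ 1 φ) :
    ∃ c : ℝ, ∫ y in Metric.ball 0 R, (φ y - c) ^ 2
      ≤ (2 * R) ^ 2 * 2 ^ d * ∫ y in Metric.ball 0 R, ‖fderiv ℝ φ y‖ ^ 2 := by
  set B : Set (E d) := Metric.ball 0 R with hBdef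
  have hBm : MeasurableSet B := measurableSet_ball
  have hconv : Convex ℝ B := convex_ball 0 R
  have hv0 : volume B ≠ 0 := (Metric.measure_ball_pos volume 0 hR).ne'
  have hvt : volume B ≠ ⊤ := measure_ball_lt_top.ne
  have hfm : IsFiniteMeasure (volume.restrict B) := ⟨by simpa using measure_ball_lt_top⟩
  have hvr : 0 < (volume B).toReal := ENNReal.toReal_pos hv0 hvt
  have hcontB : ∀ f : E d → ℝ, Continuous f → IntegrableOn f B := fun f hf =>
    (hf.continuousOn.integrableOn_compact (isCompact_closedBall 0 R)).mono_set
      Metric.ball_subset_closedBall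
  have hφ' := hφ.continuous_fderiv (by norm_num)
  set F : E d → ℝ≥0∞ := fun x => ENNReal.ofReal (‖fderiv ℝ φ x‖ ^ 2) with hF
  have hFm : Measurable F := by
    have := hφ'.norm.measurable
    fun_prop
  set c : ℝ := (volume B).toReal⁻¹ * ∫ z in B, φ z with hc
  refine ⟨c, ?_⟩
  -- As c is the average of φ over B, the deviation at y is the mean of φ y - φ z over z, so Jensen
  -- reduces the claim to differences between pairs of points.
  have hjensen : ∀ y, volume B * ENNReal.ofReal ((φ y - c) ^ 2)
      ≤ ∫⁻ z in B, ENNReal.ofReal ((φ y - φ z) ^ 2) := by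
    intro y
    have hcy : Continuous fun z => φ y - φ z := continuous_const.sub hφ.continuous
    have hcy2 : Continuous fun z => (φ y - φ z) ^ 2 := hcy.pow 2
    have h1 : ∫ z in B, (φ y - φ z) = (volume B).toReal * (φ y - c) := by
      rw [integral_sub (integrable_const _) (hcontB φ hφ.continuous), hc]
      simp only [integral_const, smul_eq_mul, Measure.real, Measure.restrict_apply_univ]
      field_simp
    have h2 : 0 ≤ ∫ z in B, ((φ y - φ z) - (φ y - c)) ^ 2 := integral_nonneg fun _ => sq_nonneg _
    have h3 : ∫ z in B, ((φ y - φ z) - (φ y - c)) ^ 2 = (∫ z in B, (φ y - φ z) ^ 2)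
        - (volume B).toReal * (φ y - c) ^ 2 := by
      have e : ∀ z, ((φ y - φ z) - (φ y - c)) ^ 2
        = (φ y - φ z) ^ 2 - 2 * (φ y - c) * (φ y - φ z) + (φ y - c) ^ 2 := fun z => by ring
      simp_rw [e]
      rw [integral_add, integral_sub, integral_const_mul, h1]
      · simp only [integral_const, smul_eq_mul, Measure.real, Measure.restrict_apply_univ]
        ring
      · exact hcontB _ hcy2
      · exact hcontB _ (continuous_const.mul hcy)
      · exact hcontB _ (hcy2.sub (continuous_const.mul hcy))
      · exact hcontB _ continuous_const
    rw [← ofReal_integral_eq_lintegral_ofReal (hcontB _ hcy2)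
      (ae_of_all _ fun _ => sq_nonneg _), ← ENNReal.ofReal_toReal hvt,
      ← ENNReal.ofReal_mul hvr.le]
    exact ENNReal.ofReal_le_ofReal (by linarith)
  have hdouble : ∫⁻ y in B, ∫⁻ z in B, ENNReal.ofReal ((φ y - φ z) ^ 2)
      ≤ ENNReal.ofReal ((2 * R) ^ 2) * (2 ^ d * (∫⁻ y in B, F y) * volume B) := by
    have hFc : Measurable fun p : (E d × E d) × ℝ => F ((1 - p.2) • p.1.2 + p.2 • p.1.1) := by
      fun_prop
    calc ∫⁻ y in B, ∫⁻ z in B, ENNReal.ofReal ((φ y - φ z) ^ 2)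
        ≤ ∫⁻ y in B, ∫⁻ z in B, ENNReal.ofReal ((2 * R) ^ 2) *
            ∫⁻ θ in Ioc (0 : ℝ) 1, F ((1 - θ) • z + θ • y) := by
          refine setLIntegral_mono' hBm fun y hy => setLIntegral_mono' hBm fun z hz => ?_
          refine sq_sub_le_lintegral_segment hφ ?_
          rw [hBdef, mem_ball_zero_iff] at hy hz
          exact (norm_sub_le _ _).trans (by linarith)
      _ = ENNReal.ofReal ((2 * R) ^ 2) * ∫⁻ p : E d × E d, (∫⁻ θ in Ioc (0 : ℝ) 1,
            F ((1 - θ) • p.2 + θ • p.1)) ∂((volume.restrict B).prod (volume.restrict B)) := by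
          rw [lintegral_prod _ (by
            exact (hFc.lintegral_prod_right').aemeasurable), ← lintegral_const_mul _ (by
            exact (hFc.lintegral_prod_right').lintegral_prod_right')]
          refine lintegral_congr fun y => ?_
          rw [lintegral_const_mul]
          have : Measurable fun p : E d × ℝ => F ((1 - p.2) • p.1 + p.2 • y) := by fun_prop
          exact this.lintegral_prod_right'
      _ = ENNReal.ofReal ((2 * R) ^ 2) * ∫⁻ θ in Ioc (0 : ℝ) 1, ∫⁻ y in B, ∫⁻ z in B,
            F ((1 - θ) • z + θ • y) := by
          rw [lintegral_lintegral_swap (by exact hFc.aemeasurable)]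
          congr 1
          refine lintegral_congr fun θ => ?_
          have : Measurable fun p : E d × E d => F ((1 - θ) • p.2 + θ • p.1) := by fun_prop
          rw [lintegral_prod _ this.aemeasurable]
      _ ≤ ENNReal.ofReal ((2 * R) ^ 2) * ∫⁻ θ in Ioc (0 : ℝ) 1,
            2 ^ d * (∫⁻ y in B, F y) * volume B := by
          refine mul_le_mul_right ?_ _
          exact setLIntegral_mono' measurableSet_Ioc fun θ hθ =>
            lintegral_lintegral_segment_le hconv hBm hFm hθ.1.le hθ.2
      _ = _ := by simp
  have hcm : Continuous fun y => (φ y - c) ^ 2 := (hφ.continuous.sub continuous_const).pow 2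
  have hfin : ∫⁻ y in B, ENNReal.ofReal ((φ y - c) ^ 2)
      ≤ ENNReal.ofReal ((2 * R) ^ 2) * (2 ^ d * ∫⁻ y in B, F y) := by
    have h1 : volume B * ∫⁻ y in B, ENNReal.ofReal ((φ y - c) ^ 2)
        ≤ volume B * (ENNReal.ofReal ((2 * R) ^ 2) * (2 ^ d * ∫⁻ y in B, F y)) := by
      rw [← lintegral_const_mul _ (f := fun y => ENNReal.ofReal ((φ y - c) ^ 2))
        (ENNReal.measurable_ofReal.comp hcm.measurable)]
      refine ((lintegral_mono hjensen).trans hdouble).trans (le_of_eq (by ring))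
    exact (ENNReal.mul_le_mul_iff_right hv0 hvt).1 h1
  have hFi : IntegrableOn (fun y => ‖fderiv ℝ φ y‖ ^ 2) B := hcontB _ (hφ'.norm.pow 2)
  rw [hF, ← ofReal_integral_eq_lintegral_ofReal (hcontB _ hcm) (ae_of_all _ fun _ => sq_nonneg _),
    ← ofReal_integral_eq_lintegral_ofReal hFi (ae_of_all _ fun _ => sq_nonneg _)] at hfin
  have h2 : (2 : ℝ≥0∞) ^ d = ENNReal.ofReal (2 ^ d) := by
    rw [ENNReal.ofReal_pow (by norm_num)]; simp
  have hI : 0 ≤ ∫ y in B, ‖fderiv ℝ φ y‖ ^ 2 := integral_nonneg fun _ => by positivity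
  rw [h2, ← ENNReal.ofReal_mul (by positivity), ← ENNReal.ofReal_mul (by positivity),
    ENNReal.ofReal_le_ofReal_iff (by positivity)] at hfin
  linarith

/-! ### A weighted Poincaré inequality from a Lyapunov condition -/

/-- The factor `1 / √(1 + |x|²)`. -/
noncomputable def radialWeight (x : E d) : ℝ := (√(1 + ‖x‖ ^ 2))⁻¹

theorem radialWeight_pos (x : E d) : 0 < radialWeight x := by
  unfold radialWeight; positivity

theorem radialWeight_le_one (x : E d) : radialWeight x ≤ 1 := by
  unfold radialWeight
  refine inv_le_one_of_one_le₀ (Real.one_le_sqrt.2 ?_)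
  nlinarith [norm_nonneg x]

theorem norm_le_sqrt (x : E d) : ‖x‖ ≤ √(1 + ‖x‖ ^ 2) := by
  refine Real.le_sqrt_of_sq_le ?_
  linarith

theorem radialWeight_mul_norm_le (x : E d) : radialWeight x * ‖x‖ ≤ 1 := by
  unfold radialWeight
  rw [inv_mul_le_iff₀ (by positivity), mul_one]
  exact norm_le_sqrt x

/-- Outside the unit ball, replacing 1/‖x‖ by the smooth weight loses at most a factor 2. -/
theorem half_le_radialWeight_mul_norm {x : E d} (hx : 1 ≤ ‖x‖) :
    1 / 2 ≤ radialWeight x * ‖x‖ := by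
  unfold radialWeight
  rw [inv_mul_eq_div, le_div_iff₀ (by positivity)]
  have : √(1 + ‖x‖ ^ 2) ≤ 2 * ‖x‖ := by
    rw [Real.sqrt_le_left (by positivity)]
    nlinarith
  linarith

theorem hasFDerivAt_radialWeight (x : E d) :
    HasFDerivAt radialWeight (-(radialWeight x ^ 3) • innerSL ℝ x) x := by
  have h1 : HasFDerivAt (fun x : E d => 1 + ‖x‖ ^ 2) (2 • innerSL ℝ x) x :=
    (hasStrictFDerivAt_norm_sq x).hasFDerivAt.const_add 1
  have hpos : 0 < 1 + ‖x‖ ^ 2 := by positivity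
  have h2 := (hasDerivAt_inv (x := √(1 + ‖x‖ ^ 2)) (by positivity)).comp_hasFDerivAt x
    (h1.sqrt hpos.ne')
  refine HasFDerivAt.congr_fderiv h2 ?_
  ext v
  simp only [radialWeight, smul_apply, innerSL_apply_apply, smul_eq_mul, nsmul_eq_mul,
    Nat.cast_ofNat]
  have : √(1 + ‖x‖ ^ 2) ≠ 0 := by positivity
  field_simp

/-- The coordinates of `x / √(1 + |x|²)`. -/
noncomputable def radialCoord (i : Fin d) (x : E d) : ℝ := radialWeight x * x i

theorem hasFDerivAt_radialCoord (i : Fin d) (x : E d) :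
    HasFDerivAt (radialCoord i) (radialWeight x • EuclideanSpace.proj (𝕜 := ℝ) i
      + x i • (-(radialWeight x ^ 3) • innerSL ℝ x)) x :=
  (hasFDerivAt_radialWeight x).fun_mul (EuclideanSpace.proj (𝕜 := ℝ) i).hasFDerivAt

theorem fderiv_radialCoord_single (i : Fin d) (x : E d) :
    fderiv ℝ (radialCoord i) x (EuclideanSpace.single i 1)
      = radialWeight x * (1 - (radialWeight x * x i) ^ 2) := by
  rw [(hasFDerivAt_radialCoord i x).fderiv]
  simp [innerSL_apply_apply, EuclideanSpace.inner_single_right]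
  ring

theorem abs_radialCoord_le (i : Fin d) (x : E d) : |radialCoord i x| ≤ 1 := by
  rw [radialCoord, abs_mul, abs_of_pos (radialWeight_pos x)]
  exact (mul_le_mul_of_nonneg_left (PiLp.norm_apply_le x i) (radialWeight_pos x).le).trans
    (radialWeight_mul_norm_le x)

/-- Summed over i, this places the divergence of the radial field between 0 and d. -/
theorem fderiv_radialCoord_single_mem (i : Fin d) (x : E d) :
    fderiv ℝ (radialCoord i) x (EuclideanSpace.single i 1) ∈ Icc (0 : ℝ) 1 := by
  rw [fderiv_radialCoord_single]
  have h1 : (radialWeight x * x i) ^ 2 ≤ 1 := by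
    rw [sq_le_one_iff_abs_le_one]
    exact abs_radialCoord_le i x
  have h2 := radialWeight_pos x
  have h3 := radialWeight_le_one x
  constructor
  · have : 0 ≤ 1 - (radialWeight x * x i) ^ 2 := by linarith
    positivity
  · nlinarith [sq_nonneg (radialWeight x * x i)]

theorem continuous_radialWeight : Continuous (radialWeight (d := d)) := by
  unfold radialWeight
  refine Continuous.inv₀ (by fun_prop) fun x => ?_
  positivity

theorem map_eq_sum_single (L : E d →L[ℝ] ℝ) (x : E d) :
    L x = ∑ i, x i * L (EuclideanSpace.single i 1) := by
  conv_lhs => rw [← (EuclideanSpace.basisFun (Fin d) ℝ).sum_repr x]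
  simp [map_sum]

/-- Integration by parts against the radial field `x / √(1 + |x|²)`. -/
theorem integral_sq_mul_radial_le {C : ℝ} {V : E d → ℝ} (hV : QuadGrowth C V)
    (hint : Integrable (fun x => (1 + ‖x‖) * Real.exp (-V x))) {ψ : E d → ℝ}
    (hψ : ContDiff ℝ 1 ψ) {B : ℝ} (hB : ∀ x, |ψ x| ≤ B) (hB' : ∀ x, ‖fderiv ℝ ψ x‖ ≤ B) :
    ∫ x, ψ x ^ 2 * (radialWeight x * fderiv ℝ V x x) * Real.exp (-V x)
      ≤ (d + 1) * (∫ x, ψ x ^ 2 * Real.exp (-V x))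
        + ∫ x, ‖fderiv ℝ ψ x‖ ^ 2 * Real.exp (-V x) := by
  have hC := hV.nonneg
  have hB0 : 0 ≤ B := (abs_nonneg _).trans (hB 0)
  have cV := hV.contDiff.continuous
  have cψ := hψ.continuous
  have cV' := hV.contDiff.continuous_fderiv (by norm_num)
  have cψ' := hψ.continuous_fderiv (by norm_num)
  have cw := continuous_radialWeight (d := d)
  -- integrability of continuous functions dominated by the weight
  have hdom : ∀ f : E d → ℝ, AEStronglyMeasurable f volume → ∀ M : ℝ,
      (∀ x, |f x| ≤ M * ((1 + ‖x‖) * Real.exp (-V x))) → Integrable f := fun f hf M hM =>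
    (hint.const_mul M).mono' hf (ae_of_all _ hM)
  have hexp : ∀ x, Real.exp (-V x) ≤ (1 + ‖x‖) * Real.exp (-V x) := fun x =>
    le_mul_of_one_le_left (Real.exp_nonneg _) (by linarith [norm_nonneg x])
  let g : E d → ℝ := fun x => ψ x ^ 2 * Real.exp (-V x)
  have hg : ∀ x v, HasFDerivAt g (fderiv ℝ g x) x ∧ fderiv ℝ g x v
      = (2 * ψ x * fderiv ℝ ψ x v - ψ x ^ 2 * fderiv ℝ V x v) * Real.exp (-V x) := by
    intro x v
    have h1 := (hψ.differentiable (by norm_num) x).hasFDerivAt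
    have h2 := (hV.contDiff.differentiable (by norm_num) x).hasFDerivAt
    have h3 : HasFDerivAt g _ x := ((hasDerivAt_pow 2 (ψ x)).comp_hasFDerivAt x h1).fun_mul
      h2.neg.exp
    refine ⟨h3.differentiableAt.hasFDerivAt, ?_⟩
    rw [h3.fderiv]
    simp
    ring
  have cg : Continuous g := by fun_prop
  have cg' : ∀ v, Continuous fun x => fderiv ℝ g x v := fun v => by
    have : (fun x => fderiv ℝ g x v) = fun x =>
      (2 * ψ x * fderiv ℝ ψ x v - ψ x ^ 2 * fderiv ℝ V x v) * Real.exp (-V x) :=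
      funext fun x => (hg x v).2
    rw [this]
    fun_prop
  have hgb : ∀ x, |g x| ≤ B ^ 2 * ((1 + ‖x‖) * Real.exp (-V x)) := fun x => by
    simp only [g]
    rw [abs_mul, abs_of_pos (Real.exp_pos _), abs_pow]
    have := hexp x
    gcongr
    exact hB x
  have hgb' : ∀ x v, |fderiv ℝ g x v|
      ≤ (2 * B ^ 2 + B ^ 2 * C) * ‖v‖ * ((1 + ‖x‖) * Real.exp (-V x)) := fun x v => by
    rw [(hg x v).2, abs_mul, abs_of_pos (Real.exp_pos _), ← mul_assoc]
    refine mul_le_mul_of_nonneg_right ?_ (Real.exp_nonneg _)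
    refine (abs_sub _ _).trans ?_
    rw [abs_mul, abs_mul, abs_mul, abs_pow, abs_two]
    have h1 : |fderiv ℝ ψ x v| ≤ B * ‖v‖ :=
      ((fderiv ℝ ψ x).le_opNorm v).trans (by gcongr; exact hB' x)
    have h2 : |fderiv ℝ V x v| ≤ C * (1 + ‖x‖) * ‖v‖ :=
      ((fderiv ℝ V x).le_opNorm v).trans (by gcongr; exact hV.bound_fderiv x)
    have h3 : 2 * |ψ x| * |fderiv ℝ ψ x v| ≤ 2 * B * (B * ‖v‖) := by
      gcongr; exact hB x
    have h4 : |ψ x| ^ 2 * |fderiv ℝ V x v| ≤ B ^ 2 * (C * (1 + ‖x‖) * ‖v‖) := by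
      gcongr; exact hB x
    have h5 : 2 * B * (B * ‖v‖) ≤ 2 * B * (B * ‖v‖) * (1 + ‖x‖) :=
      le_mul_of_one_le_right (by positivity) (by linarith [norm_nonneg x])
    calc _ ≤ 2 * B * (B * ‖v‖) * (1 + ‖x‖) + B ^ 2 * (C * (1 + ‖x‖) * ‖v‖) := by linarith
      _ = _ := by ring
  have ce : ∀ i, Continuous (radialCoord (d := d) i) := fun i => by
    have : Continuous fun x : E d => x i := (EuclideanSpace.proj (𝕜 := ℝ) i).continuous
    exact cw.mul this
  have ce' : ∀ i, Continuous fun x : E d =>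
      fderiv ℝ (radialCoord i) x (EuclideanSpace.single i 1) := fun i => by
    simp_rw [fderiv_radialCoord_single]
    have : Continuous fun x : E d => x i := (EuclideanSpace.proj (𝕜 := ℝ) i).continuous
    fun_prop
  have i1 : ∀ i, Integrable fun x : E d =>
      fderiv ℝ (radialCoord i) x (EuclideanSpace.single i 1) * g x := fun i => by
    refine hdom _ ((ce' i).mul cg).aestronglyMeasurable (B ^ 2) fun x => ?_
    rw [abs_mul]
    have h1 := fderiv_radialCoord_single_mem i x
    rw [abs_of_nonneg h1.1]
    exact (mul_le_of_le_one_left (abs_nonneg _) h1.2).trans (hgb x)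
  have i2 : ∀ i, Integrable fun x : E d =>
      radialCoord i x * fderiv ℝ g x (EuclideanSpace.single i 1) := fun i => by
    refine hdom _ ((ce i).mul (cg' _)).aestronglyMeasurable
      ((2 * B ^ 2 + B ^ 2 * C) * ‖(EuclideanSpace.single i 1 : E d)‖) fun x => ?_
    rw [abs_mul]
    exact (mul_le_of_le_one_left (abs_nonneg _) (abs_radialCoord_le i x)).trans (hgb' x _)
  have i3 : ∀ i, Integrable fun x : E d => radialCoord i x * g x := fun i => by
    refine hdom _ ((ce i).mul cg).aestronglyMeasurable (B ^ 2) fun x => ?_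
    rw [abs_mul]
    exact (mul_le_of_le_one_left (abs_nonneg _) (abs_radialCoord_le i x)).trans (hgb x)
  have hparts : ∀ i, ∫ x, radialCoord i x * fderiv ℝ g x (EuclideanSpace.single i 1)
      = -∫ x, fderiv ℝ (radialCoord i) x (EuclideanSpace.single i 1) * g x := fun i =>
    integral_mul_fderiv_eq_neg_fderiv_mul_of_integrable (i1 i) (i2 i) (i3 i)
      (fun x _ => (hasFDerivAt_radialCoord i x).differentiableAt)
      (fun x _ => (hg x 0).1.differentiableAt)
  have hsum : ∫ x, radialWeight x * fderiv ℝ g x x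
      = -∑ i, ∫ x, fderiv ℝ (radialCoord i) x (EuclideanSpace.single i 1) * g x := by
    rw [← Finset.sum_neg_distrib]
    simp_rw [← hparts]
    rw [← integral_finsetSum _ fun i _ => i2 i]
    refine integral_congr_ae (ae_of_all _ fun x => ?_)
    simp only
    rw [map_eq_sum_single (fderiv ℝ g x) x, Finset.mul_sum]
    refine Finset.sum_congr rfl fun i _ => ?_
    rw [radialCoord]
    ring
  have hgi : Integrable g := hdom g cg.aestronglyMeasurable _ hgb
  have hbound : ∑ i, ∫ x, fderiv ℝ (radialCoord i) x (EuclideanSpace.single i 1) * g x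
      ≤ d * ∫ x, g x := by
    have : ∀ i ∈ (Finset.univ : Finset (Fin d)),
        ∫ x, fderiv ℝ (radialCoord i) x (EuclideanSpace.single i 1) * g x ≤ ∫ x, g x :=
      fun i _ => integral_mono (i1 i) hgi fun x =>
        mul_le_of_le_one_left (by positivity) (fderiv_radialCoord_single_mem i x).2
    refine (Finset.sum_le_sum this).trans ?_
    simp
  have i5 : Integrable fun x => ‖fderiv ℝ ψ x‖ ^ 2 * Real.exp (-V x) := by
    refine hdom _ (by fun_prop : Continuous _).aestronglyMeasurable (B ^ 2) fun x => ?_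
    rw [abs_mul, abs_of_pos (Real.exp_pos _), abs_of_nonneg (by positivity)]
    have := hexp x
    gcongr
    exact hB' x
  have cDV : Continuous fun x => fderiv ℝ V x x := cV'.clm_apply continuous_id
  have cDψ : Continuous fun x => fderiv ℝ ψ x x := cψ'.clm_apply continuous_id
  have hwDψ : ∀ x, |radialWeight x * fderiv ℝ ψ x x| ≤ ‖fderiv ℝ ψ x‖ := fun x => by
    rw [abs_mul, abs_of_pos (radialWeight_pos x)]
    have h1 := (fderiv ℝ ψ x).le_opNorm x
    rw [Real.norm_eq_abs] at h1
    calc radialWeight x * |fderiv ℝ ψ x x| ≤ radialWeight x * (‖fderiv ℝ ψ x‖ * ‖x‖) := by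
          have := (radialWeight_pos x).le
          gcongr
      _ = (radialWeight x * ‖x‖) * ‖fderiv ℝ ψ x‖ := by ring
      _ ≤ _ := mul_le_of_le_one_left (norm_nonneg _) (radialWeight_mul_norm_le x)
  have i6 : Integrable fun x => 2 * ψ x * (radialWeight x * fderiv ℝ ψ x x) * Real.exp (-V x) := by
    refine hdom _ (by fun_prop : Continuous _).aestronglyMeasurable (2 * B * B) fun x => ?_
    rw [abs_mul, abs_of_pos (Real.exp_pos _), abs_mul, abs_mul, abs_two]
    have := hexp x
    have := (hwDψ x).trans (hB' x)
    gcongr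
    exact hB x
  have i7 : Integrable fun x => ψ x ^ 2 * (radialWeight x * fderiv ℝ V x x) * Real.exp (-V x) := by
    refine hdom _ (by fun_prop : Continuous _).aestronglyMeasurable (B ^ 2 * C) fun x => ?_
    rw [abs_mul, abs_of_pos (Real.exp_pos _), abs_mul, abs_pow, abs_mul,
      abs_of_pos (radialWeight_pos x)]
    have h1 := (fderiv ℝ V x).le_opNorm x
    rw [Real.norm_eq_abs] at h1
    have h2 : radialWeight x * |fderiv ℝ V x x| ≤ C * (1 + ‖x‖) := by
      calc radialWeight x * |fderiv ℝ V x x| ≤ radialWeight x * (‖fderiv ℝ V x‖ * ‖x‖) := by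
            have := (radialWeight_pos x).le
            gcongr
        _ = (radialWeight x * ‖x‖) * ‖fderiv ℝ V x‖ := by ring
        _ ≤ ‖fderiv ℝ V x‖ :=
            mul_le_of_le_one_left (norm_nonneg _) (radialWeight_mul_norm_le x)
        _ ≤ _ := hV.bound_fderiv x
    calc _ ≤ B ^ 2 * (C * (1 + ‖x‖)) * Real.exp (-V x) := by
          have h3 := mul_nonneg (radialWeight_pos x).le (abs_nonneg (fderiv ℝ V x x))
          gcongr
          exact hB x
      _ = _ := by ring
  have hid : ∫ x, radialWeight x * fderiv ℝ g x x
      = (∫ x, 2 * ψ x * (radialWeight x * fderiv ℝ ψ x x) * Real.exp (-V x))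
        - ∫ x, ψ x ^ 2 * (radialWeight x * fderiv ℝ V x x) * Real.exp (-V x) := by
    rw [← integral_sub i6 i7]
    refine integral_congr_ae (ae_of_all _ fun x => ?_)
    simp only
    rw [(hg x x).2]
    ring
  -- Young's inequality on the cross term adds one more copy of ∫ ψ² exp(-V), so d from the
  -- divergence becomes d + 1.
  have hyoung : ∫ x, 2 * ψ x * (radialWeight x * fderiv ℝ ψ x x) * Real.exp (-V x)
      ≤ (∫ x, g x) + ∫ x, ‖fderiv ℝ ψ x‖ ^ 2 * Real.exp (-V x) := by
    rw [← integral_add hgi i5]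
    refine integral_mono i6 (hgi.add i5) fun x => ?_
    simp only [g]
    rw [← add_mul]
    refine mul_le_mul_of_nonneg_right ?_ (Real.exp_nonneg _)
    have h1 := hwDψ x
    have h2 : (radialWeight x * fderiv ℝ ψ x x) ^ 2 ≤ ‖fderiv ℝ ψ x‖ ^ 2 := by
      rw [← sq_abs]; gcongr
    nlinarith [sq_nonneg (ψ x - radialWeight x * fderiv ℝ ψ x x)]
  have : ∫ x, ψ x ^ 2 * Real.exp (-V x) = ∫ x, g x := rfl
  rw [this]
  rw [hid] at hsum
  linarith

/-- A Poincaré inequality for the weight `exp (-V)`, with a constant that depends only on the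
radial growth of `V` outside a ball and on its size in that ball. -/
theorem weighted_poincare {C : ℝ} {V : E d → ℝ} (hV : QuadGrowth C V)
    (hint : Integrable (fun x => (1 + ‖x‖) * Real.exp (-V x))) {R : ℝ} (hR : 0 < R)
    (hfar : ∀ x, R ≤ ‖x‖ → (d + 2 : ℝ) ≤ radialWeight x * fderiv ℝ V x x)
    {φ : E d → ℝ} (hφ : IsTest φ) :
    ∃ c : ℝ, ∫ x, (φ x - c) ^ 2 * Real.exp (-V x)
      ≤ (1 + (d + 2 + C * (1 + R)) * (Real.exp (C * (1 + R) ^ 2) * ((2 * R) ^ 2 * 2 ^ d)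
        * Real.exp (C * (1 + R) ^ 2))) * ∫ x, ‖fderiv ℝ φ x‖ ^ 2 * Real.exp (-V x) := by
  -- The constant is the one of the flat inequality on the ball; the Lyapunov estimate holds for
  -- every constant.
  obtain ⟨c, hc⟩ := poincare_ball hR hφ.1
  refine ⟨c, ?_⟩
  obtain ⟨B, hB0, hB⟩ := hφ.exists_bound
  have hC := hV.nonneg
  have hψ : ContDiff ℝ 1 fun x => φ x - c := hφ.1.sub contDiff_const
  have hfd : ∀ x, fderiv ℝ (fun x => φ x - c) x = fderiv ℝ φ x := fun x => fderiv_sub_const c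
  have hψb : ∀ x, |φ x - c| ≤ B + |c| := fun x =>
    (abs_sub _ _).trans (add_le_add (hB x).1 le_rfl)
  have hlyap := integral_sq_mul_radial_le hV hint hψ hψb (fun x => by
    rw [hfd]; exact (hB x).2.trans (by linarith [abs_nonneg c]))
  simp_rw [hfd] at hlyap
  have cV := hV.contDiff.continuous
  have cφ := hφ.continuous
  have cφ' := hφ.continuous_fderiv
  have cV' : Continuous fun x => fderiv ℝ V x x :=
    (hV.contDiff.continuous_fderiv (by norm_num)).clm_apply continuous_id
  have cw := continuous_radialWeight (d := d)
  have hexp : ∀ x, Real.exp (-V x) ≤ (1 + ‖x‖) * Real.exp (-V x) := fun x =>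
    le_mul_of_one_le_left (Real.exp_nonneg _) (by linarith [norm_nonneg x])
  have hwV : ∀ x, |radialWeight x * fderiv ℝ V x x| ≤ C * (1 + ‖x‖) := fun x => by
    rw [abs_mul, abs_of_pos (radialWeight_pos x)]
    have h1 := (fderiv ℝ V x).le_opNorm x
    rw [Real.norm_eq_abs] at h1
    calc radialWeight x * |fderiv ℝ V x x| ≤ radialWeight x * (‖fderiv ℝ V x‖ * ‖x‖) := by
          have := (radialWeight_pos x).le
          gcongr
      _ = (radialWeight x * ‖x‖) * ‖fderiv ℝ V x‖ := by ring
      _ ≤ ‖fderiv ℝ V x‖ := mul_le_of_le_one_left (norm_nonneg _) (radialWeight_mul_norm_le x)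
      _ ≤ _ := hV.bound_fderiv x
  have ig : Integrable fun x => (φ x - c) ^ 2 * Real.exp (-V x) := by
    refine (hint.const_mul ((B + |c|) ^ 2)).mono'
      (by fun_prop : Continuous _).aestronglyMeasurable (ae_of_all _ fun x => ?_)
    rw [norm_mul, norm_pow, Real.norm_of_nonneg (Real.exp_nonneg _)]
    have := hexp x
    gcongr
    exact hψb x
  have iL : Integrable fun x =>
      (φ x - c) ^ 2 * (radialWeight x * fderiv ℝ V x x) * Real.exp (-V x) := by
    refine (hint.const_mul ((B + |c|) ^ 2 * C)).mono'
      (by fun_prop : Continuous _).aestronglyMeasurable (ae_of_all _ fun x => ?_)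
    rw [norm_mul, norm_mul, norm_pow, Real.norm_of_nonneg (Real.exp_nonneg _), ← mul_assoc,
      mul_assoc (_ ^ 2) C]
    gcongr
    · exact hψb x
    · exact hwV x
  have iD : Integrable fun x => ‖fderiv ℝ φ x‖ ^ 2 * Real.exp (-V x) := by
    refine (hint.const_mul (B ^ 2)).mono'
      (by fun_prop : Continuous _).aestronglyMeasurable (ae_of_all _ fun x => ?_)
    rw [norm_mul, norm_pow, Real.norm_of_nonneg (Real.exp_nonneg _), norm_norm]
    have := hexp x
    gcongr
    exact (hB x).2
  set S : Set (E d) := Metric.ball 0 R with hS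
  have hSm : MeasurableSet S := measurableSet_ball
  have hcontS : ∀ f : E d → ℝ, Continuous f → IntegrableOn f S := fun f hf =>
    (hf.continuousOn.integrableOn_compact (isCompact_closedBall 0 R)).mono_set
      Metric.ball_subset_closedBall
  have hVS : ∀ x ∈ S, |V x| ≤ C * (1 + R) ^ 2 := fun x hx => by
    rw [hS, mem_ball_zero_iff] at hx
    refine (hV.bound x).trans ?_
    gcongr
  -- the far region is controlled by the Lyapunov term
  have hsplit : (d + 2 : ℝ) * (∫ x, (φ x - c) ^ 2 * Real.exp (-V x))
      ≤ (∫ x, (φ x - c) ^ 2 * (radialWeight x * fderiv ℝ V x x) * Real.exp (-V x))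
        + (d + 2 + C * (1 + R)) * ∫ x in S, (φ x - c) ^ 2 * Real.exp (-V x) := by
    rw [← integral_const_mul, ← integral_const_mul, ← integral_indicator hSm,
      ← integral_add iL ((ig.const_mul _).indicator hSm)]
    refine integral_mono (ig.const_mul _) (iL.add ((ig.const_mul _).indicator hSm)) fun x => ?_
    simp only
    have hnn : 0 ≤ (φ x - c) ^ 2 * Real.exp (-V x) := by positivity
    by_cases hx : x ∈ S
    · rw [indicator_of_mem hx]
      rw [hS, mem_ball_zero_iff] at hx
      have h1 := neg_le_of_abs_le (hwV x)
      have h2 : C * (1 + ‖x‖) ≤ C * (1 + R) := by gcongr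
      have h3 : 0 ≤ ((φ x - c) ^ 2 * Real.exp (-V x))
          * (radialWeight x * fderiv ℝ V x x + C * (1 + R)) :=
        mul_nonneg hnn (by linarith)
      linarith
    · rw [indicator_of_notMem hx]
      rw [hS, mem_ball_zero_iff, not_lt] at hx
      have h3 := mul_le_mul_of_nonneg_left (hfar x hx) hnn
      linarith
  -- On the ball the weight and its inverse are at most exp(C(1+R)²), so passing to the flat
  -- inequality and back costs this factor twice.
  have hnear : ∫ x in S, (φ x - c) ^ 2 * Real.exp (-V x)
      ≤ Real.exp (C * (1 + R) ^ 2) * ∫ x in S, (φ x - c) ^ 2 := by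
    rw [← integral_const_mul]
    refine setIntegral_mono_on (hcontS _ (by fun_prop)) (hcontS _ (by fun_prop)) hSm
      fun x hx => ?_
    rw [mul_comm]
    have := neg_le_of_abs_le (hVS x hx)
    gcongr
    linarith
  have hnear' : ∫ x in S, ‖fderiv ℝ φ x‖ ^ 2
      ≤ Real.exp (C * (1 + R) ^ 2) * ∫ x, ‖fderiv ℝ φ x‖ ^ 2 * Real.exp (-V x) := by
    refine le_trans ?_ (mul_le_mul_of_nonneg_left
      (setIntegral_le_integral (s := S) iD (ae_of_all _ fun x => by positivity))
      (Real.exp_nonneg _))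
    rw [← integral_const_mul]
    refine setIntegral_mono_on (hcontS _ (by fun_prop)) (hcontS _ (by fun_prop)) hSm
      fun x hx => ?_
    rw [mul_left_comm, ← Real.exp_add]
    refine le_mul_of_one_le_right (by positivity) (Real.one_le_exp ?_)
    have := le_of_abs_le (hVS x hx)
    linarith
  have hchain : ∫ x in S, (φ x - c) ^ 2 * Real.exp (-V x)
      ≤ Real.exp (C * (1 + R) ^ 2) * ((2 * R) ^ 2 * 2 ^ d) * Real.exp (C * (1 + R) ^ 2)
        * ∫ x, ‖fderiv ℝ φ x‖ ^ 2 * Real.exp (-V x) := by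
    calc _ ≤ Real.exp (C * (1 + R) ^ 2) * ((2 * R) ^ 2 * 2 ^ d
          * (Real.exp (C * (1 + R) ^ 2) * ∫ x, ‖fderiv ℝ φ x‖ ^ 2 * Real.exp (-V x))) := by
          refine hnear.trans (mul_le_mul_of_nonneg_left (hc.trans ?_) (Real.exp_nonneg _))
          gcongr
      _ = _ := by ring
  have hK : 0 ≤ (d + 2 + C * (1 + R) : ℝ) := by positivity
  have := mul_le_mul_of_nonneg_left hchain hK
  -- The far region contributes d + 2 copies of the left side and the integration by parts returns d
  -- + 1, so exactly one copy is left.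
  calc ∫ x, (φ x - c) ^ 2 * Real.exp (-V x)
      ≤ (∫ x, ‖fderiv ℝ φ x‖ ^ 2 * Real.exp (-V x))
        + (d + 2 + C * (1 + R)) * ∫ x in S, (φ x - c) ^ 2 * Real.exp (-V x) := by linarith
    _ ≤ _ := by linarith

section

/-! ### Solving the control law by duality -/

/-- A linear functional that is controlled by a linear map into a Hilbert space is represented
by a vector of that space. -/
theorem exists_inner_representation {X H : Type*} [AddCommGroup X] [Module ℝ X]
    [NormedAddCommGroup H] [InnerProductSpace ℝ H] [CompleteSpace H] (G : X →ₗ[ℝ] H)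
    (l : X →ₗ[ℝ] ℝ) {A B : ℝ} (h : ∀ x, l x ≤ A * ‖G x‖ ^ 2 + B) :
    ∃ v : H, ∀ x, l x = inner ℝ v (G x) := by
  have hker : ∀ x, G x = 0 → l x = 0 := by
    intro x hx
    by_contra hl
    -- If l did not vanish on the kernel of G, this multiple of x would have l-value B + 1, against
    -- the bound B.
    have h1 := h (((B + 1) / l x) • x)
    rw [map_smul, map_smul, hx, smul_zero, norm_zero, smul_eq_mul, div_mul_cancel₀ _ hl] at h1
    linarith
  have hle : ∀ x, l x ≤ (A + B) * ‖G x‖ := by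
    intro x
    by_cases hx : G x = 0
    · rw [hker x hx, hx, norm_zero, mul_zero]
    have hp : 0 < ‖G x‖ := norm_pos_iff.2 hx
    -- Scaling to ‖G x‖ = 1 turns the quadratic bound into a linear one with constant A + B.
    have h1 := h (‖G x‖⁻¹ • x)
    rw [map_smul, map_smul, norm_smul, norm_inv, norm_norm, inv_mul_cancel₀ hp.ne', one_pow,
      mul_one, smul_eq_mul, inv_mul_le_iff₀ hp] at h1
    linarith
  have hab : ∀ x, ‖l x‖ ≤ (A + B) * ‖G x‖ := by
    intro x
    rw [Real.norm_eq_abs, abs_le]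
    have h1 := hle (-x)
    rw [map_neg, map_neg, norm_neg] at h1
    exact ⟨by linarith, hle x⟩
  -- The functional descends to the range of G. Hahn–Banach extends it to all of H and Riesz
  -- represents it.
  let f₀ : LinearMap.range G →ₗ[ℝ] ℝ :=
    ((LinearMap.ker G).liftQ l fun x hx => hker x hx) ∘ₗ
      (G.quotKerEquivRange.symm : LinearMap.range G →ₗ[ℝ] X ⧸ LinearMap.ker G)
  have hf₀ : ∀ x, f₀ ⟨G x, x, rfl⟩ = l x := by
    intro x
    have : (G.quotKerEquivRange.symm ⟨G x, x, rfl⟩ : X ⧸ LinearMap.ker G)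
        = (LinearMap.ker G).mkQ x := by
      rw [LinearEquiv.symm_apply_eq]
      rfl
    simp only [f₀, LinearMap.comp_apply, LinearEquiv.coe_coe, this]
    exact Submodule.liftQ_apply _ _ _
  let f₁ : StrongDual ℝ (LinearMap.range G) := f₀.mkContinuous (A + B) (by
    rintro ⟨_, x, rfl⟩
    rw [hf₀]
    exact hab x)
  obtain ⟨f, hf, -⟩ := exists_extension_norm_eq (LinearMap.range G) f₁
  refine ⟨(InnerProductSpace.toDual ℝ H).symm f, fun x => ?_⟩
  rw [InnerProductSpace.toDual_symm_apply, ← hf₀ x]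
  exact (hf ⟨G x, x, rfl⟩).symm

/-- The space of test functions. -/
def testSpace (d : ℕ) : Submodule ℝ (E d → ℝ) where
  carrier := {φ | IsTest φ}
  add_mem' h1 h2 := h1.add h2
  zero_mem' := ⟨contDiff_const, HasCompactSupport.zero⟩
  smul_mem' c _ h := h.const_mul c

/-- The gradient, as a vector. -/
noncomputable def grad (φ : E d → ℝ) (x : E d) : E d :=
  (InnerProductSpace.toDual ℝ (E d)).symm (fderiv ℝ φ x)

theorem inner_grad (φ : E d → ℝ) (x v : E d) : inner ℝ v (grad φ x) = fderiv ℝ φ x v := by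
  rw [grad, real_inner_comm, InnerProductSpace.toDual_symm_apply]

theorem norm_grad (φ : E d → ℝ) (x : E d) : ‖grad φ x‖ = ‖fderiv ℝ φ x‖ :=
  LinearIsometryEquiv.norm_map _ _

theorem grad_add {φ ψ : E d → ℝ} (hφ : IsTest φ) (hψ : IsTest ψ) (x : E d) :
    grad (φ + ψ) x = grad φ x + grad ψ x := by
  rw [grad, fderiv_add (hφ.1.differentiable (by norm_num) x)
    (hψ.1.differentiable (by norm_num) x), map_add]
  rfl

theorem grad_smul {φ : E d → ℝ} (hφ : IsTest φ) (c : ℝ) (x : E d) :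
    grad (c • φ) x = c • grad φ x := by
  rw [grad, fderiv_const_smul (hφ.1.differentiable (by norm_num) x), map_smul]
  rfl

theorem IsTest.continuous_grad {φ : E d → ℝ} (hφ : IsTest φ) : Continuous (grad φ) :=
  (LinearIsometryEquiv.continuous _).comp hφ.continuous_fderiv

section Duality

variable {S : Type*} [MeasurableSpace S]

/-- Only finitely many test functions occur, so joint measurability follows from continuity of each,
and no σ-algebra on the space of test functions is needed. -/
theorem simpleFunc_measurable_eval (Φ : SimpleFunc S (testSpace d)) :
    Measurable fun p : S × E d => (Φ p.1 : E d → ℝ) p.2 :=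
  SimpleFunc.measurable_bind (Φ.comp Prod.fst measurable_fst)
    (fun φ p => (φ : E d → ℝ) p.2) fun φ => (φ.2.continuous.measurable).comp measurable_snd

theorem simpleFunc_measurable_grad (Φ : SimpleFunc S (testSpace d)) :
    Measurable fun p : S × E d => grad (Φ p.1 : E d → ℝ) p.2 :=
  SimpleFunc.measurable_bind (Φ.comp Prod.fst measurable_fst)
    (fun φ p => grad (φ : E d → ℝ) p.2)
    fun φ => (φ.2.continuous_grad.measurable).comp measurable_snd

theorem simpleFunc_exists_bound (Φ : SimpleFunc S (testSpace d)) :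
    ∃ B : ℝ, ∀ s x, |(Φ s : E d → ℝ) x| ≤ B ∧ ‖grad (Φ s : E d → ℝ) x‖ ≤ B := by
  have hb : ∀ φ : testSpace d, ∃ B, ∀ x, |(φ : E d → ℝ) x| ≤ B ∧ ‖grad (φ : E d → ℝ) x‖ ≤ B :=
    fun φ => by
      obtain ⟨B, -, hB⟩ := φ.2.exists_bound
      exact ⟨B, fun x => ⟨(hB x).1, (norm_grad _ x).le.trans (hB x).2⟩⟩
  choose b hb using hb
  obtain ⟨B, hB⟩ := (Φ.finite_range.image b).bddAbove
  refine ⟨B, fun s x => ?_⟩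
  have h1 : b (Φ s) ≤ B := hB ⟨Φ s, ⟨s, rfl⟩, rfl⟩
  exact ⟨(hb _ x).1.trans h1, (hb _ x).2.trans h1⟩

variable {μ : Measure (S × E d)} [IsFiniteMeasure μ]

theorem simpleFunc_memLp_eval (Φ : SimpleFunc S (testSpace d)) :
    MemLp (fun p : S × E d => (Φ p.1 : E d → ℝ) p.2) 2 μ := by
  obtain ⟨B, hB⟩ := simpleFunc_exists_bound Φ
  exact MemLp.of_bound (simpleFunc_measurable_eval Φ).aestronglyMeasurable B
    (ae_of_all _ fun p => (hB p.1 p.2).1)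

theorem simpleFunc_memLp_grad (Φ : SimpleFunc S (testSpace d)) :
    MemLp (fun p : S × E d => grad (Φ p.1 : E d → ℝ) p.2) 2 μ := by
  obtain ⟨B, hB⟩ := simpleFunc_exists_bound Φ
  exact MemLp.of_bound (simpleFunc_measurable_grad Φ).aestronglyMeasurable B
    (ae_of_all _ fun p => (hB p.1 p.2).2)

variable (μ) in
/-- The spatial gradient of simple functions with values in the test functions. -/
noncomputable def gradLp : SimpleFunc S (testSpace d) →ₗ[ℝ] Lp (E d) 2 μ where
  toFun Φ := (simpleFunc_memLp_grad Φ).toLp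
  map_add' Φ Ψ := by
    rw [← MemLp.toLp_add]
    congr 1
    ext1 p
    exact grad_add (Φ p.1).2 (Ψ p.1).2 p.2
  map_smul' c Φ := by
    rw [RingHom.id_apply, ← MemLp.toLp_const_smul]
    congr 1
    ext1 p
    exact grad_smul (Φ p.1).2 c p.2

theorem simpleFunc_integrable_mul {w : S × E d → ℝ} (hw : MemLp w 2 μ)
    (Φ : SimpleFunc S (testSpace d)) :
    Integrable (fun p : S × E d => (Φ p.1 : E d → ℝ) p.2 * w p) μ :=
  (simpleFunc_memLp_eval Φ).integrable_mul hw

/-- Integration against a square integrable function. -/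
noncomputable def pairing {w : S × E d → ℝ} (hw : MemLp w 2 μ) :
    SimpleFunc S (testSpace d) →ₗ[ℝ] ℝ where
  toFun Φ := ∫ p, (Φ p.1 : E d → ℝ) p.2 * w p ∂μ
  map_add' Φ Ψ := by
    rw [← integral_add (simpleFunc_integrable_mul hw Φ) (simpleFunc_integrable_mul hw Ψ)]
    refine integral_congr_ae (ae_of_all _ fun p => ?_)
    exact add_mul _ _ _
  map_smul' c Φ := by
    rw [RingHom.id_apply, smul_eq_mul, ← integral_const_mul]
    refine integral_congr_ae (ae_of_all _ fun p => ?_)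
    exact mul_assoc _ _ _

end Duality

/-- Under a Poincaré inequality that is uniform in the parameter, the equation
`∇·(ρ u) = ρ w` has a solution of finite energy that is jointly measurable. -/
theorem exists_control {S : Type*} [MeasurableSpace S] {ν : Measure S} [SFinite ν]
    {κ : ProbabilityTheory.Kernel S (E d)} [ProbabilityTheory.IsSFiniteKernel κ]
    [IsFiniteMeasure (ν.compProd κ)] {w : S × E d → ℝ} (hw : MemLp w 2 (ν.compProd κ))
    (hprob : ∀ᵐ s ∂ν, IsProbabilityMeasure (κ s))
    (hw0 : ∀ᵐ s ∂ν, ∫ x, w (s, x) ∂(κ s) = 0) {C : ℝ}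
    (hP : ∀ᵐ s ∂ν, ∀ φ : E d → ℝ, IsTest φ → ∃ c : ℝ,
      ∫ x, (φ x - c) ^ 2 ∂(κ s) ≤ C * ∫ x, ‖fderiv ℝ φ x‖ ^ 2 ∂(κ s)) :
    ∃ u : S × E d → E d, Measurable u ∧ MemLp u 2 (ν.compProd κ) ∧
      ∀ᵐ s ∂ν, LocallyIntegrable (fun x => u (s, x)) (κ s) ∧
        LocallyIntegrable (fun x => w (s, x)) (κ s) ∧ ∀ φ : E d → ℝ, IsTest φ →
        ∫ x, φ x * w (s, x) ∂(κ s) = -∫ x, fderiv ℝ φ x (u (s, x)) ∂(κ s) := by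
  set μ := ν.compProd κ with hμ
  have hslice : ∀ {f : S × E d → ℝ}, Integrable f μ →
      (∀ᵐ s ∂ν, Integrable (fun x => f (s, x)) (κ s)) ∧
      Integrable (fun s => ∫ x, f (s, x) ∂(κ s)) ν := fun {f} hf =>
    ⟨((Measure.integrable_compProd_iff hf.aestronglyMeasurable).1 hf).1,
      Integrable.integral_compProd (κ := ProbabilityTheory.Kernel.const Unit ν)
        (η := ProbabilityTheory.Kernel.prodMkLeft Unit κ) (a := ()) hf⟩
  have hwsq := hslice hw.integrable_sq
  have hw1 := hslice (hw.integrable (by norm_num))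
  -- On each slice w has mean zero, so a constant may be subtracted from φ before Young and Poincaré
  -- are applied. The constant depends on s but is gone before the integration in s.
  have hbound : ∀ Φ, pairing hw Φ ≤ C / 2 * ‖gradLp μ Φ‖ ^ 2 + 1 / 2 * ∫ p, w p ^ 2 ∂μ := by
    intro Φ
    have hnorm : ‖gradLp μ Φ‖ ^ 2 = ∫ p, ‖grad (Φ p.1 : E d → ℝ) p.2‖ ^ 2 ∂μ := by
      rw [← real_inner_self_eq_norm_sq, L2.inner_def]
      refine integral_congr_ae ?_
      filter_upwards [(simpleFunc_memLp_grad (μ := μ) Φ).coeFn_toLp] with p hp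
      rw [← real_inner_self_eq_norm_sq]
      exact congrArg₂ _ hp hp
    have i1 := simpleFunc_integrable_mul hw Φ
    have i2 : Integrable (fun p : S × E d => ‖grad (Φ p.1 : E d → ℝ) p.2‖ ^ 2) μ :=
      (simpleFunc_memLp_grad Φ).integrable_norm_pow (p := 2) (by norm_num)
    have h1 : pairing hw Φ = ∫ s, ∫ x, (Φ s : E d → ℝ) x * w (s, x) ∂(κ s) ∂ν :=
      Measure.integral_compProd i1
    have h2 : ∫ p, ‖grad (Φ p.1 : E d → ℝ) p.2‖ ^ 2 ∂μ
        = ∫ s, ∫ x, ‖grad (Φ s : E d → ℝ) x‖ ^ 2 ∂(κ s) ∂ν := Measure.integral_compProd i2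
    have h3 : ∫ p, w p ^ 2 ∂μ = ∫ s, ∫ x, w (s, x) ^ 2 ∂(κ s) ∂ν :=
      Measure.integral_compProd hw.integrable_sq
    have j2 := (hslice i2).2
    rw [hnorm, h1, h2, h3, ← integral_const_mul, ← integral_const_mul,
      ← integral_add (j2.const_mul _) (hwsq.2.const_mul _)]
    refine integral_mono_ae (hslice i1).2 ((j2.const_mul _).add (hwsq.2.const_mul _)) ?_
    filter_upwards [hP, hw0, hprob, hwsq.1, hw1.1, (hslice i1).1] with s hPs hw0s hps hws hwi hi1
    obtain ⟨c, hc⟩ := hPs _ (Φ s).2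
    have hΦ := (Φ s).2
    obtain ⟨B, hB0, hB⟩ := IsTest.exists_bound hΦ
    have hwL : MemLp (fun x => w (s, x)) 2 (κ s) :=
      (memLp_two_iff_integrable_sq hwi.aestronglyMeasurable).2 hws
    have hφc : MemLp (fun x => (Φ s : E d → ℝ) x - c) 2 (κ s) :=
      (MemLp.of_bound (IsTest.continuous hΦ).aestronglyMeasurable B
        (ae_of_all _ fun x => (hB x).1)).sub (memLp_const c)
    have e1 : ∫ x, (Φ s : E d → ℝ) x * w (s, x) ∂(κ s)
        = ∫ x, ((Φ s : E d → ℝ) x - c) * w (s, x) ∂(κ s) := by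
      simp_rw [sub_mul]
      rw [integral_sub hi1 (hwi.const_mul c), integral_const_mul, hw0s, mul_zero, sub_zero]
    have e2 : ∫ x, ((Φ s : E d → ℝ) x - c) * w (s, x) ∂(κ s)
        ≤ 1 / 2 * ∫ x, ((Φ s : E d → ℝ) x - c) ^ 2 ∂(κ s) + 1 / 2 * ∫ x, w (s, x) ^ 2 ∂(κ s) := by
      rw [← integral_const_mul, ← integral_const_mul,
        ← integral_add (hφc.integrable_sq.const_mul _) (hws.const_mul _)]
      refine integral_mono (hφc.integrable_mul hwL)
        ((hφc.integrable_sq.const_mul _).add (hws.const_mul _)) fun x => ?_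
      simp only
      nlinarith [sq_nonneg ((Φ s : E d → ℝ) x - c - w (s, x))]
    simp only [norm_grad]
    linarith
  obtain ⟨v, hv⟩ := exists_inner_representation (gradLp μ) (pairing hw) hbound
  have hvm : Measurable v := (Lp.stronglyMeasurable v).measurable
  have hvL : MemLp v 2 μ := Lp.memLp v
  have hv1 : ∀ᵐ s ∂ν, Integrable (fun x => v (s, x)) (κ s) :=
    ((Measure.integrable_compProd_iff hvm.aestronglyMeasurable).1
      (hvL.integrable (by norm_num))).1
  -- The space-time identity is tested against the function equal to φ for s in A and to 0
  -- otherwise; as A is arbitrary, it holds on almost every slice.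
  have key : ∀ φ : E d → ℝ, IsTest φ → ∀ᵐ s ∂ν,
      ∫ x, φ x * w (s, x) ∂(κ s) = ∫ x, fderiv ℝ φ x (v (s, x)) ∂(κ s) := by
    intro φ hφ
    obtain ⟨B, hB0, hB⟩ := hφ.exists_bound
    have i1 : Integrable (fun p : S × E d => φ p.2 * w p) μ := by
      refine (hw.integrable (by norm_num)).bdd_mul (c := B)
        (hφ.continuous.measurable.comp measurable_snd).aestronglyMeasurable
        (ae_of_all _ fun p => (hB p.2).1)
    have i2 : Integrable (fun p : S × E d => fderiv ℝ φ p.2 (v p)) μ := by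
      refine ((hvL.integrable (by norm_num)).norm.const_mul B).mono'
        (aestronglyMeasurable_fderiv_apply measurable_snd.aestronglyMeasurable
          hvm.aestronglyMeasurable hφ.1) (ae_of_all _ fun p => ?_)
      exact ((fderiv ℝ φ p.2).le_opNorm _).trans
        (mul_le_mul_of_nonneg_right (hB p.2).2 (norm_nonneg _))
    refine (hslice i1).2.ae_eq_of_forall_setIntegral_eq _ _ (hslice i2).2 fun A hA _ => ?_
    have hfst : MeasurableSet (Prod.fst ⁻¹' A : Set (S × E d)) := measurable_fst hA
    classical
    let Φ : SimpleFunc S (testSpace d) :=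
      SimpleFunc.piecewise A hA (SimpleFunc.const S ⟨φ, hφ⟩) (SimpleFunc.const S 0)
    have hΦ : ∀ s, (Φ s : E d → ℝ) = if s ∈ A then φ else 0 := fun s => by
      by_cases hs : s ∈ A <;> simp [Φ, hs]
    have hset : ∀ {f : S × E d → ℝ}, Integrable f μ →
        ∫ s in A, ∫ x, f (s, x) ∂(κ s) ∂ν = ∫ p, (Prod.fst ⁻¹' A).indicator f p ∂μ := by
      intro f hf
      rw [hμ, Measure.integral_compProd (hf.indicator hfst), ← integral_indicator hA]
      refine integral_congr_ae (ae_of_all _ fun s => ?_)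
      by_cases hs : s ∈ A <;> simp [hs, indicator]
    rw [hset i1, hset i2]
    have h1 := hv Φ
    rw [L2.inner_def] at h1
    have h2 : pairing hw Φ = ∫ p, (Prod.fst ⁻¹' A).indicator (fun p => φ p.2 * w p) p ∂μ := by
      refine integral_congr_ae (ae_of_all _ fun p => ?_)
      by_cases hp : p.1 ∈ A <;> simp [hΦ, hp, indicator]
    rw [← h2, h1]
    refine integral_congr_ae ?_
    filter_upwards [(simpleFunc_memLp_grad (μ := μ) Φ).coeFn_toLp] with p hp
    have h3 : (gradLp μ Φ : S × E d → E d) p = grad (Φ p.1 : E d → ℝ) p.2 := hp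
    rw [h3, inner_grad, hΦ]
    by_cases hpA : p.1 ∈ A
    · simp [hpA, indicator]
    · simp [hpA, indicator]
  -- The representing field satisfies the identity with a plus sign, and the divergence convention
  -- has a minus sign.
  refine ⟨fun p => -v p, hvm.neg, hvL.neg, ?_⟩
  have hall := ae_all_iff.2 fun n => key _ (isTest_denseTest (d := d) n)
  filter_upwards [hall, hv1, hw1.1] with s hs hvs hws
  refine ⟨hvs.neg.locallyIntegrable, hws.locallyIntegrable, fun φ hφ => ?_⟩
  refine forall_isTest_of_denseTest hws.locallyIntegrable hvs.neg.locallyIntegrable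
    (fun n => ?_) hφ
  rw [hs n]
  simp only [Pi.neg_apply, map_neg]
  rw [integral_neg, neg_neg]

end

section

/-! ### Exponential tilting of a density -/

/-- The growth constant depends on the upper bound L and not on k, which makes the Poincaré constant
uniform along the tilt. -/
theorem QuadGrowth.add_smul {C C' : ℝ} {V h : E d → ℝ} (hV : QuadGrowth C V)
    (hh : QuadGrowth C' h) {k L : ℝ} (hk : k ∈ Icc 0 L) :
    QuadGrowth (C + L * C') (fun x => V x + k * h x) where
  contDiff := hV.contDiff.add (contDiff_const.mul hh.contDiff)
  bound x := by
    refine (abs_add_le _ _).trans ?_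
    rw [abs_mul, abs_of_nonneg hk.1]
    have h1 := hV.bound x
    have h2 : k * |h x| ≤ L * (C' * (1 + ‖x‖) ^ 2) :=
      mul_le_mul hk.2 (hh.bound x) (abs_nonneg _) (hk.1.trans hk.2)
    linarith
  bound_fderiv x := by
    have h1 := (hV.contDiff.differentiable (by norm_num) x).hasFDerivAt
    have h2 := (hh.contDiff.differentiable (by norm_num) x).hasFDerivAt
    rw [(h1.fun_add (h2.const_mul k)).fderiv]
    refine (norm_add_le _ _).trans ?_
    rw [norm_smul, Real.norm_of_nonneg hk.1]
    have h3 := hV.bound_fderiv x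
    have h4 : k * ‖fderiv ℝ h x‖ ≤ L * (C' * (1 + ‖x‖)) :=
      mul_le_mul hk.2 (hh.bound_fderiv x) (norm_nonneg _) (hk.1.trans hk.2)
    linarith

/-- It ensures that the tilting factor exp(-k h), k ≥ 0, grows at most exponentially in ‖x‖, so that
exponential moments absorb it. -/
theorem exists_linear_lower_bound' {h : E d → ℝ} (hh : ContDiff ℝ 1 h)
    (hr : ∃ c : ℝ, ∀ᶠ x in cocompact (E d), c ≤ fderiv ℝ h x x / ‖x‖) :
    ∃ a, 0 ≤ a ∧ ∀ x, -(a * (1 + ‖x‖)) ≤ h x := by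
  obtain ⟨c, hc⟩ := hr
  obtain ⟨D, hD0, hD⟩ := exists_linear_lower_bound hh hc
  refine ⟨|c| + D, by positivity, fun x => ?_⟩
  have h1 := hD x
  have h2 := neg_abs_le c
  nlinarith [norm_nonneg x, abs_nonneg c]

/-- The Poincaré inequality for the tilted densities, uniformly in the tilting parameter. -/
theorem AssumptionA1.exists_poincare {ρ₀ h : E d → ℝ} (hρ₀ : AssumptionA1 ρ₀) {C : ℝ}
    (hh : QuadGrowth C h)
    (hr : ∃ c : ℝ, ∀ᶠ x in cocompact (E d), c ≤ fderiv ℝ h x x / ‖x‖) {L : ℝ} (hL : 0 ≤ L) :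
    ∃ K, 0 ≤ K ∧ ∀ k ∈ Icc 0 L, ∀ φ : E d → ℝ, IsTest φ → ∃ c : ℝ,
      ∫ x, (φ x - c) ^ 2 * (ρ₀ x * Real.exp (-k * h x))
        ≤ K * ∫ x, ‖fderiv ℝ φ x‖ ^ 2 * (ρ₀ x * Real.exp (-k * h x)) := by
  obtain ⟨V, -, hexp, ⟨C₀, hV⟩, htend, hlow⟩ := hρ₀.exists_potential
  obtain ⟨a, ha0, ha⟩ := exists_linear_lower_bound' hh.contDiff hr
  obtain ⟨c, hc⟩ := hr
  -- The term L|c| compensates the worst tilt, and the factor 2 is lost when 1/‖x‖ is replaced by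
  -- the radial weight; d + 2 is what the Lyapunov condition asks for.
  have hev : ∀ᶠ x in cocompact (E d), 2 * (d + 2) + L * |c| ≤ fderiv ℝ V x x / ‖x‖ ∧
      c ≤ fderiv ℝ h x x / ‖x‖ := (htend.eventually_ge_atTop _).and hc
  obtain ⟨R, hR1, hR⟩ : ∃ R : ℝ, 1 ≤ R ∧ ∀ x : E d, R ≤ ‖x‖ →
      2 * (d + 2) + L * |c| ≤ fderiv ℝ V x x / ‖x‖ ∧ c ≤ fderiv ℝ h x x / ‖x‖ := by
    rw [← Metric.cobounded_eq_cocompact, ← comap_norm_atTop, eventually_comap,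
      eventually_atTop] at hev
    obtain ⟨R, hR⟩ := hev
    exact ⟨max R 1, le_max_right _ _, fun x hx => hR _ ((le_max_left _ _).trans hx) x rfl⟩
  have hC := hh.nonneg
  have hC₀ := hV.nonneg
  refine ⟨1 + (d + 2 + (C₀ + L * C) * (1 + R)) * (Real.exp ((C₀ + L * C) * (1 + R) ^ 2)
    * ((2 * R) ^ 2 * 2 ^ d) * Real.exp ((C₀ + L * C) * (1 + R) ^ 2)), by positivity,
    fun k hk φ hφ => ?_⟩
  have hq := hV.add_smul hh hk
  have hweight : ∀ x, ρ₀ x * Real.exp (-k * h x) = Real.exp (-(V x + k * h x)) := fun x => by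
    rw [hexp, ← Real.exp_add]
    congr 1
    ring
  simp_rw [hweight]
  refine weighted_poincare hq ?_ (by linarith) (fun x hx => ?_) hφ
  -- Of the slope, L a pays for the tilt, 1 for the factor 1 + ‖x‖, and 1 remains for the decay
  -- exp(-‖x‖).
  · obtain ⟨D, -, hD⟩ := hlow (2 + L * a)
    have hcont := hq.contDiff.continuous
    refine ((integrable_exp_neg_norm d).const_mul (Real.exp (D + L * a))).mono'
      (by fun_prop) (ae_of_all _ fun x => ?_)
    have h1 := one_add_norm_pow_le 1 x
    rw [pow_one, Nat.cast_one, one_mul] at h1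
    have h2 : -(L * a * (1 + ‖x‖)) ≤ k * h x := by
      have h3 := mul_le_mul_of_nonneg_left (ha x) hk.1
      have h4 : k * (a * (1 + ‖x‖)) ≤ L * (a * (1 + ‖x‖)) :=
        mul_le_mul_of_nonneg_right hk.2 (by positivity)
      linarith
    rw [Real.norm_of_nonneg (by positivity)]
    calc (1 + ‖x‖) * Real.exp (-(V x + k * h x))
        ≤ Real.exp ‖x‖ * Real.exp (-(V x + k * h x)) := by gcongr
      _ = Real.exp (‖x‖ + -(V x + k * h x)) := by rw [Real.exp_add]
      _ ≤ Real.exp (D + L * a + -‖x‖) := Real.exp_le_exp.2 (by linarith [hD x])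
      _ = _ := by rw [Real.exp_add]
  · obtain ⟨h1, h2⟩ := hR x hx
    have hx0 : 0 < ‖x‖ := by linarith
    rw [le_div_iff₀ hx0] at h1 h2
    have e1 := (hV.contDiff.differentiable (by norm_num) x).hasFDerivAt
    have e2 := (hh.contDiff.differentiable (by norm_num) x).hasFDerivAt
    rw [(e1.fun_add (e2.const_mul k)).fderiv]
    simp only [add_apply, smul_apply, smul_eq_mul]
    have h3 : -(L * |c|) * ‖x‖ ≤ k * fderiv ℝ h x x := by
      have h4 : -(|c| * ‖x‖) ≤ fderiv ℝ h x x := by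
        have := mul_le_mul_of_nonneg_right (neg_abs_le c) hx0.le
        linarith
      have h5 := mul_le_mul_of_nonneg_left h4 hk.1
      have h6 : k * (|c| * ‖x‖) ≤ L * (|c| * ‖x‖) :=
        mul_le_mul_of_nonneg_right hk.2 (by positivity)
      linarith
    have h7 : 2 * (d + 2 : ℝ) * ‖x‖ ≤ fderiv ℝ V x x + k * fderiv ℝ h x x := by linarith
    have h8 := mul_le_mul_of_nonneg_left h7 (radialWeight_pos x).le
    have h9 := half_le_radialWeight_mul_norm (hR1.trans hx)
    have h10 : (0 : ℝ) ≤ d + 2 := by positivity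
    nlinarith

/-- The control law has a solution in `L²(ρ)`. -/
theorem AssumptionA1.exists_solvesControlPDE {ρ h : E d → ℝ} (hρ : AssumptionA1 ρ) {C : ℝ}
    (hh : QuadGrowth C h)
    (hr : ∃ c : ℝ, ∀ᶠ x in cocompact (E d), c ≤ fderiv ℝ h x x / ‖x‖) (β : ℝ) :
    ∃ u, MemLp u 2 (law ρ) ∧ SolvesControlPDE β h ρ u := by
  obtain ⟨K, -, hK⟩ := hρ.exists_poincare hh hr le_rfl
  have hprob := hρ.density.isProbabilityMeasure
  have hm := hρ.density.measurable
  have h0 := hρ.density.nonneg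
  have hhm := hh.contDiff.continuous.measurable
  have hh2 := hρ.memLp_two hh
  have hw2 : MemLp (fun x => β * (h x - mean ρ h)) 2 (law ρ) :=
    (hh2.sub (memLp_const _)).const_mul β
  -- The stationary problem is the space-time problem over a one-point parameter space.
  let κ : ProbabilityTheory.Kernel Unit (E d) := ProbabilityTheory.Kernel.const Unit (law ρ)
  let ν : Measure Unit := Measure.dirac ()
  have hwm : Measurable fun p : Unit × E d => β * (h p.2 - mean ρ h) := by fun_prop
  have hw : MemLp (fun p : Unit × E d => β * (h p.2 - mean ρ h)) 2 (ν.compProd κ) := by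
    rw [memLp_two_iff_integrable_sq hwm.aestronglyMeasurable,
      Measure.integrable_compProd_iff (hwm.pow_const 2).aestronglyMeasurable]
    refine ⟨ae_of_all _ fun _ => hw2.integrable_sq, ?_⟩
    exact integrable_const (∫ y, ‖(β * (h y - mean ρ h)) ^ 2‖ ∂(law ρ))
  have hw0 : ∫ x, β * (h x - mean ρ h) ∂(law ρ) = 0 := by
    rw [integral_const_mul, integral_sub (hh2.integrable (by norm_num)) (integrable_const _)]
    simp [mean]
  have hP : ∀ φ : E d → ℝ, IsTest φ → ∃ c : ℝ,
      ∫ x, (φ x - c) ^ 2 ∂(law ρ) ≤ K * ∫ x, ‖fderiv ℝ φ x‖ ^ 2 ∂(law ρ) := fun φ hφ => by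
    obtain ⟨c, hc⟩ := hK 0 ⟨le_rfl, le_rfl⟩ φ hφ
    refine ⟨c, ?_⟩
    rw [integral_law hm h0, integral_law hm h0]
    simpa [mul_comm] using hc
  obtain ⟨u, hum, hu2, hu⟩ := exists_control hw (C := K) (ae_of_all _ fun _ => hprob)
    (ae_of_all _ fun _ => hw0) (ae_of_all _ fun _ => hP)
  have hu' : SolvesControlPDE β h ρ (fun x => u ((), x)) :=
    (ae_dirac_eq (a := ()) ▸ hu : ∀ᶠ s in pure (), _)
  have hn : Integrable (fun p => ‖u p‖ ^ 2) (ν.compProd κ) :=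
    hu2.integrable_norm_pow (p := 2) (by norm_num)
  have hs := ((Measure.integrable_compProd_iff hn.aestronglyMeasurable).1 hn).1
  have hs' : Integrable (fun x => ‖u ((), x)‖ ^ 2) (law ρ) :=
    (ae_dirac_eq (a := ()) ▸ hs : ∀ᶠ s in pure (), _)
  exact ⟨fun x => u ((), x), (memLp_two_iff_integrable_sq_norm
    (hum.comp measurable_prodMk_left).aestronglyMeasurable).2 hs', hu'⟩

/-- The unnormalized tilted integral `∫ f exp (-k h) ρ₀ dx`. -/
noncomputable def tilt (ρ₀ h f : E d → ℝ) (k : ℝ) : ℝ :=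
  ∫ x, ρ₀ x * Real.exp (-k * h x) * f x

section Tilt

variable {ρ₀ h f : E d → ℝ} {C a M : ℝ} {n : ℕ}

/-- The bound is uniform in k on [0, L], so it dominates both for continuity and for differentiation
in the tilting parameter. -/
theorem tilt_weight_le (h0 : ∀ x, 0 ≤ ρ₀ x) (ha0 : 0 ≤ a) (ha : ∀ x, -(a * (1 + ‖x‖)) ≤ h x)
    {k L : ℝ} (hk : k ∈ Icc 0 L) (x : E d) :
    ρ₀ x * Real.exp (-k * h x) ≤ ρ₀ x * (Real.exp (L * a) * Real.exp (L * a * ‖x‖)) := by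
  refine mul_le_mul_of_nonneg_left ?_ (h0 x)
  rw [← Real.exp_add]
  refine Real.exp_le_exp.2 ?_
  have h3 := mul_le_mul_of_nonneg_left (ha x) hk.1
  have h4 : k * (a * (1 + ‖x‖)) ≤ L * (a * (1 + ‖x‖)) :=
    mul_le_mul_of_nonneg_right hk.2 (by positivity)
  linarith

/-- The dominating function for tilted integrals. -/
theorem AssumptionA1.integrable_tilt_bound (hρ₀ : AssumptionA1 ρ₀) (L a M : ℝ) (n : ℕ) :
    Integrable fun x => ρ₀ x * (Real.exp (L * a) * Real.exp (L * a * ‖x‖))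
      * (M * Real.exp (n * ‖x‖)) := by
  refine ((hρ₀.integrable_exp_volume (L * a + n)).const_mul (Real.exp (L * a) * M)).congr
    (ae_of_all _ fun x => ?_)
  simp only
  rw [add_mul, Real.exp_add]
  ring

theorem tilt_integrand_le (h0 : ∀ x, 0 ≤ ρ₀ x) (ha0 : 0 ≤ a)
    (ha : ∀ x, -(a * (1 + ‖x‖)) ≤ h x) (hM0 : 0 ≤ M) (hM : ∀ x, |f x| ≤ M * (1 + ‖x‖) ^ n)
    {k L : ℝ} (hk : k ∈ Icc 0 L) (x : E d) :
    |ρ₀ x * Real.exp (-k * h x) * f x|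
      ≤ ρ₀ x * (Real.exp (L * a) * Real.exp (L * a * ‖x‖)) * (M * Real.exp (n * ‖x‖)) := by
  have hnn : 0 ≤ ρ₀ x * Real.exp (-k * h x) := mul_nonneg (h0 x) (Real.exp_nonneg _)
  rw [abs_mul, abs_of_nonneg hnn]
  refine mul_le_mul (tilt_weight_le h0 ha0 ha hk x) ((hM x).trans ?_) (abs_nonneg _)
    (mul_nonneg (h0 x) (by positivity))
  exact mul_le_mul_of_nonneg_left (one_add_norm_pow_le n x) hM0

theorem AssumptionA1.integrable_tilt (hρ₀ : AssumptionA1 ρ₀) (hhm : Measurable h)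
    (hfm : Measurable f) (ha0 : 0 ≤ a) (ha : ∀ x, -(a * (1 + ‖x‖)) ≤ h x) (hM0 : 0 ≤ M)
    (hM : ∀ x, |f x| ≤ M * (1 + ‖x‖) ^ n) {k : ℝ} (hk : 0 ≤ k) :
    Integrable fun x => ρ₀ x * Real.exp (-k * h x) * f x := by
  have hm := hρ₀.density.measurable
  exact (hρ₀.integrable_tilt_bound k a M n).mono' (by fun_prop)
    (ae_of_all _ (tilt_integrand_le hρ₀.density.nonneg ha0 ha hM0 hM ⟨hk, le_rfl⟩))

theorem AssumptionA1.continuousOn_tilt (hρ₀ : AssumptionA1 ρ₀) (hhm : Measurable h)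
    (hfm : Measurable f) (ha0 : 0 ≤ a) (ha : ∀ x, -(a * (1 + ‖x‖)) ≤ h x) (hM0 : 0 ≤ M)
    (hM : ∀ x, |f x| ≤ M * (1 + ‖x‖) ^ n) (L : ℝ) :
    ContinuousOn (tilt ρ₀ h f) (Icc 0 L) := by
  have hm := hρ₀.density.measurable
  intro k hk
  refine continuousWithinAt_of_dominated (Eventually.of_forall fun k => ?_)
    (eventually_nhdsWithin_of_forall fun k hk => ae_of_all _
      (tilt_integrand_le hρ₀.density.nonneg ha0 ha hM0 hM hk))
    (hρ₀.integrable_tilt_bound L a M n) (ae_of_all _ fun x => ?_)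
  · exact (by fun_prop : Measurable fun x => ρ₀ x * Real.exp (-k * h x) * f x).aestronglyMeasurable
  · exact (by fun_prop : Continuous fun k : ℝ =>
      ρ₀ x * Real.exp (-k * h x) * f x).continuousWithinAt

/-- Two-sided differentiation needs k > 0: h may grow quadratically upwards, so for negative k the
weight need not be integrable. The endpoint 0 is reached through `continuousOn_tilt`. -/
theorem AssumptionA1.hasDerivAt_tilt (hρ₀ : AssumptionA1 ρ₀) (hh : QuadGrowth C h)
    (hfm : Measurable f) (ha0 : 0 ≤ a) (ha : ∀ x, -(a * (1 + ‖x‖)) ≤ h x) (hM0 : 0 ≤ M)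
    (hM : ∀ x, |f x| ≤ M * (1 + ‖x‖) ^ n) {k : ℝ} (hk : 0 < k) :
    HasDerivAt (tilt ρ₀ h f) (-tilt ρ₀ h (fun x => h x * f x) k) k := by
  have hm := hρ₀.density.measurable
  have hhm := hh.contDiff.continuous.measurable
  have hC := hh.nonneg
  have hM' : ∀ x, |h x * f x| ≤ C * M * (1 + ‖x‖) ^ (n + 2) := fun x => by
    rw [abs_mul]
    calc |h x| * |f x| ≤ (C * (1 + ‖x‖) ^ 2) * (M * (1 + ‖x‖) ^ n) :=
          mul_le_mul (hh.bound x) (hM x) (abs_nonneg _) (by positivity)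
      _ = _ := by ring
  have h1 := hasDerivAt_integral_of_dominated_loc_of_deriv_le (μ := (volume : Measure (E d)))
    (F := fun k x => ρ₀ x * Real.exp (-k * h x) * f x)
    (F' := fun k x => -(ρ₀ x * Real.exp (-k * h x) * (h x * f x)))
    (x₀ := k) (s := Ioo 0 (k + 1)) (Ioo_mem_nhds hk (by linarith))
    (Eventually.of_forall fun k => ?_)
    (hρ₀.integrable_tilt hhm hfm ha0 ha hM0 hM hk.le) ?_
    (ae_of_all _ fun x k' hk' => ?_)
    (hρ₀.integrable_tilt_bound (k + 1) a (C * M) (n + 2)) (ae_of_all _ fun x k' _ => ?_)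
  · have h2 := h1.2
    rw [integral_neg] at h2
    exact h2
  · exact (by fun_prop : Measurable fun x =>
      ρ₀ x * Real.exp (-k * h x) * f x).aestronglyMeasurable
  · exact (by fun_prop : Measurable fun x =>
      -(ρ₀ x * Real.exp (-k * h x) * (h x * f x))).aestronglyMeasurable
  · rw [norm_neg]
    exact tilt_integrand_le hρ₀.density.nonneg ha0 ha (by positivity) hM' ⟨hk'.1.le, hk'.2.le⟩ x
  · have h3 : HasDerivAt (fun k : ℝ => -k * h x) (-1 * h x) k' :=
      (hasDerivAt_neg k').mul_const (h x)
    have h4 := (h3.exp.const_mul (ρ₀ x)).mul_const (f x)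
    exact h4.congr_deriv (by ring)

theorem AssumptionA1.tilt_one_pos (hρ₀ : AssumptionA1 ρ₀) (hhm : Measurable h)
    (ha0 : 0 ≤ a) (ha : ∀ x, -(a * (1 + ‖x‖)) ≤ h x) {k : ℝ} (hk : 0 ≤ k) :
    0 < tilt ρ₀ h (fun _ => 1) k := by
  obtain ⟨V, -, hexp, -⟩ := hρ₀.exists_potential
  have hi := hρ₀.integrable_tilt (f := fun _ => 1) (M := 1) (n := 0) hhm measurable_const ha0 ha
    zero_le_one (by simp) hk
  have hpos : ∀ x, 0 < ρ₀ x * Real.exp (-k * h x) * 1 := fun x => by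
    rw [hexp]; positivity
  rw [tilt, integral_pos_iff_support_of_nonneg (fun x => (hpos x).le) hi]
  have : Function.support (fun x => ρ₀ x * Real.exp (-k * h x) * 1) = univ :=
    eq_univ_of_forall fun x => (hpos x).ne'
  rw [this]
  exact isOpen_univ.measure_pos volume univ_nonempty

/-- The normalized tilted density. -/
noncomputable def gibbs (ρ₀ h : E d → ℝ) (k : ℝ) (x : E d) : ℝ :=
  ρ₀ x * Real.exp (-k * h x) / tilt ρ₀ h (fun _ => 1) k

theorem measurable_tilt (hm : Measurable ρ₀) (hhm : Measurable h) (hfm : Measurable f) :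
    Measurable (tilt ρ₀ h f) := by
  have : Measurable fun p : ℝ × E d => ρ₀ p.2 * Real.exp (-p.1 * h p.2) * f p.2 := by fun_prop
  exact (this.stronglyMeasurable.integral_prod_right' (ν := volume)).measurable

theorem measurable_gibbs (hm : Measurable ρ₀) (hhm : Measurable h) :
    Measurable (Function.uncurry (gibbs ρ₀ h)) := by
  have h1 := measurable_tilt hm hhm (measurable_const (a := (1 : ℝ)))
  have : Function.uncurry (gibbs ρ₀ h) = fun p : ℝ × E d =>
    ρ₀ p.2 * Real.exp (-p.1 * h p.2) / tilt ρ₀ h (fun _ => 1) p.1 := rfl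
  rw [this]
  exact (by fun_prop : Measurable fun p : ℝ × E d => ρ₀ p.2 * Real.exp (-p.1 * h p.2)).div
    (h1.comp measurable_fst)

theorem AssumptionA1.gibbs_zero (hρ₀ : AssumptionA1 ρ₀) : gibbs ρ₀ h 0 = ρ₀ := by
  ext x
  simp [gibbs, tilt, hρ₀.density.integral_eq_one]

theorem AssumptionA1.gibbs_nonneg (hρ₀ : AssumptionA1 ρ₀) (hhm : Measurable h)
    (ha0 : 0 ≤ a) (ha : ∀ x, -(a * (1 + ‖x‖)) ≤ h x) {k : ℝ} (hk : 0 ≤ k) (x : E d) :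
    0 ≤ gibbs ρ₀ h k x :=
  div_nonneg (mul_nonneg (hρ₀.density.nonneg x) (Real.exp_nonneg _))
    (hρ₀.tilt_one_pos hhm ha0 ha hk).le

theorem AssumptionA1.integral_gibbs (hρ₀ : AssumptionA1 ρ₀) (hhm : Measurable h)
    (ha0 : 0 ≤ a) (ha : ∀ x, -(a * (1 + ‖x‖)) ≤ h x) {k : ℝ} (hk : 0 ≤ k) (f : E d → ℝ) :
    ∫ x, f x ∂(law (gibbs ρ₀ h k)) = tilt ρ₀ h f k / tilt ρ₀ h (fun _ => 1) k := by
  have hmeas : Measurable (gibbs ρ₀ h k) :=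
    (measurable_gibbs hρ₀.density.measurable hhm).comp measurable_prodMk_left
  rw [integral_law hmeas (hρ₀.gibbs_nonneg hhm ha0 ha hk), tilt, ← integral_div]
  refine integral_congr_ae (ae_of_all _ fun x => ?_)
  simp only [gibbs]
  ring

theorem AssumptionA1.integrable_gibbs (hρ₀ : AssumptionA1 ρ₀) (hhm : Measurable h)
    (hfm : Measurable f) (ha0 : 0 ≤ a) (ha : ∀ x, -(a * (1 + ‖x‖)) ≤ h x) (hM0 : 0 ≤ M)
    (hM : ∀ x, |f x| ≤ M * (1 + ‖x‖) ^ n) {k : ℝ} (hk : 0 ≤ k) :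
    Integrable f (law (gibbs ρ₀ h k)) := by
  have hmeas : Measurable (gibbs ρ₀ h k) :=
    (measurable_gibbs hρ₀.density.measurable hhm).comp measurable_prodMk_left
  rw [integrable_law_iff hmeas (hρ₀.gibbs_nonneg hhm ha0 ha hk)]
  refine ((hρ₀.integrable_tilt hhm hfm ha0 ha hM0 hM hk).div_const
    (tilt ρ₀ h (fun _ => 1) k)).congr (ae_of_all _ fun x => ?_)
  simp only [gibbs]
  ring

theorem AssumptionA1.isDensity_gibbs (hρ₀ : AssumptionA1 ρ₀) (hhm : Measurable h)
    (ha0 : 0 ≤ a) (ha : ∀ x, -(a * (1 + ‖x‖)) ≤ h x) {k : ℝ} (hk : 0 ≤ k) :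
    IsDensity (gibbs ρ₀ h k) := by
  have hmeas : Measurable (gibbs ρ₀ h k) :=
    (measurable_gibbs hρ₀.density.measurable hhm).comp measurable_prodMk_left
  have hnn := hρ₀.gibbs_nonneg hhm ha0 ha hk
  have h1 := hρ₀.integrable_gibbs (f := fun _ => 1) (M := 1) (n := 0) hhm measurable_const ha0 ha
    zero_le_one (by simp) hk
  have h2 := hρ₀.integrable_gibbs (f := fun x => ‖x‖ ^ 2) (M := 1) (n := 2) hhm (by fun_prop)
    ha0 ha zero_le_one (fun x => by
      rw [abs_of_nonneg (by positivity), one_mul]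
      gcongr
      linarith) hk
  rw [integrable_law_iff hmeas hnn] at h1 h2
  refine ⟨hmeas, hnn, by simpa using h1, ?_, by simpa [mul_comm] using h2⟩
  have h3 := hρ₀.integral_gibbs hhm ha0 ha hk (fun _ => (1 : ℝ))
  rw [integral_law hmeas hnn, div_self (hρ₀.tilt_one_pos hhm ha0 ha hk).ne'] at h3
  simpa using h3

end Tilt

end

section

/-! ### The optimal pair -/

section GibbsPath

variable {ρ₀ h φ : E d → ℝ} {C a : ℝ}

/-- The evolution of expectations along the tilted densities. -/
theorem AssumptionA1.hasDerivAt_integral_gibbs (hρ₀ : AssumptionA1 ρ₀) (hh : QuadGrowth C h)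
    (ha0 : 0 ≤ a) (ha : ∀ x, -(a * (1 + ‖x‖)) ≤ h x) (hφ : IsTest φ) {k : ℝ} (hk : 0 < k) :
    HasDerivAt (fun k => tilt ρ₀ h φ k / tilt ρ₀ h (fun _ => 1) k)
      (-∫ x, φ x * (h x - mean (gibbs ρ₀ h k) h) ∂(law (gibbs ρ₀ h k))) k := by
  obtain ⟨B, hB0, hB⟩ := hφ.exists_bound
  have hhm := hh.contDiff.continuous.measurable
  have hφm := hφ.continuous.measurable
  have hC := hh.nonneg
  have hZ := hρ₀.tilt_one_pos hhm ha0 ha hk.le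
  have hφB : ∀ x, |φ x| ≤ B * (1 + ‖x‖) ^ 0 := fun x => by simpa using (hB x).1
  have h1 := hρ₀.hasDerivAt_tilt hh hφm ha0 ha hB0.le hφB hk
  have h2 := hρ₀.hasDerivAt_tilt (f := fun _ => 1) (M := 1) (n := 0) hh measurable_const ha0 ha
    zero_le_one (by simp) hk
  have hφh : ∀ x, |h x * φ x| ≤ C * B * (1 + ‖x‖) ^ 2 := fun x => by
    rw [abs_mul]
    calc |h x| * |φ x| ≤ (C * (1 + ‖x‖) ^ 2) * B :=
          mul_le_mul (hh.bound x) (hB x).1 (abs_nonneg _) (by positivity)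
      _ = _ := by ring
  have i1 : Integrable (fun x => h x * φ x) _ :=
    hρ₀.integrable_gibbs hhm (hhm.mul hφm) ha0 ha (by positivity) hφh hk.le
  have i2 := hρ₀.integrable_gibbs hhm hφm ha0 ha hB0.le hφB hk.le
  -- By the quotient rule the derivative is minus the covariance of φ and h under the tilted law.
  refine (h1.div h2 hZ.ne').congr_deriv ?_
  have e : ∀ x, φ x * (h x - mean (gibbs ρ₀ h k) h)
      = h x * φ x - mean (gibbs ρ₀ h k) h * φ x := fun x => by ring
  simp_rw [e]
  rw [integral_sub i1 (i2.const_mul _), integral_const_mul, mean,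
    hρ₀.integral_gibbs hhm ha0 ha hk.le, hρ₀.integral_gibbs hhm ha0 ha hk.le,
    hρ₀.integral_gibbs hhm ha0 ha hk.le]
  simp only [mul_one]
  field_simp
  ring

/-- The second moment of h is a quotient of continuous tilts over a compact interval, and it
dominates the variance. This puts the source term of the divergence equation in L² of space-time. -/
theorem AssumptionA1.exists_variance_bound (hρ₀ : AssumptionA1 ρ₀) (hh : QuadGrowth C h)
    (ha0 : 0 ≤ a) (ha : ∀ x, -(a * (1 + ‖x‖)) ≤ h x) (L : ℝ) :
    ∃ M, ∀ k ∈ Icc 0 L, MemLp h 2 (law (gibbs ρ₀ h k)) ∧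
      ∫ x, (h x - mean (gibbs ρ₀ h k) h) ^ 2 ∂(law (gibbs ρ₀ h k)) ≤ M := by
  have hhm := hh.contDiff.continuous.measurable
  have hC := hh.nonneg
  have hsq : ∀ x, |h x ^ 2| ≤ C ^ 2 * (1 + ‖x‖) ^ 4 := fun x => by
    rw [abs_pow]
    calc |h x| ^ 2 ≤ (C * (1 + ‖x‖) ^ 2) ^ 2 := by gcongr; exact hh.bound x
      _ = _ := by ring
  have h1 := hρ₀.continuousOn_tilt hhm (hhm.pow_const 2) ha0 ha (by positivity) hsq L
  have h2 := hρ₀.continuousOn_tilt (f := fun _ => 1) (M := 1) (n := 0) hhm measurable_const ha0 ha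
    zero_le_one (by simp) L
  obtain ⟨M, hM⟩ := isCompact_Icc.exists_bound_of_continuousOn
    (h1.div h2 fun k hk => (hρ₀.tilt_one_pos hhm ha0 ha hk.1).ne')
  refine ⟨M, fun k hk => ?_⟩
  have hprob := (hρ₀.isDensity_gibbs hhm ha0 ha hk.1).isProbabilityMeasure
  have hi := hρ₀.integrable_gibbs hhm (hhm.pow_const 2) ha0 ha (by positivity) hsq hk.1
  have hmem : MemLp h 2 (law (gibbs ρ₀ h k)) :=
    (memLp_two_iff_integrable_sq hhm.aestronglyMeasurable).2 hi
  refine ⟨hmem, ?_⟩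
  have h3 := integral_sq_sub hmem (memLp_const (1 : ℝ)) (mean (gibbs ρ₀ h k) h)
  have h4 := (le_abs_self _).trans (hM k hk)
  simp only [Pi.div_apply] at h4
  rw [← hρ₀.integral_gibbs hhm ha0 ha hk.1] at h4
  have h5 : ∫ x, h x ∂(law (gibbs ρ₀ h k)) = mean (gibbs ρ₀ h k) h := rfl
  simp only [mul_one, one_pow, integral_const, probReal_univ, smul_eq_mul, h5] at h3
  rw [h3]
  nlinarith [sq_nonneg (mean (gibbs ρ₀ h k) h)]

/-- The tilted densities are driven by controls that solve the control law. -/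
theorem AssumptionA1.exists_isAdmissible (hρ₀ : AssumptionA1 ρ₀) (hh : QuadGrowth C h)
    (hr : ∃ c : ℝ, ∀ᶠ x in cocompact (E d), c ≤ fderiv ℝ h x x / ‖x‖)
    {β t T : ℝ} (hβ : 0 < β) (htT : t ≤ T) :
    ∃ ρ u, IsAdmissible t T ρ₀ ρ u ∧
      ∀ᵐ s ∂(volume.restrict (Icc t T)), SolvesControlPDE β h (ρ s) (u s) := by
  obtain ⟨a, ha0, ha⟩ := exists_linear_lower_bound' hh.contDiff hr
  have hhm := hh.contDiff.continuous.measurable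
  set L := β * (T - t) with hLdef
  have hL : 0 ≤ L := mul_nonneg hβ.le (by linarith)
  -- The maximum keeps the tilt nonnegative at every real time, so the laws form a Markov kernel
  -- even outside [t,T].
  let k : ℝ → ℝ := fun s => β * max 0 (s - t)
  have hkm : Measurable k := by fun_prop
  have hk0 : ∀ s, 0 ≤ k s := fun s => mul_nonneg hβ.le (le_max_left _ _)
  have hkt : ∀ s, t ≤ s → k s = β * (s - t) := fun s hs => by
    simp only [k, max_eq_right (sub_nonneg.2 hs)]
  have hkL : ∀ s ∈ Icc t T, k s ∈ Icc 0 L := fun s hs => ⟨hk0 s, by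
    rw [hkt s hs.1]
    exact mul_le_mul_of_nonneg_left (by linarith [hs.2]) hβ.le⟩
  let ρ : ℝ → E d → ℝ := fun s => gibbs ρ₀ h (k s)
  have hm : Measurable (Function.uncurry ρ) :=
    (measurable_gibbs hρ₀.density.measurable hhm).comp
      ((hkm.comp measurable_fst).prodMk measurable_snd)
  have hden : ∀ s, IsDensity (ρ s) := fun s => hρ₀.isDensity_gibbs hhm ha0 ha (hk0 s)
  have hprob : ∀ s, IsProbabilityMeasure (law (ρ s)) := fun s => (hden s).isProbabilityMeasure
  have hmarkov : ProbabilityTheory.IsMarkovKernel (lawKernel ρ) :=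
    ⟨fun s => by rw [lawKernel_apply hm]; exact hprob s⟩
  have hfin : IsFiniteMeasure ((volume.restrict (Icc t T)).compProd (lawKernel ρ)) := inferInstance
  obtain ⟨M, hM⟩ := hρ₀.exists_variance_bound hh ha0 ha L
  obtain ⟨K, -, hK⟩ := hρ₀.exists_poincare hh hr hL
  let w : ℝ × E d → ℝ := fun p => β * (h p.2 - mean (ρ p.1) h)
  have hmean : Measurable fun s => mean (ρ s) h :=
    (stronglyMeasurable_integral_law hm hhm).measurable
  have hwm : Measurable w := ((hhm.comp measurable_snd).sub
    (hmean.comp measurable_fst)).const_mul β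
  have hcent : ∀ s ∈ Icc t T, MemLp (fun x => h x - mean (ρ s) h) 2 (law (ρ s)) := fun s hs =>
    (hM (k s) (hkL s hs)).1.sub (memLp_const _)
  have hw : MemLp w 2 ((volume.restrict (Icc t T)).compProd (lawKernel ρ)) := by
    rw [memLp_two_iff_integrable_sq hwm.aestronglyMeasurable]
    refine integrable_spaceTime_of_bound hm (hwm.pow_const 2) (fun z => sq_nonneg _)
      (M := β ^ 2 * M) (fun s hs => ?_) (fun s hs => ?_)
    · exact ((hcent s hs).const_mul β).integrable_sq
    · simp only [w, mul_pow]
      rw [integral_const_mul]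
      exact mul_le_mul_of_nonneg_left (hM (k s) (hkL s hs)).2 (sq_nonneg _)
  have hmem := ae_restrict_mem (μ := (volume : Measure ℝ)) (measurableSet_Icc (a := t) (b := T))
  obtain ⟨u, hum, hu2, hu⟩ := exists_control (κ := lawKernel ρ) hw (C := K)
    (ae_of_all _ fun s => hmarkov.isProbabilityMeasure s)
    (by
      filter_upwards [hmem] with s hs
      rw [lawKernel_apply hm]
      simp only [w]
      rw [integral_const_mul, integral_sub ((hM (k s) (hkL s hs)).1.integrable (by norm_num))
        (integrable_const _)]
      simp [mean, ρ])
    (by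
      filter_upwards [hmem] with s hs φ hφ
      obtain ⟨c, hc⟩ := hK (k s) (hkL s hs) φ hφ
      refine ⟨c, ?_⟩
      have hZ := hρ₀.tilt_one_pos hhm ha0 ha (hk0 s)
      rw [lawKernel_apply hm, hρ₀.integral_gibbs hhm ha0 ha (hk0 s),
        hρ₀.integral_gibbs hhm ha0 ha (hk0 s), ← mul_div_assoc]
      refine div_le_div_of_nonneg_right ?_ hZ.le
      simpa only [tilt, mul_comm] using hc)
  simp_rw [lawKernel_apply hm] at hu
  refine ⟨ρ, fun s x => u (s, x), ⟨hm, hum, fun s _ => hden s, ?_, ?_, ?_⟩, hu⟩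
  · simp only [ρ, hkt t le_rfl, sub_self, mul_zero]
    exact hρ₀.gibbs_zero
  · rw [← lintegral_spaceTime (f := fun p => ‖u p‖ₑ ^ 2) hm (by fun_prop)]
    have := lintegral_rpow_enorm_lt_top_of_eLpNorm_lt_top (by norm_num) (by norm_num) hu2.2
    simp only [ENNReal.toReal_ofNat, ENNReal.rpow_ofNat] at this
    exact this
  · intro φ hφ s hs
    obtain ⟨B, hB0, hB⟩ := hφ.exists_bound
    have hφm := hφ.continuous.measurable
    have hC := hh.nonneg
    let F : ℝ → ℝ := fun k => tilt ρ₀ h φ k / tilt ρ₀ h (fun _ => 1) k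
    let G : ℝ → ℝ := fun k =>
      -∫ x, φ x * (h x - mean (gibbs ρ₀ h k) h) ∂(law (gibbs ρ₀ h k))
    have hφB : ∀ x, |φ x| ≤ B * (1 + ‖x‖) ^ 0 := fun x => by simpa using (hB x).1
    have hc1 := hρ₀.continuousOn_tilt (f := fun _ => 1) (M := 1) (n := 0) hhm measurable_const
      ha0 ha zero_le_one (by simp) L
    have hFc : ContinuousOn F (Icc 0 L) :=
      (hρ₀.continuousOn_tilt hhm hφm ha0 ha hB0.le hφB L).div hc1
        fun k hk => (hρ₀.tilt_one_pos hhm ha0 ha hk.1).ne'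
    have hkc : ContinuousOn (fun s => β * (s - t)) (Icc t s) := by fun_prop
    have hmaps : MapsTo (fun s => β * (s - t)) (Icc t s) (Icc 0 L) := fun r hr => by
      have hr' : r ∈ Icc t T := ⟨hr.1, hr.2.trans hs.2⟩
      have := hkL r hr'
      rwa [hkt r hr.1] at this
    have hder : ∀ r ∈ Ioo t s, HasDerivAt (fun r => F (β * (r - t))) (G (β * (r - t)) * β) r := by
      intro r hr
      have h1 := hρ₀.hasDerivAt_integral_gibbs hh ha0 ha hφ (mul_pos hβ (sub_pos.2 hr.1))
      have h2 : HasDerivAt (fun r => β * (r - t)) β r := by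
        simpa using ((hasDerivAt_id r).sub_const t).const_mul β
      exact h1.comp r h2
    -- The control was built so that its flux against φ is minus the pairing of φ with w, which is
    -- the time derivative of the expectation of φ.
    have hae : ∀ᵐ r ∂(volume.restrict (Icc t T)), G (β * (r - t)) * β
        = ∫ x, fderiv ℝ φ x (u (r, x)) ∂(law (ρ r)) := by
      filter_upwards [hu, hmem] with r hr hrm
      have h1 := hr.2.2 φ hφ
      rw [← neg_eq_iff_eq_neg] at h1
      rw [← h1]
      simp only [G, w, ← hkt r hrm.1]
      rw [neg_mul, mul_comm, ← integral_const_mul]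
      congr 2
      ext x
      ring
    have hmw : Integrable (fun p : ℝ × E d => φ p.2 * w p)
        ((volume.restrict (Icc t T)).compProd (lawKernel ρ)) :=
      (hw.integrable (by norm_num)).bdd_mul (c := B)
        (hφ.continuous.comp continuous_snd).aestronglyMeasurable
        (ae_of_all _ fun p => (hB p.2).1)
    have hGi : IntegrableOn (fun r => G (β * (r - t)) * β) (Icc t T) := by
      refine (integrable_spaceTime hm hmw).2.neg.congr ?_
      filter_upwards [hae, hu] with r hr hr'
      rw [hr, Pi.neg_apply, hr'.2.2 φ hφ, neg_neg]
    have hsub : Icc t s ⊆ Icc t T := Icc_subset_Icc_right hs.2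
    have hint : IntervalIntegrable (fun r => G (β * (r - t)) * β) volume t s :=
      (intervalIntegrable_iff_integrableOn_Icc_of_le hs.1).2 (hGi.mono_set hsub)
    -- This form asks for derivatives only in the open interval and continuity up to the ends, as
    -- the tilt is differentiable only for k > 0.
    have hftc := intervalIntegral.integral_eq_sub_of_hasDerivAt_of_le hs.1
      (hFc.comp hkc hmaps) hder hint
    have e1 : ∀ r, t ≤ r → ∫ x, φ x ∂(law (ρ r)) = F (β * (r - t)) := fun r hr => by
      simp only [ρ]
      rw [hρ₀.integral_gibbs hhm ha0 ha (hk0 r), hkt r hr]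
    rw [e1 s hs.1, e1 t le_rfl]
    refine hftc.symm.trans ?_
    refine intervalIntegral.integral_congr_ae ?_
    rw [uIoc_of_le hs.1, ← ae_restrict_iff' measurableSet_Ioc]
    exact ae_mono (Measure.restrict_mono (Ioc_subset_Icc_self.trans hsub) le_rfl) hae

end GibbsPath

/-! ### Optimal pairs and the value function. -/

section ValueFunction

variable {ρ₀ h : E d → ℝ} {C β t T : ℝ}

theorem AssumptionA1.exists_isOptimal (hρ₀ : AssumptionA1 ρ₀) (hh : QuadGrowth C h)
    (hr : ∃ c : ℝ, ∀ᶠ x in cocompact (E d), c ≤ fderiv ℝ h x x / ‖x‖)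
    (hβ : 0 < β) (htT : t ≤ T) :
    ∃ ρ u, IsOptimal β h t T ρ₀ ρ u ∧
      cost β h t T ρ u = ((β * ∫ x, h x ∂(law ρ₀) : ℝ) : EReal) := by
  obtain ⟨a, ha0, hlow⟩ := exists_linear_lower_bound' hh.contDiff hr
  obtain ⟨ρ, u, ha, hpde⟩ := hρ₀.exists_isAdmissible hh hr hβ htT
  have hc := ha.cost_eq_of_solvesControlPDE hρ₀ htT hβ hh hpde ha0 hlow
  exact ⟨ρ, u, ⟨ha, fun ρ' u' ha' => hc.le.trans (ha'.le_cost htT hβ hh)⟩, hc⟩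

/-- Since the lower bound is attained, optimality amounts to a cost of at most β ∫ h ρ₀, and this is
the case of equality treated above. -/
theorem AssumptionA1.isOptimal_iff (hρ₀ : AssumptionA1 ρ₀) (hh : QuadGrowth C h)
    (hr : ∃ c : ℝ, ∀ᶠ x in cocompact (E d), c ≤ fderiv ℝ h x x / ‖x‖)
    (hβ : 0 < β) (htT : t ≤ T) {ρ : ℝ → E d → ℝ} {u : ℝ → E d → E d}
    (ha : IsAdmissible t T ρ₀ ρ u) :
    IsOptimal β h t T ρ₀ ρ u ↔
      ∀ᵐ s ∂(volume.restrict (Icc t T)), SolvesControlPDE β h (ρ s) (u s) := by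
  constructor
  · intro ho
    obtain ⟨ρ', u', ho', hc⟩ := hρ₀.exists_isOptimal hh hr hβ htT
    exact ha.solvesControlPDE_of_cost_le htT hβ hh ((ho.2 _ _ ho'.1).trans hc.le)
  · intro hpde
    obtain ⟨a, ha0, hlow⟩ := exists_linear_lower_bound' hh.contDiff hr
    have hc := ha.cost_eq_of_solvesControlPDE hρ₀ htT hβ hh hpde ha0 hlow
    exact ⟨ha, fun ρ' u' ha' => hc.le.trans (ha'.le_cost htT hβ hh)⟩

theorem AssumptionA1.valueFunction_eq (hρ₀ : AssumptionA1 ρ₀) (hh : QuadGrowth C h)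
    (hr : ∃ c : ℝ, ∀ᶠ x in cocompact (E d), c ≤ fderiv ℝ h x x / ‖x‖)
    (hβ : 0 < β) (htT : t ≤ T) :
    valueFunction β h T ρ₀ t = ((β * ∫ x, h x ∂(law ρ₀) : ℝ) : EReal) := by
  refine le_antisymm ?_ (le_iInf₂ fun ρ u => le_iInf fun ha => ha.le_cost htT hβ hh)
  obtain ⟨ρ, u, ho, hc⟩ := hρ₀.exists_isOptimal hh hr hβ htT
  rw [← hc]
  exact iInf₂_le_of_le ρ u (iInf_le _ ho.1)

end ValueFunction

end

section

/-! ### The derivative of a linear functional of the density -/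

section Gateaux

variable {h ρ : E d → ℝ} {C : ℝ}

/-- Expectations of functions whose gradient vanishes on the supports of the velocity fields are
constant along a variation. -/
theorem IsVariation.integral_eq {ε : ℝ} {path : ℝ → E d → ℝ} {u : ℝ → E d → E d}
    (hv : IsVariation ρ ε path u) {f : E d → ℝ} (hf : QuadGrowth C f)
    (hfu : ∀ n, ∀ s ∈ Ioo (-ε) ε, ∀ x, fderiv ℝ (fun y => cutoff n y * f y) x (u s x) = 0)
    {s : ℝ} (hs : s ∈ Ioo (-ε) ε) :
    ∫ x, f x ∂(law (path s)) = ∫ x, f x ∂(law ρ) := by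
  have h0 : (0 : ℝ) ∈ Ioo (-ε) ε := ⟨by linarith [hv.pos], hv.pos⟩
  have hconst : ∀ n, ∫ x, cutoff n x * f x ∂(law (path s)) = ∫ x, cutoff n x * f x ∂(law ρ) := by
    intro n
    have hder : ∀ r ∈ Ioo (-ε) ε, HasDerivAt (fun r => ∫ x, cutoff n x * f x ∂(law (path r))) 0 r :=
      fun r hr => by
        have := hv.continuity _ (isTest_cutoff_mul n hf.contDiff) r hr
        simpa only [hfu n r hr, integral_zero] using this
    have := isOpen_Ioo.is_const_of_fderiv_eq_zero (𝕜 := ℝ) isPreconnected_Ioo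
      (fun r hr => (hder r hr).differentiableAt.differentiableWithinAt)
      (fun r hr => by
        rw [(hder r hr).hasFDerivAt.fderiv]
        ext
        simp) hs h0
    simpa only [hv.initial] using this
  have key : ∀ ρ' : E d → ℝ, AssumptionA1 ρ' →
      Tendsto (fun n => ∫ x, cutoff n x * f x ∂(law ρ')) atTop (𝓝 (∫ x, f x ∂(law ρ'))) := by
    intro ρ' h'
    have := tendsto_integral_cutoff_mul (μ := law ρ') (f := f) (g := fun _ => 1)
      (by simpa using h'.integrable_of_pow hf.contDiff.continuous.aestronglyMeasurable 2 hf.bound)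
    simpa using this
  exact tendsto_nhds_unique (key _ (hv.density s hs))
    ((key _ (hv.initial ▸ hv.density 0 h0)).congr fun n => (hconst n).symm)

/-- Split h by a cutoff equal to 1 near the common support K of the velocity fields. The inner part
is a test function, to which the definition of a variation applies; the outer part vanishes near K,
so its expectation is constant along the variation. -/
theorem AssumptionA1.hasGateauxDeriv (hρ : AssumptionA1 ρ) (hh : QuadGrowth C h) (β : ℝ) :
    HasGateauxDeriv (fun ρ' => β * ∫ x, h x ∂(law ρ')) ρ (fun x => β * h x) := by
  refine ⟨(hρ.memLp_two hh).const_mul β, fun ε path u g hv hg hg2 => ?_⟩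
  have h0 : (0 : ℝ) ∈ Ioo (-ε) ε := ⟨by linarith [hv.pos], hv.pos⟩
  obtain ⟨K, hK, hKu⟩ := hv.support
  obtain ⟨R, hR⟩ := hK.isBounded.exists_norm_le
  obtain ⟨N, hN⟩ := exists_nat_gt R
  have hnear : ∀ x ∈ K, ∀ᶠ y in 𝓝 x, cutoff N y = 1 := fun x hx => by
    have : ∀ᶠ y in 𝓝 x, ‖y‖ < N :=
      (continuous_norm.tendsto x).eventually (gt_mem_nhds ((hR x hx).trans_lt hN))
    filter_upwards [this] with y hy
    exact cutoff_eq_one (by linarith)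
  have hχ : IsTest (fun x => cutoff N x * h x) := isTest_cutoff_mul N hh.contDiff
  have hχ' : IsTest (fun x => cutoff N x * -h x) := isTest_cutoff_mul N hh.contDiff.neg
  obtain ⟨C', hC'⟩ := hχ'.quadGrowth
  have hf : QuadGrowth (C + 1 * C') (fun x => h x + 1 * (cutoff N x * -h x)) :=
    hh.add_smul hC' ⟨zero_le_one, le_rfl⟩
  -- This is h times one minus the cutoff; the factor 1 is the parameter of `QuadGrowth.add_smul`.
  set f : E d → ℝ := fun x => h x + 1 * (cutoff N x * -h x) with hfdef
  have hfu : ∀ n, ∀ s ∈ Ioo (-ε) ε, ∀ x,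
      fderiv ℝ (fun y => cutoff n y * f y) x (u s x) = 0 := by
    intro n s hs x
    by_cases hx : x ∈ K
    · have : (fun y => cutoff n y * f y) =ᶠ[𝓝 x] fun _ => 0 := by
        filter_upwards [hnear x hx] with y hy
        simp [hfdef, hy]
      simp [this.fderiv_eq]
    · rw [hKu s hs x hx, map_zero]
  have hsplit : ∀ ρ', AssumptionA1 ρ' → ∫ x, h x ∂(law ρ')
      = ∫ x, cutoff N x * h x ∂(law ρ') + ∫ x, f x ∂(law ρ') := by
    intro ρ' h'
    have := h'.density.isProbabilityMeasure
    rw [← integral_add]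
    · refine integral_congr_ae (ae_of_all _ fun x => ?_)
      simp only [hfdef]
      ring
    · obtain ⟨C₁, h₁⟩ := hχ.quadGrowth
      exact h'.integrable_of_pow hχ.continuous.aestronglyMeasurable 2 h₁.bound
    · exact h'.integrable_of_pow hf.contDiff.continuous.aestronglyMeasurable 2 hf.bound
  have hder := (hv.continuity _ hχ 0 h0).add_const (∫ x, f x ∂(law ρ))
  have hval : ∫ x, fderiv ℝ (fun y => cutoff N y * h y) x (u 0 x) ∂(law (path 0))
      = -∫ x, h x * g x ∂(law ρ) := by
    have hhg : Integrable (fun x => h x * g x) (law ρ) := (hρ.memLp_two hh).integrable_mul hg2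
    have hfg : Integrable (fun x => f x * g x) (law ρ) := (hρ.memLp_two hf).integrable_mul hg2
    have e1 : ∫ x, f x * g x ∂(law ρ) = 0 := by
      refine tendsto_nhds_unique (tendsto_integral_cutoff_mul hfg) ?_
      refine tendsto_const_nhds.congr fun n => ?_
      rw [hg.2.2 _ (isTest_cutoff_mul n hf.contDiff)]
      simp_rw [hfu n 0 h0]
      simp
    have e2 : ∫ x, h x * g x ∂(law ρ) = ∫ x, cutoff N x * h x * g x ∂(law ρ) := by
      rw [← sub_eq_zero, ← integral_sub hhg (hχ.integrable_mul hg.2.1), ← e1]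
      refine integral_congr_ae (ae_of_all _ fun x => ?_)
      simp only [hfdef]
      ring
    rw [e2, hg.2.2 _ hχ, neg_neg, hv.initial]
  rw [hval] at hder
  have hfin := (hder.const_mul β).congr_of_eventuallyEq
    (f₁ := fun s => β * ∫ x, h x ∂(law (path s))) (by
      filter_upwards [isOpen_Ioo.mem_nhds h0] with s hs
      rw [hsplit _ (hv.density s hs), hv.integral_eq hf hfu hs])
  refine hfin.congr_deriv ?_
  simp_rw [mul_assoc]
  rw [integral_const_mul]
  ring

/-- Variations consist of densities satisfying (A1), so only the values of the functional there
enter. -/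
theorem HasGateauxDeriv.congr {F G : (E d → ℝ) → ℝ} {Θ : E d → ℝ} (hF : HasGateauxDeriv F ρ Θ)
    (hFG : ∀ ρ', AssumptionA1 ρ' → G ρ' = F ρ') : HasGateauxDeriv G ρ Θ := by
  refine ⟨hF.1, fun ε path u g hv hg hg2 => ?_⟩
  have h0 : (0 : ℝ) ∈ Ioo (-ε) ε := ⟨by linarith [hv.pos], hv.pos⟩
  refine (hF.2 ε path u g hv hg hg2).congr_of_eventuallyEq ?_
  filter_upwards [isOpen_Ioo.mem_nhds h0] with s hs
  exact hFG _ (hv.density s hs)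

end Gateaux

/-! ### Functions with vanishing weak gradient -/

/-- The derivative of a mollification of q is q paired with a derivative of a smooth bump, hence
zero. Mollifications are therefore constant, and they converge to q almost everywhere. -/
theorem exists_ae_eq_const {q : E d → ℝ} (hq : LocallyIntegrable q)
    (h : ∀ (ψ : E d → ℝ) (v : E d), ContDiff ℝ ((⊤ : ℕ∞) : WithTop ℕ∞) ψ → HasCompactSupport ψ →
      ∫ x, q x * fderiv ℝ ψ x v = 0) :
    ∃ c, ∀ᵐ x, q x = c := by
  let φ : ℕ → ContDiffBump (0 : E d) := fun n =>
    ⟨((n : ℝ) + 1)⁻¹, 2 * ((n : ℝ) + 1)⁻¹, by positivity, by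
      have : (0 : ℝ) < ((n : ℝ) + 1)⁻¹ := by positivity
      linarith⟩
  have hlim : Tendsto (fun n => (φ n).rOut) atTop (𝓝 0) := by
    have := (tendsto_one_div_add_atTop_nhds_zero_nat (𝕜 := ℝ)).const_mul 2
    simpa [φ, one_div] using this
  have hae := ContDiffBump.ae_convolution_tendsto_right_of_locallyIntegrable (μ := volume)
    (φ := φ) (K := 2) hlim (Eventually.of_forall fun n => le_rfl) hq
  let L : ℝ →L[ℝ] ℝ →L[ℝ] ℝ := ContinuousLinearMap.lsmul ℝ ℝ
  have hconst : ∀ n x, MeasureTheory.convolution ((φ n).normed volume) q L volume x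
      = MeasureTheory.convolution ((φ n).normed volume) q L volume 0 := by
    intro n x
    rw [← convolution_flip]
    have hsmooth : ContDiff ℝ ((⊤ : ℕ∞) : WithTop ℕ∞) ((φ n).normed volume) :=
      (φ n).contDiff_normed
    have hc : HasCompactSupport ((φ n).normed volume) := (φ n).hasCompactSupport_normed
    have h1 : ContDiff ℝ 1 ((φ n).normed volume) := (φ n).contDiff_normed
    have hder : ∀ y, HasFDerivAt (𝕜 := ℝ)
        (MeasureTheory.convolution q ((φ n).normed volume) L.flip volume)
        (0 : E d →L[ℝ] ℝ) y := by
      intro y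
      have h5 := hc.hasFDerivAt_convolution_right (𝕜 := ℝ) (μ := volume) L.flip hq h1 y
      refine h5.congr_fderiv (ContinuousLinearMap.ext fun v => ?_)
      rw [convolution_precompR_apply L.flip hq (hc.fderiv ℝ) (h1.continuous_fderiv (by norm_num)),
        convolution_def]
      have h2 := h (fun t => (φ n).normed volume (y - t)) v
        (hsmooth.comp (contDiff_const.sub contDiff_id))
        (hc.comp_homeomorph (Homeomorph.subLeft y))
      have h3 : ∀ t, fderiv ℝ (fun t => (φ n).normed volume (y - t)) t v
          = -fderiv ℝ ((φ n).normed volume) (y - t) v := by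
        intro t
        have h4 : HasFDerivAt (fun t => (φ n).normed volume (y - t)) _ t :=
          (h1.differentiable (by norm_num) (y - t)).hasFDerivAt.comp t
            ((hasFDerivAt_id t).const_sub y)
        rw [h4.fderiv]
        simp
      simp_rw [h3, mul_neg] at h2
      rw [integral_neg, neg_eq_zero] at h2
      refine (integral_congr_ae (ae_of_all _ fun t => ?_)).trans h2
      simp [L, mul_comm]
    exact is_const_of_fderiv_eq_zero (fun y => (hder y).differentiableAt)
      (fun y => (hder y).fderiv) x 0
  obtain ⟨x₀, hx₀⟩ := hae.exists
  refine ⟨q x₀, ?_⟩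
  filter_upwards [hae] with x hx
  refine tendsto_nhds_unique hx (hx₀.congr fun n => ?_)
  exact (hconst n x₀).trans (hconst n x).symm

/-! ### The Hamiltonian -/

section Hamiltonian

variable {β C c : ℝ} {h ρ g Θ : E d → ℝ} {u : E d → E d}

theorem AssumptionA1.integrable_norm_mul (hρ : AssumptionA1 ρ) (hu : MemLp u 2 (law ρ)) :
    Integrable (fun x => (1 + ‖x‖) * ‖u x‖) (law ρ) := by
  have hprob := hρ.density.isProbabilityMeasure
  have h1 : MemLp (fun x : E d => 1 + ‖x‖) 2 (law ρ) := by
    rw [memLp_two_iff_integrable_sq (by fun_prop)]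
    exact hρ.integrable_of_pow (C := 1) (by fun_prop) 2 fun x => by
      rw [abs_of_nonneg (by positivity), one_mul]
  exact h1.integrable_mul hu.norm

/-- The additive constant c drops out because g has mean zero, and the term linear in βh supplies
exactly the cross term that completes the square. -/
theorem AssumptionA1.hamiltonian_eq (hρ : AssumptionA1 ρ) (hh : QuadGrowth C h)
    (hΘ : ∀ᵐ x ∂(law ρ), Θ x = β * h x + c) (hu : MemLp u 2 (law ρ))
    (hg : HasWeightedDiv ρ u g) (hg2 : MemLp g 2 (law ρ)) :
    hamiltonian β h ρ Θ u
      = ((1 / 2 * ∫ x, (g x - β * (h x - mean ρ h)) ^ 2 ∂(law ρ) : ℝ) : EReal) := by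
  have hprob := hρ.density.isProbabilityMeasure
  have hu1 := hρ.integrable_norm_mul hu
  have hh2 := hρ.memLp_two hh
  have hw : MemLp (fun x => h x - mean ρ h) 2 (law ρ) := hh2.sub (memLp_const _)
  have hgi : Integrable g (law ρ) := hg2.integrable (by norm_num)
  have hhg : Integrable (fun x => h x * g x) (law ρ) := hh2.integrable_mul hg2
  have e0 : ∫ x, g x ∂(law ρ) = 0 := by
    simpa using hg.integral_eq hu1 (QuadGrowth.const (d := d) 1) (by simpa using hgi)
  have e1 := hg.integral_eq hu1 hh hhg
  have e2 := hg.integral_centred hu1 hh hg2 hw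
  have e3 : ∫ x, Θ x * weightedDiv ρ u x ∂(law ρ) = β * ∫ x, h x * g x ∂(law ρ) := by
    have e4 : ∫ x, Θ x * weightedDiv ρ u x ∂(law ρ)
        = ∫ x, (β * (h x * g x) + c * g x) ∂(law ρ) := by
      refine integral_congr_ae ?_
      filter_upwards [hΘ, (weightedDiv_spec ⟨g, hg⟩).ae_eq hg] with x h1 h2
      rw [h1, h2]
      ring
    rw [e4, integral_add (hhg.const_mul β) (hgi.const_mul c), integral_const_mul,
      integral_const_mul, e0, mul_zero, add_zero]
  rw [hamiltonian, e3, lagrangian_eq hg hg2 hw, EReal.coe_ennreal_ofReal, max_eq_left,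
    ← EReal.coe_sub, integral_sq_sub hg2 hw, e2, e1]
  · congr 1
    ring
  · have h1 : 0 ≤ ∫ x, g x ^ 2 ∂(law ρ) := integral_nonneg fun _ => sq_nonneg _
    have h2 : 0 ≤ ∫ x, (h x - mean ρ h) ^ 2 ∂(law ρ) := integral_nonneg fun _ => sq_nonneg _
    positivity

/-- The Hamiltonian is half the squared residual when the Lagrangian is finite, and ⊤ otherwise. In
the latter case the control law fails, since its solutions have finite Lagrangian. -/
theorem AssumptionA1.hamiltonian_nonneg (hρ : AssumptionA1 ρ) (hh : QuadGrowth C h) (hβ : 0 < β)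
    (hΘ : ∀ᵐ x ∂(law ρ), Θ x = β * h x + c) (hu : MemLp u 2 (law ρ)) :
    0 ≤ hamiltonian β h ρ Θ u ∧ (hamiltonian β h ρ Θ u = 0 ↔ SolvesControlPDE β h ρ u) := by
  have hprob := hρ.density.isProbabilityMeasure
  have hw : MemLp (fun x => h x - mean ρ h) 2 (law ρ) := (hρ.memLp_two hh).sub (memLp_const _)
  by_cases hL : lagrangian β h ρ u = ⊤
  · have htop : hamiltonian β h ρ Θ u = ⊤ := by
      rw [hamiltonian, hL, EReal.coe_ennreal_top, EReal.top_sub_coe]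
    rw [htop]
    refine ⟨le_top, fun h => absurd h (by simp), fun hs => ?_⟩
    rw [lagrangian_eq hs (hw.const_mul β) hw] at hL
    exact absurd hL ENNReal.ofReal_ne_top
  · obtain ⟨hg, hg2, -⟩ := exists_of_lagrangian_ne_top hβ hh.contDiff.continuous.measurable hL
    have key := hρ.hamiltonian_eq hh hΘ hu hg hg2
    have hnn : 0 ≤ ∫ x, (weightedDiv ρ u x - β * (h x - mean ρ h)) ^ 2 ∂(law ρ) :=
      integral_nonneg fun _ => sq_nonneg _
    refine ⟨?_, fun h0 => ?_, fun hs => ?_⟩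
    · rw [key]
      exact_mod_cast (by positivity : 0 ≤ 1 / 2 * ∫ x, (weightedDiv ρ u x
        - β * (h x - mean ρ h)) ^ 2 ∂(law ρ))
    · rw [key] at h0
      have h1 : 1 / 2 * ∫ x, (weightedDiv ρ u x - β * (h x - mean ρ h)) ^ 2 ∂(law ρ) = 0 := by
        exact_mod_cast h0
      have h2 : ∫ x, (weightedDiv ρ u x - β * (h x - mean ρ h)) ^ 2 ∂(law ρ) = 0 := by linarith
      have hi : Integrable (fun x => (weightedDiv ρ u x - β * (h x - mean ρ h)) ^ 2) (law ρ) :=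
        (hg2.sub (hw.const_mul β)).integrable_sq
      rw [integral_eq_zero_iff_of_nonneg (fun _ => sq_nonneg _) hi] at h2
      refine hg.congr ?_
      filter_upwards [h2] with x hx
      exact sub_eq_zero.1 (pow_eq_zero_iff (two_ne_zero) |>.1 hx)
    · rw [hρ.hamiltonian_eq hh hΘ hu hs (hw.const_mul β)]
      simp

theorem AssumptionA1.minHamiltonian_eq_zero (hρ : AssumptionA1 ρ) (hh : QuadGrowth C h)
    (hr : ∃ c : ℝ, ∀ᶠ x in cocompact (E d), c ≤ fderiv ℝ h x x / ‖x‖) (hβ : 0 < β)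
    (hΘ : ∀ᵐ x ∂(law ρ), Θ x = β * h x + c) : minHamiltonian β h ρ Θ = 0 := by
  obtain ⟨u, hu, hs⟩ := hρ.exists_solvesControlPDE hh hr β
  refine le_antisymm ?_ (le_iInf₂ fun u hu => (hρ.hamiltonian_nonneg hh hβ hΘ hu).1)
  rw [← (hρ.hamiltonian_nonneg hh hβ hΘ hu).2.2 hs]
  exact iInf₂_le u hu

end Hamiltonian

end

section

/-! ### Compactly supported perturbations of a density -/

section Perturbation

variable {ρ f ψ : E d → ℝ}

/-- Factoring out ρ = exp(-V), the perturbed potential is V - log(1 + s f exp(V)). It differs from V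
by a compactly supported C² function, so the Hessian bound and the radial growth persist. A bound B
for |f| exp(V) gives the admissible range (B+1)⁻¹ of s. -/
theorem AssumptionA1.exists_perturbation (hρ : AssumptionA1 ρ) (hf : ContDiff ℝ 2 f)
    (hc : HasCompactSupport f) (hf0 : ∫ x, f x = 0) :
    ∃ ε, 0 < ε ∧ ∀ s ∈ Ioo (-ε) ε, AssumptionA1 (fun x => ρ x + s * f x) ∧
      ∀ x, 0 < ρ x + s * f x := by
  obtain ⟨V, hV, hexp, ⟨C, hC⟩, hrad⟩ := hρ.exp_form
  have hq : ContDiff ℝ 2 fun x => f x * Real.exp (V x) := hf.mul hV.exp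
  obtain ⟨B, hB⟩ := hq.continuous.bounded_above_of_compact_support hc.mul_right
  have hB0 : 0 ≤ B := (norm_nonneg _).trans (hB 0)
  refine ⟨(B + 1)⁻¹, by positivity, fun s hs => ?_⟩
  have hsB : |s| * B < 1 := by
    have h1 : |s| < (B + 1)⁻¹ := abs_lt.2 hs
    calc |s| * B ≤ |s| * (B + 1) := by gcongr; linarith
      _ < (B + 1)⁻¹ * (B + 1) := by gcongr
      _ = 1 := inv_mul_cancel₀ (by positivity)
  have hpos : ∀ x, 0 < 1 + s * (f x * Real.exp (V x)) := fun x => by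
    have h1 : |s * (f x * Real.exp (V x))| ≤ |s| * B := by
      rw [abs_mul]
      exact mul_le_mul_of_nonneg_left (hB x) (abs_nonneg _)
    have h2 := neg_abs_le (s * (f x * Real.exp (V x)))
    linarith
  have hfac : ∀ x, ρ x + s * f x = ρ x * (1 + s * (f x * Real.exp (V x))) := fun x => by
    rw [hexp]
    have : Real.exp (-V x) * Real.exp (V x) = 1 := by rw [← Real.exp_add]; simp
    linear_combination (-(s * f x)) * this
  have hρpos : ∀ x, 0 < ρ x := fun x => by rw [hexp]; exact Real.exp_pos _
  have hspos : ∀ x, 0 < ρ x + s * f x := fun x => by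
    rw [hfac]
    exact mul_pos (hρpos x) (hpos x)
  let η : E d → ℝ := fun x => -Real.log (1 + s * (f x * Real.exp (V x)))
  have hη : ContDiff ℝ 2 η :=
    ((contDiff_const.add (contDiff_const.mul hq)).log fun x => (hpos x).ne').neg
  have hηc : HasCompactSupport η := by
    refine hc.mono fun x hx => ?_
    contrapose! hx
    simp only [Function.mem_support, not_not] at hx ⊢
    simp [η, hx]
  refine ⟨⟨⟨?_, fun x => (hspos x).le, ?_, ?_, ?_⟩, fun x => V x + η x, hV.add hη, ?_, ?_, ?_⟩,
    hspos⟩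
  · exact hρ.density.measurable.add (hf.continuous.measurable.const_mul s)
  · exact hρ.density.integrable.add ((hf.continuous.integrable_of_hasCompactSupport hc).const_mul s)
  · rw [integral_add hρ.density.integrable
      ((hf.continuous.integrable_of_hasCompactSupport hc).const_mul s), integral_const_mul, hf0,
      hρ.density.integral_eq_one, mul_zero, add_zero]
  · have h1 : Integrable (fun x => ‖x‖ ^ 2 * (s * f x)) :=
      ((continuous_norm.pow 2).mul (continuous_const.mul hf.continuous)
        ).integrable_of_hasCompactSupport (hc.mul_left.mul_left)
    refine (hρ.density.second_moment.add h1).congr (ae_of_all _ fun x => ?_)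
    simp only [Pi.add_apply]
    ring
  · intro x
    rw [hfac, hexp, neg_add, Real.exp_add]
    simp only [η, neg_neg]
    rw [Real.exp_log (hpos x)]
  · obtain ⟨B', hB'⟩ := (hη.continuous_iteratedFDeriv (m := 2) le_rfl
      ).bounded_above_of_compact_support (hηc.iteratedFDeriv 2)
    refine ⟨C + B', fun x => ?_⟩
    have h1 := iteratedFDeriv_add_apply (i := 2) (𝕜 := ℝ) (hV.contDiffAt (x := x)) hη.contDiffAt
    change iteratedFDeriv ℝ 2 (fun x => V x + η x) x = _ at h1
    rw [h1]
    exact (norm_add_le _ _).trans (add_le_add (hC x) (hB' x))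
  · refine hrad.congr' ?_
    filter_upwards [hηc.isCompact.compl_mem_cocompact] with x hx
    have h1 : (fun x => V x + η x) =ᶠ[𝓝 x] V := by
      filter_upwards [notMem_tsupport_iff_eventuallyEq.1 hx] with y hy
      rw [hy]
      simp
    rw [h1.fderiv_eq]

theorem IsTest.integral_mul_fderiv {φ : E d → ℝ} (hφ : ContDiff ℝ 1 φ) (hψ : IsTest ψ) (v : E d) :
    ∫ x, φ x * fderiv ℝ ψ x v = -∫ x, ψ x * fderiv ℝ φ x v := by
  have hψ' : Continuous fun x => fderiv ℝ ψ x v := hψ.continuous_fderiv.clm_apply continuous_const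
  have hφ' : Continuous fun x => fderiv ℝ φ x v :=
    (hφ.continuous_fderiv (by norm_num)).clm_apply continuous_const
  have hψc : HasCompactSupport fun x => fderiv ℝ ψ x v := hψ.2.fderiv_apply ℝ v
  rw [integral_mul_fderiv_eq_neg_fderiv_mul_of_integrable
    ((hφ'.mul hψ.continuous).integrable_of_hasCompactSupport hψ.2.mul_left)
    ((hφ.continuous.mul hψ').integrable_of_hasCompactSupport hψc.mul_left)
    ((hφ.continuous.mul hψ.continuous).integrable_of_hasCompactSupport hψ.2.mul_left)
    (fun x _ => hφ.differentiable (by norm_num) x)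
    (fun x _ => hψ.1.differentiable (by norm_num) x)]
  simp_rw [mul_comm]

/-- Transport of `ρ` along the momentum field `ψ v`, as a variation. -/
theorem AssumptionA1.exists_isVariation (hρ : AssumptionA1 ρ)
    (hψ : ContDiff ℝ ((⊤ : ℕ∞) : WithTop ℕ∞) ψ) (hψc : HasCompactSupport ψ) (v : E d) :
    ∃ ε path u, IsVariation ρ ε path u ∧
      HasWeightedDiv ρ (u 0) (fun x => fderiv ℝ ψ x v / ρ x) := by
  have hψt : IsTest ψ := IsTest.of_contDiff hψ hψc
  have hψ3 : ContDiff ℝ 3 ψ := contDiff_infty.1 hψ 3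
  let f : E d → ℝ := fun x => -fderiv ℝ ψ x v
  have hf : ContDiff ℝ 2 f :=
    ((hψ3.fderiv_right (m := 2) (by norm_num)).clm_apply contDiff_const).neg
  have hfc : HasCompactSupport f := (hψc.fderiv_apply ℝ v).comp_left neg_zero
  have hf0 : ∫ x, f x = 0 := by
    have := hψt.integral_mul_fderiv (φ := fun _ => (1 : ℝ)) contDiff_const v
    simp only [one_mul, fderiv_const_apply] at this
    simp [f, integral_neg, this]
  obtain ⟨ε, hε, hall⟩ := hρ.exists_perturbation hf hfc hf0
  -- Dividing by the current density makes the momentum ρ_s u_s equal to ψ v at all s, so the path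
  -- is affine in s with slope minus the divergence of ψ v.
  let u : ℝ → E d → E d := fun s x => (ψ x / (ρ x + s * f x)) • v
  have h0 : (0 : ℝ) ∈ Ioo (-ε) ε := ⟨by linarith, hε⟩
  obtain ⟨V, hV, hexp, -⟩ := hρ.exp_form
  have hρc : Continuous ρ := by
    rw [show ρ = fun x => Real.exp (-V x) from funext hexp]
    exact hV.continuous.neg.rexp
  have huc : ∀ s ∈ Ioo (-ε) ε, Continuous (u s) := fun s hs =>
    (hψ.continuous.div (hρc.add (continuous_const.mul hf.continuous))
      fun x => ((hall s hs).2 x).ne').smul continuous_const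
  have hflux : ∀ s ∈ Ioo (-ε) ε, ∀ φ : E d → ℝ,
      ∫ x, fderiv ℝ φ x (u s x) ∂(law fun x => ρ x + s * f x) = ∫ x, ψ x * fderiv ℝ φ x v := by
    intro s hs φ
    have h1 := hall s hs
    rw [integral_law h1.1.density.measurable h1.1.density.nonneg]
    refine integral_congr_ae (ae_of_all _ fun x => ?_)
    simp only [u, map_smul, smul_eq_mul]
    have := (h1.2 x).ne'
    field_simp
  have hpath0 : (fun x => ρ x + 0 * f x) = ρ := by simp
  refine ⟨ε, fun s x => ρ x + s * f x, u, ⟨hε, fun s hs => (hall s hs).1, hpath0, huc,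
    ⟨tsupport ψ, hψc, fun s _ x hx => ?_⟩, fun φ hφ s hs => ?_⟩, ?_⟩
  · simp [u, image_eq_zero_of_notMem_tsupport hx]
  · rw [hflux s hs]
    have h1 : ∀ r ∈ Ioo (-ε) ε, ∫ x, φ x ∂(law fun x => ρ x + r * f x)
        = (∫ x, ρ x * φ x) + r * ∫ x, f x * φ x := by
      intro r hr
      have h2 := (hall r hr).1.density
      rw [integral_law h2.measurable h2.nonneg, ← integral_const_mul, ← integral_add]
      · refine integral_congr_ae (ae_of_all _ fun x => ?_)
        simp only
        ring
      · exact (hρc.mul hφ.continuous).integrable_of_hasCompactSupport hφ.2.mul_left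
      · exact ((hf.continuous.mul hφ.continuous).integrable_of_hasCompactSupport
          hφ.2.mul_left).const_mul r
    have h3 : HasDerivAt (fun r => (∫ x, ρ x * φ x) + r * ∫ x, f x * φ x) (∫ x, f x * φ x) s := by
      simpa using ((hasDerivAt_id s).mul_const (∫ x, f x * φ x)).const_add (∫ x, ρ x * φ x)
    have h4 : ∫ x, f x * φ x = ∫ x, ψ x * fderiv ℝ φ x v := by
      rw [← neg_eq_iff_eq_neg.2 (hψt.integral_mul_fderiv hφ.1 v), ← integral_neg]
      refine integral_congr_ae (ae_of_all _ fun x => ?_)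
      simp only [f]
      ring
    rw [← h4]
    refine h3.congr_of_eventuallyEq ?_
    filter_upwards [isOpen_Ioo.mem_nhds hs] with r hr
    exact h1 r hr
  · have hprob := hρ.density.isProbabilityMeasure
    have hρne : ∀ x, ρ x ≠ 0 := fun x => by rw [hexp]; exact (Real.exp_pos _).ne'
    have hgc : Continuous fun x => fderiv ℝ ψ x v / ρ x :=
      (hψt.continuous_fderiv.clm_apply continuous_const).div hρc hρne
    refine ⟨(huc 0 h0).locallyIntegrable, hgc.locallyIntegrable, fun φ hφ => ?_⟩
    have h1 := hflux 0 h0 φ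
    rw [hpath0] at h1
    rw [h1, ← hψt.integral_mul_fderiv hφ.1 v,
      integral_law hρ.density.measurable hρ.density.nonneg]
    refine integral_congr_ae (ae_of_all _ fun x => ?_)
    have := hρne x
    simp only
    field_simp

/-- The derivative of a functional is determined up to an additive constant. -/
theorem AssumptionA1.exists_gateauxDeriv_eq_add_const (hρ : AssumptionA1 ρ)
    {F : (E d → ℝ) → ℝ} {Θ Θ' : E d → ℝ} (hΘ : HasGateauxDeriv F ρ Θ)
    (hΘ' : HasGateauxDeriv F ρ Θ') : ∃ c, ∀ᵐ x ∂(law ρ), Θ x = Θ' x + c := by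
  have hprob := hρ.density.isProbabilityMeasure
  have hm := hρ.density.measurable
  have h0 := hρ.density.nonneg
  obtain ⟨V, hV, hexp, -⟩ := hρ.exp_form
  have hρc : Continuous ρ := by
    rw [show ρ = fun x => Real.exp (-V x) from funext hexp]
    exact hV.continuous.neg.rexp
  have hρne : ∀ x, ρ x ≠ 0 := fun x => by rw [hexp]; exact (Real.exp_pos _).ne'
  have hq2 : MemLp (fun x => Θ x - Θ' x) 2 (law ρ) := hΘ.1.sub hΘ'.1
  -- Since ρ is continuous and positive, integrability for the law gives local integrability for
  -- Lebesgue measure.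
  have hloc : LocallyIntegrable fun x => Θ x - Θ' x := by
    have h1 := (integrable_law_iff hm h0).1 (hq2.integrable (by norm_num))
    have h2 := h1.locallyIntegrable.mul_continuous (hρc.inv₀ hρne)
    refine h2.congr (ae_of_all _ fun x => ?_)
    have := hρne x
    simp only [Pi.inv_apply]
    field_simp
  -- Along the variation with momentum ψ v the weight ρ cancels, and equality of the two derivatives
  -- says that Θ - Θ' is orthogonal to every directional derivative of ψ.
  obtain ⟨c, hc⟩ := exists_ae_eq_const hloc fun ψ v hψ hψc => by
    obtain ⟨ε, path, u, hv, hg⟩ := hρ.exists_isVariation hψ hψc v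
    have hψt : IsTest ψ := IsTest.of_contDiff hψ hψc
    have hgc : Continuous fun x => fderiv ℝ ψ x v / ρ x :=
      (hψt.continuous_fderiv.clm_apply continuous_const).div hρc hρne
    have hg2 : MemLp (fun x => fderiv ℝ ψ x v / ρ x) 2 (law ρ) := by
      have hcs : HasCompactSupport fun x => fderiv ℝ ψ x v / ρ x := by
        simp_rw [div_eq_mul_inv]
        exact (hψc.fderiv_apply ℝ v).mul_right
      exact hgc.memLp_of_hasCompactSupport hcs
    have h1 := (hΘ.2 ε path u _ hv hg hg2).unique (hΘ'.2 ε path u _ hv hg hg2)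
    have h2 : ∫ x, (Θ x - Θ' x) * (fderiv ℝ ψ x v / ρ x) ∂(law ρ) = 0 := by
      have i1 : Integrable (fun x => Θ x * (fderiv ℝ ψ x v / ρ x)) (law ρ) :=
        hΘ.1.integrable_mul hg2
      have i2 : Integrable (fun x => Θ' x * (fderiv ℝ ψ x v / ρ x)) (law ρ) :=
        hΘ'.1.integrable_mul hg2
      simp_rw [sub_mul]
      rw [integral_sub i1 i2, sub_eq_zero]
      exact neg_injective h1
    rw [integral_law hm h0] at h2
    rw [← h2]
    refine integral_congr_ae (ae_of_all _ fun x => ?_)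
    have := hρne x
    simp only
    field_simp
  refine ⟨c, (withDensity_absolutelyContinuous _ _).ae_le ?_⟩
  filter_upwards [hc] with x hx
  linarith

end Perturbation

end

/-! ### The dynamic programming equation -/

/-- The functional does not depend on time, and every representative of its derivative is βh plus a
constant, for which the infimum of the Hamiltonian is 0. -/
theorem solvesDP_linear {β C T : ℝ} {h : E d → ℝ} (hh : QuadGrowth C h)
    (hr : ∃ c : ℝ, ∀ᶠ x in cocompact (E d), c ≤ fderiv ℝ h x x / ‖x‖) (hβ : 0 < β) :
    SolvesDP β h T (fun ρ _ => β * ∫ x, h x ∂(law ρ)) := by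
  refine ⟨fun ρ hρ t _ => ⟨⟨_, hρ.hasGateauxDeriv hh β⟩, 0, hasDerivWithinAt_const _ _ _,
    fun Θ hΘ => ?_⟩, fun ρ _ => rfl⟩
  obtain ⟨c, hc⟩ := hρ.exists_gateauxDeriv_eq_add_const hΘ (hρ.hasGateauxDeriv hh β)
  rw [hρ.minHamiltonian_eq_zero hh hr hβ hc, EReal.coe_zero, add_zero]

/-- The equation sees only densities satisfying (A1) and times in [0,T], the range on which the
value function is identified with the linear functional. -/
theorem SolvesDP.congr {β T : ℝ} {h : E d → ℝ} {W W' : (E d → ℝ) → ℝ → ℝ}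
    (hW : SolvesDP β h T W) (hT : 0 ≤ T)
    (hWW' : ∀ ρ, AssumptionA1 ρ → ∀ t ∈ Icc 0 T, W' ρ t = W ρ t) : SolvesDP β h T W' := by
  refine ⟨fun ρ hρ t ht => ?_, fun ρ hρ => (hWW' ρ hρ T ⟨hT, le_rfl⟩).trans (hW.2 ρ hρ)⟩
  have ht' := Ico_subset_Icc_self ht
  obtain ⟨⟨Θ, hΘ⟩, a, ha, hdp⟩ := hW.1 ρ hρ t ht
  refine ⟨⟨Θ, hΘ.congr fun ρ' h' => hWW' ρ' h' t ht'⟩, a,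
    ha.congr (fun s hs => hWW' ρ hρ s hs) (hWW' ρ hρ t ht'), fun Θ hΘ => hdp Θ ?_⟩
  exact hΘ.congr fun ρ' h' => (hWW' ρ' h' t ht').symm

end MeanFieldControl

/-! ### The main theorem. -/

theorem theorem2 (d : ℕ) (hd : 0 < d) (β T : ℝ) (hβ : 0 < β) (hT : 0 < T)
    (p₀ h : MeanFieldControl.E d → ℝ)
    (hp₀ : MeanFieldControl.AssumptionA1 p₀) (hh : MeanFieldControl.AssumptionA2 p₀ h) :
    -- the value function is finite and solves the dynamic programming equation
    (MeanFieldControl.SolvesDP β h T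
        (fun ρ t => (MeanFieldControl.valueFunction β h T ρ t).toReal)) ∧
    -- its explicit form
    (∀ ρ : MeanFieldControl.E d → ℝ, MeanFieldControl.AssumptionA1 ρ → ∀ t ∈ Set.Icc 0 T,
      MeanFieldControl.valueFunction β h T ρ t
        = ((β * ∫ x, h x ∂(MeanFieldControl.law ρ) : ℝ) : EReal)) ∧
    -- the explicit functional solves the dynamic programming equation, with derivative `β h`
    (MeanFieldControl.SolvesDP β h T
        (fun ρ _ => β * ∫ x, h x ∂(MeanFieldControl.law ρ))) ∧
    (∀ ρ : MeanFieldControl.E d → ℝ, MeanFieldControl.AssumptionA1 ρ → ∀ t ∈ Set.Ico 0 T,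
      MeanFieldControl.HasGateauxDeriv
        (fun ρ' => (MeanFieldControl.valueFunction β h T ρ' t).toReal) ρ (fun x => β * h x)) ∧
    -- the minimizers in the dynamic programming equation exist, and are exactly
    -- the solutions in `L²(ρ)` of the control law
    (∀ ρ : MeanFieldControl.E d → ℝ, MeanFieldControl.AssumptionA1 ρ → ∀ t ∈ Set.Ico 0 T,
      ∀ Θ : MeanFieldControl.E d → ℝ,
        MeanFieldControl.HasGateauxDeriv
          (fun ρ' => (MeanFieldControl.valueFunction β h T ρ' t).toReal) ρ Θ →
        (∃ u, MeasureTheory.MemLp u 2 (MeanFieldControl.law ρ) ∧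
          MeanFieldControl.hamiltonian β h ρ Θ u = MeanFieldControl.minHamiltonian β h ρ Θ) ∧
        ∀ u, MeasureTheory.MemLp u 2 (MeanFieldControl.law ρ) →
          (MeanFieldControl.hamiltonian β h ρ Θ u = MeanFieldControl.minHamiltonian β h ρ Θ ↔
            MeanFieldControl.SolvesControlPDE β h ρ u)) ∧
    -- optimal controls on `[t,T]` exist, and are exactly those that solve the control law
    (∀ ρ₀ : MeanFieldControl.E d → ℝ, MeanFieldControl.AssumptionA1 ρ₀ → ∀ t ∈ Set.Icc 0 T,
      (∃ ρ u, MeanFieldControl.IsOptimal β h t T ρ₀ ρ u) ∧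
      ∀ ρ u, MeanFieldControl.IsAdmissible t T ρ₀ ρ u →
        (MeanFieldControl.IsOptimal β h t T ρ₀ ρ u ↔
          ∀ᵐ s ∂(MeasureTheory.volume.restrict (Set.Icc t T)),
            MeanFieldControl.SolvesControlPDE β h (ρ s) (u s))) ∧
    -- in particular for the problem on `[0,T]` started at the prior `p₀`
    ((∃ ρ u, MeanFieldControl.IsOptimal β h 0 T p₀ ρ u ∧
        MeanFieldControl.cost β h 0 T ρ u
          = ((β * ∫ x, h x ∂(MeanFieldControl.law p₀) : ℝ) : EReal)) ∧
      ∀ ρ u, MeanFieldControl.IsAdmissible 0 T p₀ ρ u →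
        (MeanFieldControl.IsOptimal β h 0 T p₀ ρ u ↔
          ∀ᵐ s ∂(MeasureTheory.volume.restrict (Set.Icc 0 T)),
            MeanFieldControl.SolvesControlPDE β h (ρ s) (u s))) := by
  obtain ⟨C, hq⟩ := MeanFieldControl.exists_quadGrowth hh.contDiff hh.hessian_bounded
  have hr := hh.liminf_radial
  have hV : ∀ ρ : MeanFieldControl.E d → ℝ, MeanFieldControl.AssumptionA1 ρ →
      ∀ t ∈ Set.Icc 0 T, MeanFieldControl.valueFunction β h T ρ t
        = ((β * ∫ x, h x ∂(MeanFieldControl.law ρ) : ℝ) : EReal) := fun ρ hρ t ht =>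
    hρ.valueFunction_eq hq hr hβ ht.2
  have hV' : ∀ ρ : MeanFieldControl.E d → ℝ, MeanFieldControl.AssumptionA1 ρ →
      ∀ t ∈ Set.Icc 0 T, (MeanFieldControl.valueFunction β h T ρ t).toReal
        = β * ∫ x, h x ∂(MeanFieldControl.law ρ) := fun ρ hρ t ht => by
    rw [hV ρ hρ t ht, EReal.toReal_coe]
  have hlin := MeanFieldControl.solvesDP_linear (T := T) hq hr hβ
  have hG : ∀ ρ : MeanFieldControl.E d → ℝ, MeanFieldControl.AssumptionA1 ρ →
      ∀ t ∈ Set.Ico 0 T, MeanFieldControl.HasGateauxDeriv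
        (fun ρ' => (MeanFieldControl.valueFunction β h T ρ' t).toReal) ρ (fun x => β * h x) :=
    fun ρ hρ t ht => (hρ.hasGateauxDeriv hq β).congr fun ρ' h' =>
      hV' ρ' h' t (Set.Ico_subset_Icc_self ht)
  refine ⟨hlin.congr hT.le hV', hV, hlin, hG, fun ρ hρ t ht Θ hΘ => ?_, fun ρ₀ hρ₀ t ht => ?_, ?_⟩
  · obtain ⟨c, hc⟩ := hρ.exists_gateauxDeriv_eq_add_const hΘ (hG ρ hρ t ht)
    rw [hρ.minHamiltonian_eq_zero hq hr hβ hc]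
    obtain ⟨u, hu, hs⟩ := hρ.exists_solvesControlPDE hq hr β
    exact ⟨⟨u, hu, (hρ.hamiltonian_nonneg hq hβ hc hu).2.2 hs⟩,
      fun u hu => (hρ.hamiltonian_nonneg hq hβ hc hu).2⟩
  · obtain ⟨ρ, u, ho, -⟩ := hρ₀.exists_isOptimal hq hr hβ ht.2
    exact ⟨⟨ρ, u, ho⟩, fun ρ u ha => hρ₀.isOptimal_iff hq hr hβ ht.2 ha⟩
  · exact ⟨hp₀.exists_isOptimal hq hr hβ hT.le,
      fun ρ u ha => hp₀.isOptimal_iff hq hr hβ hT.le ha⟩
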